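/- Let $M$ be a connected smooth surface, let $X:M\to\mathbb R^3$ be a smooth immersion and give $M$ the induced metric $g$, so that $X$ is an isometric immersion. Suppose that $X$ is developable, that is, its Gauss curvature vanishes identically. Let $f:M\to(0,\infty)$ be smooth, and suppose that $X$ is proper $f$-biharmonic, that is, $$\tau_{2,f}(X)=f\,\tau_2(X)+(\Delta f)\,\tau(X)+2\nabla_{\operatorname{grad} f}\,\tau(X)=0,$$ but $X$ is not biharmonic ($\tau_2(X)\not\equiv 0$). Here $\tau(X)=\Delta X$ is the tension field, $\tau_2(X)=\Delta\tau(X)$ is the bitension field, and $\Delta$ is the Laplace–Beltrami operator of $g$ (acting componentwise). Then $X$ is (a part of) a cylinder: there are a unit vector $b\in\mathbb R^3$, an open interval $I$ and a smooth curve $a:I\to\mathbb R^3$ parametrized by arc length with $a'\perp b$, such that near every point of $M$ one has $X=a(\sigma)+\nu\, b$ with smooth functions $\sigma$ (with values in $I$) and $\nu$. Moreover, $I$, $a$ and $b$ can be chosen so that one of the following holds. 1. The cylinder is circular: the directrix $a$ lies on a circle in a plane perpendicular to $b$. 2. With respect to an orthonormal Frenet frame $(T,N,B)$ along $a$, with $T=a'$,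 $T'=\kappa N$, $N'=-\kappa T+\tau B$, $B'=-\tau N$, the directrix $a$ has torsion $\tau=0$ and nonconstant (signed) curvature $\kappa(s)=\kappa_N(s,K)$ for some constant $K\in\mathbb R$, where $$\kappa_N(s,K)=\begin{cases}\dfrac{1}{C_1e^{2\sqrt{-K}\,s}+C_2e^{-2\sqrt{-K}\,s}+\sqrt{4C_1C_2+\frac1K}}, & K<0,\\[2ex] \dfrac{4C_3}{16+C_3^2(s+C_4)^2}, & K=0,\\[2ex] \dfrac{1}{C_4\cos(2\sqrt K\,s)+C_5\sin(2\sqrt K\,s)+\sqrt{\frac1K+C_4^2+C_5^2}}, & K>0,\end{cases}$$ with real constants $C_1,\dots,C_5$, where $4C_1C_2+\frac1K\ge 0$ if $K<0$. -/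

import Mathlib

open scoped Manifold ContDiff Matrix

noncomputable section

/-- The coordinate plane. -/
abbrev E2 : Type := EuclideanSpace ℝ (Fin 2)

/-- Euclidean three-space. -/
abbrev E3 : Type := EuclideanSpace ℝ (Fin 3)

namespace Surf

section Coordinates

variable {V : Type*} [NormedAddCommGroup V] [NormedSpace ℝ V]

/-- The partial derivative `∂ᵢ u`. -/
def pd (i : Fin 2) (u : E2 → V) (x : E2) : V :=
  fderiv ℝ u x (EuclideanSpace.single i 1)

/-- The Laplace-Beltrami operator of the metric with coefficient matrix `g`:
`Δ u = (det g)^(-1/2) ∑ᵢ ∂ᵢ (∑ⱼ (det g)^(1/2) gⁱʲ ∂ⱼ u)`, for real or vector valued `u`. -/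
def laplacian (g : E2 → Matrix (Fin 2) (Fin 2) ℝ) (u : E2 → V) (x : E2) : V :=
  (Real.sqrt (g x).det)⁻¹ •
    ∑ i, pd i (fun y => ∑ j, (Real.sqrt (g y).det * (g y)⁻¹ i j) • pd j u y) x

/-- The derivative `∇_{grad f} u` of a vector valued function along the gradient of `f`:
`∑ᵢⱼ gⁱʲ (∂ⱼ f) ∂ᵢ u`. -/
def derivAlongGrad (g : E2 → Matrix (Fin 2) (Fin 2) ℝ) (f : E2 → ℝ) (u : E2 → V) (x : E2) : V :=
  ∑ i, ∑ j, ((g x)⁻¹ i j * pd j f x) • pd i u x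

end Coordinates

/-- The tension field `Trace_g ∇dφ` of a map into Euclidean space, in coordinates on the source. -/
def tension (g : E2 → Matrix (Fin 2) (Fin 2) ℝ) (φ : E2 → E3) : E2 → E3 :=
  laplacian g φ

/-- The bitension field; the curvature term is absent since the target is flat, and the connection
of the pulled back tangent bundle is the componentwise derivative. -/
def bitension (g : E2 → Matrix (Fin 2) (Fin 2) ℝ) (φ : E2 → E3) : E2 → E3 :=
  laplacian g (tension g φ)

/-- The `f`-bitension field `f τ₂(φ) + (Δ f) τ(φ) + 2 ∇_{grad f} τ(φ)`. -/
def fBitension (g : E2 → Matrix (Fin 2) (Fin 2) ℝ) (f : E2 → ℝ) (φ : E2 → E3) (x : E2) : E3 :=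
  f x • bitension g φ x + laplacian g f x • tension g φ x
    + (2 : ℝ) • derivAlongGrad g f (tension g φ) x

/-- The first fundamental form of a parametrized surface, i.e. its induced metric. -/
def firstForm (r : E2 → E3) (x : E2) : Matrix (Fin 2) (Fin 2) ℝ :=
  Matrix.of fun i j => inner ℝ (pd i r x) (pd j r x)

/-- The unit normal `∂₀ r × ∂₁ r / |∂₀ r × ∂₁ r|` of a parametrized surface. -/
def unitNormal (r : E2 → E3) (x : E2) : E3 :=
  let n : E3 := WithLp.toLp 2 ((pd 0 r x).ofLp ⨯₃ (pd 1 r x).ofLp)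
  ‖n‖⁻¹ • n

/-- The second fundamental form of a parametrized surface. -/
def secondForm (r : E2 → E3) (x : E2) : Matrix (Fin 2) (Fin 2) ℝ :=
  Matrix.of fun i j => inner ℝ (pd i (pd j r) x) (unitNormal r x)

/-- The Gauss curvature of a parametrized surface. -/
def gaussCurvature (r : E2 → E3) (x : E2) : ℝ :=
  (secondForm r x).det / (firstForm r x).det

section Surfaces

variable {M : Type*} [TopologicalSpace M] [ChartedSpace E2 M]

/-- A smooth immersion of a surface into three-space. -/
def IsSmoothImmersion (X : M → E3) : Prop :=
  ContMDiff 𝓘(ℝ, E2) 𝓘(ℝ, E3) ∞ X ∧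
    ∀ p : M, Function.Injective (mfderiv 𝓘(ℝ, E2) 𝓘(ℝ, E3) X p)

/-- An immersed surface is developable if its Gauss curvature vanishes identically. -/
def IsDevelopable (X : M → E3) : Prop :=
  ∀ e ∈ atlas E2 M, ∀ x ∈ e.target, gaussCurvature (X ∘ e.symm) x = 0

/-- `X`, regarded as an isometric immersion (the source carries the induced metric),
is a biharmonic map. -/
def IsBiharmonic (X : M → E3) : Prop :=
  ∀ e ∈ atlas E2 M, ∀ x ∈ e.target,
    bitension (firstForm (X ∘ e.symm)) (X ∘ e.symm) x = 0

/-- `X`, regarded as an isometric immersion (the source carries the induced metric),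
is an `f`-biharmonic map. -/
def IsFBiharmonic (f : M → ℝ) (X : M → E3) : Prop :=
  ∀ e ∈ atlas E2 M, ∀ x ∈ e.target,
    fBitension (firstForm (X ∘ e.symm)) (f ∘ e.symm) (X ∘ e.symm) x = 0

/-- Proper `f`-biharmonic: `f`-biharmonic but not biharmonic. -/
def IsProperFBiharmonic (f : M → ℝ) (X : M → E3) : Prop :=
  IsFBiharmonic f X ∧ ¬ IsBiharmonic X

/-- The immersed surface `X` is (a part of) the cylinder `(s, v) ↦ a(s) + v b`, `s ∈ I`, whose
directrix `a` is a smooth curve on the open interval `I`, parametrized by arc length and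
perpendicular to the unit vector `b`: around every point there are smooth functions `σ`, `ν` with
`X = a(σ) + ν b`. (As `X` is an immersion, `(σ, ν)` is then a local coordinate system.) -/
structure IsCylinder (X : M → E3) (I : Set ℝ) (a : ℝ → E3) (b : E3) : Prop where
  isOpen : IsOpen I
  ordConnected : I.OrdConnected
  smooth : ContDiffOn ℝ ∞ a I
  norm_deriv : ∀ s ∈ I, ‖deriv a s‖ = 1
  norm_dir : ‖b‖ = 1
  perp : ∀ s ∈ I, inner ℝ (deriv a s) b = 0
  repr : ∀ p : M, ∃ U : Set M, IsOpen U ∧ p ∈ U ∧ ∃ σ ν : M → ℝ,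
    ContMDiffOn 𝓘(ℝ, E2) 𝓘(ℝ, ℝ) ∞ σ U ∧ ContMDiffOn 𝓘(ℝ, E2) 𝓘(ℝ, ℝ) ∞ ν U ∧
    ∀ q ∈ U, σ q ∈ I ∧ X q = a (σ q) + ν q • b

end Surfaces

/-- The arc length parametrized curve `a` on `I` has curvature `κ` and torsion `τ` with respect to
an orthonormal Frenet frame `T = a'`, `N`, `B`:
`T' = κ N`, `N' = -κ T + τ B`, `B' = -τ N`.
The curvature is signed: replacing `N`, `B` by their negatives replaces `κ` by `-κ`. -/
def HasFrenetCurvatures (I : Set ℝ) (a : ℝ → E3) (κ τ : ℝ → ℝ) : Prop :=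
  ∃ T N B : ℝ → E3, ∀ s ∈ I,
    Orthonormal ℝ ![T s, N s, B s] ∧
    HasDerivAt a (T s) s ∧
    HasDerivAt T (κ s • N s) s ∧
    HasDerivAt N (-(κ s • T s) + τ s • B s) s ∧
    HasDerivAt B (-(τ s • N s)) s

/-- On `I` the curve `a` runs on a circle of positive radius in a plane perpendicular to `b`. -/
def IsCircular (I : Set ℝ) (a : ℝ → E3) (b : E3) : Prop :=
  ∃ (c : E3) (r : ℝ), 0 < r ∧ ∀ s ∈ I, ‖a s - c‖ = r ∧ inner ℝ (a s - c) b = 0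

/-- The function `κ_N(s, K)` with constants `C₁, …, C₅`. -/
def kappaN (K C₁ C₂ C₃ C₄ C₅ s : ℝ) : ℝ :=
  if K < 0 then
    1 / (C₁ * Real.exp (2 * Real.sqrt (-K) * s) + C₂ * Real.exp (-(2 * Real.sqrt (-K) * s))
      + Real.sqrt (4 * C₁ * C₂ + 1 / K))
  else if K = 0 then
    4 * C₃ / (16 + C₃ ^ 2 * (s + C₄) ^ 2)
  else
    1 / (C₄ * Real.cos (2 * Real.sqrt K * s) + C₅ * Real.sin (2 * Real.sqrt K * s)
      + Real.sqrt (1 / K + (C₄ ^ 2 + C₅ ^ 2)))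

end Surf

end

/-! The product rule for the Laplacian turns the `f`-bitension field into `Δ(f τ)`, so the
hypothesis says that the vector function `F = f τ` is harmonic componentwise
(`fBitension_eq_laplacian`). For an immersion `τ` is a multiple of the unit normal `n`.

Local structure where `τ ≠ 0`. Flatness makes the Gauss map have rank one: `dn = α t` for a unit
vector `t`, and the rulings have direction `b = n × t` with `db = μ t`. Symmetry of the second
derivatives of `n` makes the one-forms `α` and `μ` proportional. Since `dF` has no `b` component,
harmonicity of `F` makes them orthogonal. As `α ≠ 0`, `μ = 0` and `b` is constant
(`exists_ruling_direction`). The surface is then locally `a(σ) + ν b` with metric `dσ² + dν²`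
(`exists_cylinderChart`), and `F = φ N` with `φ = f κ` is harmonic for the flat Laplacian. Its
tangential component separates the variables of `φ`; its normal component becomes `4 - 2 y y'' + y'²
= 4 K y²` for the radius of curvature `y = 1/κ` (`harmonic_normal`, `radius_ode`). A first integral
`C` reduces this to `y'' = -4 K y + 2 C`, whose solutions are, up to sign, the functions `1/κ_N`.

Globalization. Solutions of the linear equation live on all of `ℝ`, and the first integral gives
`y'² = -4` at a zero of `y`, so `κ` extends without poles or zeros to an analytic function on `ℝ`.
Each local piece thus lies on the cylinder over a complete `Directrix`
(`exists_directrix_extension`). Analyticity of `κ` and uniqueness for the Frenet equations show that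
overlapping complete cylinders coincide (`Directrix.congruent`).

It remains to rule out points with `τ = 0`. On a represented piece `|τ| = |κ(σ)|`, and `log(1 + y²)`
has bounded derivative, so `|τ|` stays away from zero along a segment (`Directrix.tension_ne_zero`).
Hence the set represented by one directrix is closed as well as open, and connectedness gives all of
`M`. Constant `κ` is the circular case; otherwise the profile is nonconstant. -/

noncomputable section

namespace Surf

open Filter Topology

/-! ### Partial derivatives on the coordinate plane -/

section PartialDerivatives

variable {V : Type*} [NormedAddCommGroup V] [NormedSpace ℝ V] {u v : E2 → V} {x : E2} {i j : Fin 2}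

theorem pd_congr (h : u =ᶠ[𝓝 x] v) : pd i u x = pd i v x := by
  simp only [pd, h.fderiv_eq]

theorem eventuallyEq_pd (h : u =ᶠ[𝓝 x] v) : pd i u =ᶠ[𝓝 x] pd i v :=
  h.eventuallyEq_nhds.mono fun _ hy => pd_congr hy

theorem contDiffAt_pd (hu : ContDiffAt ℝ ∞ u x) : ContDiffAt ℝ ∞ (pd i u) x :=
  (hu.fderiv_right (m := ∞) (by simp)).clm_apply contDiffAt_const

theorem _root_.ContDiffAt.differentiableAt_of_infty {E F : Type*} [NormedAddCommGroup E]
    [NormedSpace ℝ E] [NormedAddCommGroup F] [NormedSpace ℝ F] {u : E → F} {x : E}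
    (hu : ContDiffAt ℝ ∞ u x) : DifferentiableAt ℝ u x :=
  hu.differentiableAt (by simp)

theorem pd_add (hu : DifferentiableAt ℝ u x) (hv : DifferentiableAt ℝ v x) :
    pd i (fun y => u y + v y) x = pd i u x + pd i v x := by
  simp only [pd, fderiv_fun_add hu hv, add_apply]

theorem pd_sub (hu : DifferentiableAt ℝ u x) (hv : DifferentiableAt ℝ v x) :
    pd i (fun y => u y - v y) x = pd i u x - pd i v x := by
  simp only [pd, fderiv_fun_sub hu hv, sub_apply]

theorem pd_const (c : V) : pd i (fun _ => c) x = 0 := by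
  simp [pd]

theorem pd_smul {f : E2 → ℝ} (hf : DifferentiableAt ℝ f x) (hu : DifferentiableAt ℝ u x) :
    pd i (fun y => f y • u y) x = f x • pd i u x + pd i f x • u x := by
  simp only [pd, fderiv_fun_smul hf hu, add_apply,
    smul_apply, ContinuousLinearMap.smulRight_apply]

theorem pd_mul {f g : E2 → ℝ} (hf : DifferentiableAt ℝ f x) (hg : DifferentiableAt ℝ g x) :
    pd i (fun y => f y * g y) x = f x * pd i g x + pd i f x * g x :=
  pd_smul hf hg

theorem pd_comm (hu : ContDiffAt ℝ ∞ u x) : pd i (pd j u) x = pd j (pd i u) x := by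
  have hd : DifferentiableAt ℝ (fderiv ℝ u) x :=
    (hu.fderiv_right (m := ∞) (by simp)).differentiableAt_of_infty
  have hs : IsSymmSndFDerivAt ℝ u x := hu.isSymmSndFDerivAt (by
    simp only [minSmoothness_of_isRCLikeNormedField]
    exact WithTop.coe_le_coe.2 (le_top : (2 : ℕ∞) ≤ ⊤))
  have key : ∀ a b : E2, fderiv ℝ (fun y => fderiv ℝ u y a) x b
      = fderiv ℝ (fderiv ℝ u) x b a := fun a b => by
    rw [fderiv_clm_apply hd (differentiableAt_const a)]
    simp
  show fderiv ℝ (fun y => fderiv ℝ u y _) x _ = fderiv ℝ (fun y => fderiv ℝ u y _) x _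
  rw [key, key, hs.eq]

theorem pd_inner {W : Type*} [NormedAddCommGroup W] [InnerProductSpace ℝ W] {u v : E2 → W}
    (hu : DifferentiableAt ℝ u x) (hv : DifferentiableAt ℝ v x) :
    pd i (fun y => inner ℝ (u y) (v y)) x = inner ℝ (u x) (pd i v x) + inner ℝ (pd i u x) (v x) := by
  simp only [pd, fderiv_inner_apply ℝ hu hv]

theorem fderiv_eq_pd (a : E2) : fderiv ℝ u x a = a 0 • pd 0 u x + a 1 • pd 1 u x := by
  have : a = a 0 • EuclideanSpace.single 0 1 + a 1 • EuclideanSpace.single 1 (1 : ℝ) := by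
    ext k; fin_cases k <;> simp
  conv_lhs => rw [this]
  simp only [map_add, map_smul, pd]

end PartialDerivatives

/-- The cross product of Euclidean three-space. -/
def cr (u v : E3) : E3 := WithLp.toLp 2 (u.ofLp ⨯₃ v.ofLp)

/-! ### Cross product and orthonormal frames in three-space -/

section Cross

variable (u v w z : E3)

theorem inner_E3 : inner ℝ u v = u 0 * v 0 + u 1 * v 1 + u 2 * v 2 := by
  simp only [PiLp.inner_apply, Fin.sum_univ_three, RCLike.inner_apply, conj_trivial]
  ring

theorem cr_apply_zero : cr u v 0 = u 1 * v 2 - u 2 * v 1 := by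
  simp [cr, cross_apply]

theorem cr_apply_one : cr u v 1 = u 2 * v 0 - u 0 * v 2 := by
  simp [cr, cross_apply]

theorem cr_apply_two : cr u v 2 = u 0 * v 1 - u 1 * v 0 := by
  simp [cr, cross_apply]

theorem E3_ext {u v : E3} (h0 : u 0 = v 0) (h1 : u 1 = v 1) (h2 : u 2 = v 2) : u = v := by
  ext k; fin_cases k <;> assumption

theorem cr_anticomm : cr v u = -cr u v := by
  apply E3_ext <;> simp only [PiLp.neg_apply, cr_apply_zero, cr_apply_one, cr_apply_two] <;> ring

theorem cr_self : cr u u = 0 := by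
  apply E3_ext <;> simp only [PiLp.zero_apply, cr_apply_zero, cr_apply_one, cr_apply_two] <;> ring

theorem cr_add_left : cr (u + v) w = cr u w + cr v w := by
  apply E3_ext <;> simp only [PiLp.add_apply, cr_apply_zero, cr_apply_one, cr_apply_two] <;> ring

theorem cr_add_right : cr w (u + v) = cr w u + cr w v := by
  apply E3_ext <;> simp only [PiLp.add_apply, cr_apply_zero, cr_apply_one, cr_apply_two] <;> ring

theorem cr_smul_left (c : ℝ) : cr (c • u) v = c • cr u v := by
  apply E3_ext <;>
    simp only [PiLp.smul_apply, cr_apply_zero, cr_apply_one, cr_apply_two, smul_eq_mul] <;> ring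

theorem cr_smul_right (c : ℝ) : cr u (c • v) = c • cr u v := by
  apply E3_ext <;>
    simp only [PiLp.smul_apply, cr_apply_zero, cr_apply_one, cr_apply_two, smul_eq_mul] <;> ring

theorem inner_cr_left : inner ℝ u (cr u v) = (0 : ℝ) := by
  simp only [inner_E3, cr_apply_zero, cr_apply_one, cr_apply_two]; ring

theorem inner_cr_right : inner ℝ v (cr u v) = (0 : ℝ) := by
  simp only [inner_E3, cr_apply_zero, cr_apply_one, cr_apply_two]; ring

theorem inner_cr_cr : inner ℝ (cr u v) (cr w z)
    = inner ℝ u w * inner ℝ v z - inner ℝ u z * (inner ℝ v w : ℝ) := by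
  simp only [inner_E3, cr_apply_zero, cr_apply_one, cr_apply_two]; ring

theorem cr_cr : cr u (cr v w) = (inner ℝ u w : ℝ) • v - (inner ℝ u v : ℝ) • w := by
  apply E3_ext <;> simp only [PiLp.sub_apply, PiLp.smul_apply, inner_E3, cr_apply_zero,
    cr_apply_one, cr_apply_two, smul_eq_mul] <;> ring

/-- The cross product as a continuous bilinear map. -/
def crL : E3 →L[ℝ] E3 →L[ℝ] E3 :=
  LinearMap.toContinuousLinearMap
    ((LinearMap.toContinuousLinearMap : (E3 →ₗ[ℝ] E3) ≃ₗ[ℝ] (E3 →L[ℝ] E3)).toLinearMap ∘ₗ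
      LinearMap.mk₂ ℝ cr (fun u v w => cr_add_left u v w) (fun c u v => cr_smul_left u v c)
        (fun u v w => cr_add_right v w u) (fun c u v => cr_smul_right u v c))

theorem crL_apply : crL u v = cr u v := rfl

variable {u v w z}

theorem contDiffAt_cr {E : Type*} [NormedAddCommGroup E] [NormedSpace ℝ E] {p q : E → E3} {x : E}
    {n : WithTop ℕ∞} (hp : ContDiffAt ℝ n p x) (hq : ContDiffAt ℝ n q x) :
    ContDiffAt ℝ n (fun y => cr (p y) (q y)) x :=
  (crL.contDiff.contDiffAt.comp x hp).clm_apply hq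

theorem hasDerivAt_cr {p q : ℝ → E3} {p' q' : E3} {s : ℝ} (hp : HasDerivAt p p' s)
    (hq : HasDerivAt q q' s) :
    HasDerivAt (fun t => cr (p t) (q t)) (cr p' (q s) + cr (p s) q') s :=
  (crL.hasFDerivAt.comp_hasDerivAt s hp).clm_apply hq

theorem pd_cr {p q : E2 → E3} {x : E2} {i : Fin 2} (hp : DifferentiableAt ℝ p x)
    (hq : DifferentiableAt ℝ q x) :
    pd i (fun y => cr (p y) (q y)) x = cr (pd i p x) (q x) + cr (p x) (pd i q x) := by
  have h := ((crL.hasFDerivAt.comp x hp.hasFDerivAt).clm_apply hq.hasFDerivAt).fderiv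
  simp only [Function.comp_def, crL_apply] at h
  simp only [pd, h, add_apply, ContinuousLinearMap.comp_apply,
    ContinuousLinearMap.flip_apply, crL_apply]
  abel

theorem norm_eq_one_of_inner {E : Type*} [NormedAddCommGroup E] [InnerProductSpace ℝ E] {a : E}
    (h : inner ℝ a a = (1 : ℝ)) : ‖a‖ = 1 := by
  rw [real_inner_self_eq_norm_sq] at h
  nlinarith [norm_nonneg a]

theorem orthonormal_triple (hu : inner ℝ u u = (1 : ℝ)) (hv : inner ℝ v v = (1 : ℝ))
    (hw : inner ℝ w w = (1 : ℝ)) (huv : inner ℝ u v = (0 : ℝ)) (huw : inner ℝ u w = (0 : ℝ))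
    (hvw : inner ℝ v w = (0 : ℝ)) : Orthonormal ℝ ![u, v, w] := by
  refine ⟨fun k => ?_, fun k l hkl => ?_⟩
  · fin_cases k
    exacts [norm_eq_one_of_inner hu, norm_eq_one_of_inner hv, norm_eq_one_of_inner hw]
  · have h1 := real_inner_comm u v
    have h2 := real_inner_comm u w
    have h3 := real_inner_comm v w
    fin_cases k <;> fin_cases l <;> simp_all

theorem eq_sum_of_orthonormal (h : Orthonormal ℝ ![u, v, w]) (a : E3) :
    a = (inner ℝ u a : ℝ) • u + (inner ℝ v a : ℝ) • v + (inner ℝ w a : ℝ) • w := by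
  have hsp : ⊤ ≤ Submodule.span ℝ (Set.range ![u, v, w]) := by
    have := h.linearIndependent.span_eq_top_of_card_eq_finrank (by simp)
    rw [this]
  have := (OrthonormalBasis.mk h hsp).sum_repr' a
  simpa [Fin.sum_univ_three] using this.symm

end Cross

/-! ### The Laplacian as the divergence of a flux -/

section Laplacian

variable {V : Type*} [NormedAddCommGroup V] [NormedSpace ℝ V]

/-- The inverse is the adjugate over the determinant, so `√(det g) g⁻¹ = adj g / √(det g)`: the flux
has coefficients linear in `g`, apart from one scalar factor. -/
theorem flux_zero {g : Matrix (Fin 2) (Fin 2) ℝ} (hd : 0 < g.det) (u : Fin 2 → V) :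
    ∑ j, (Real.sqrt g.det * g⁻¹ 0 j) • u j
      = (Real.sqrt g.det)⁻¹ • (g 1 1 • u 0 - g 0 1 • u 1) := by
  have h : Real.sqrt g.det * g.det⁻¹ = (Real.sqrt g.det)⁻¹ := by
    have h0 := (Real.sqrt_pos.2 hd).ne'
    have h1 := Real.mul_self_sqrt hd.le
    field_simp
    rw [sq, h1]
  simp only [Fin.sum_univ_two, Matrix.inv_def, Ring.inverse_eq_inv', Matrix.adjugate_fin_two,
    Matrix.smul_apply, smul_eq_mul, ← mul_assoc, h]
  simp only [Matrix.of_apply, Matrix.cons_val', Matrix.cons_val_zero, Matrix.cons_val_one,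
    smul_sub, smul_smul]
  simp [sub_eq_add_neg]

theorem flux_one {g : Matrix (Fin 2) (Fin 2) ℝ} (hd : 0 < g.det) (u : Fin 2 → V) :
    ∑ j, (Real.sqrt g.det * g⁻¹ 1 j) • u j
      = (Real.sqrt g.det)⁻¹ • (g 0 0 • u 1 - g 1 0 • u 0) := by
  have h : Real.sqrt g.det * g.det⁻¹ = (Real.sqrt g.det)⁻¹ := by
    have h0 := (Real.sqrt_pos.2 hd).ne'
    have h1 := Real.mul_self_sqrt hd.le
    field_simp
    rw [sq, h1]
  simp only [Fin.sum_univ_two, Matrix.inv_def, Ring.inverse_eq_inv', Matrix.adjugate_fin_two,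
    Matrix.smul_apply, smul_eq_mul, ← mul_assoc, h]
  simp only [Matrix.of_apply, Matrix.cons_val', Matrix.cons_val_zero, Matrix.cons_val_one,
    smul_sub, smul_smul]
  simp [sub_eq_add_neg, add_comm]

variable {g : E2 → Matrix (Fin 2) (Fin 2) ℝ} {u v : E2 → V} {x : E2}

/-- The components of `√(det g) grad u`. -/
def flux (g : E2 → Matrix (Fin 2) (Fin 2) ℝ) (u : E2 → V) (i : Fin 2) (x : E2) : V :=
  ∑ j, (Real.sqrt (g x).det * (g x)⁻¹ i j) • pd j u x

theorem laplacian_eq_flux :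
    laplacian g u x = (Real.sqrt (g x).det)⁻¹ • (pd 0 (flux g u 0) x + pd 1 (flux g u 1) x) := by
  simp only [laplacian, Fin.sum_univ_two (fun i => pd i _ x)]
  rfl

theorem flux_congr (h : u =ᶠ[𝓝 x] v) (i : Fin 2) : flux g u i =ᶠ[𝓝 x] flux g v i := by
  filter_upwards [eventuallyEq_pd (i := 0) h, eventuallyEq_pd (i := 1) h] with y h0 h1
  simp only [flux, Fin.sum_univ_two, h0, h1]

theorem laplacian_congr (h : u =ᶠ[𝓝 x] v) : laplacian g u x = laplacian g v x := by
  simp only [laplacian_eq_flux, pd_congr (flux_congr h _)]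

/-- The coefficients of the metric are smooth, and its determinant is positive, at the point. -/
structure MetricAt (g : E2 → Matrix (Fin 2) (Fin 2) ℝ) (x : E2) : Prop where
  smooth : ∀ i j, ContDiffAt ℝ ∞ (fun y => g y i j) x
  det_pos : 0 < (g x).det
  symm : ∀ y, (g y) 0 1 = (g y) 1 0

theorem MetricAt.det (hg : MetricAt g x) : ContDiffAt ℝ ∞ (fun y => (g y).det) x := by
  simp only [Matrix.det_fin_two]
  exact ((hg.smooth 0 0).mul (hg.smooth 1 1)).sub ((hg.smooth 0 1).mul (hg.smooth 1 0))

theorem MetricAt.sqrt (hg : MetricAt g x) :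
    ContDiffAt ℝ ∞ (fun y => Real.sqrt (g y).det) x :=
  hg.det.sqrt hg.det_pos.ne'

theorem MetricAt.coeff (hg : MetricAt g x) (i j : Fin 2) :
    ContDiffAt ℝ ∞ (fun y => Real.sqrt (g y).det * (g y)⁻¹ i j) x := by
  refine hg.sqrt.mul ?_
  simp only [Matrix.inv_def, Ring.inverse_eq_inv', Matrix.adjugate_fin_two, Matrix.smul_apply,
    smul_eq_mul]
  refine (hg.det.inv hg.det_pos.ne').mul ?_
  fin_cases i <;> fin_cases j
  exacts [hg.smooth 1 1, (hg.smooth 0 1).neg, (hg.smooth 1 0).neg, hg.smooth 0 0]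

theorem MetricAt.inv_symm (hg : MetricAt g x) : (g x)⁻¹ 0 1 = (g x)⁻¹ 1 0 := by
  simp [Matrix.inv_def, Matrix.adjugate_fin_two, hg.symm]

theorem contDiffAt_flux (hg : MetricAt g x) (hu : ContDiffAt ℝ ∞ u x) (i : Fin 2) :
    ContDiffAt ℝ ∞ (flux g u i) x := by
  unfold flux
  exact ContDiffAt.sum fun j _ => (hg.coeff i j).smul (contDiffAt_pd hu)

theorem contDiffAt_laplacian (hg : MetricAt g x) (hu : ContDiffAt ℝ ∞ u x) :
    ContDiffAt ℝ ∞ (laplacian g u) x := by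
  have : laplacian g u = fun x =>
    (Real.sqrt (g x).det)⁻¹ • (pd 0 (flux g u 0) x + pd 1 (flux g u 1) x) :=
    funext fun _ => laplacian_eq_flux
  rw [this]
  exact (hg.sqrt.inv (Real.sqrt_pos.2 hg.det_pos).ne').smul
    ((contDiffAt_pd (contDiffAt_flux hg hu 0)).add (contDiffAt_pd (contDiffAt_flux hg hu 1)))

/-- Both mixed terms of the product rule equal the derivative along `grad f`, because `g⁻¹` is
symmetric. The right side has exactly the shape of the `f`-bitension field. -/
theorem laplacian_smul {f : E2 → ℝ} (hg : MetricAt g x) (hf : ∀ᶠ y in 𝓝 x, ContDiffAt ℝ ∞ f y)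
    (hu : ∀ᶠ y in 𝓝 x, ContDiffAt ℝ ∞ u y) :
    laplacian g (fun y => f y • u y) x
      = f x • laplacian g u x + laplacian g f x • u x + (2 : ℝ) • derivAlongGrad g f u x := by
  have hfx := hf.self_of_nhds
  have hux := hu.self_of_nhds
  have h : ∀ i, flux g (fun y => f y • u y) i
      =ᶠ[𝓝 x] fun y => f y • flux g u i y + flux g f i y • u y := fun i => by
    filter_upwards [hf, hu] with y hfy hyu
    simp only [flux, Fin.sum_univ_two,
      pd_smul hfy.differentiableAt_of_infty hyu.differentiableAt_of_infty, smul_eq_mul]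
    module
  have hw := (Real.sqrt_pos.2 hg.det_pos).ne'
  have hp : ∀ i, pd i (flux g (fun y => f y • u y) i) x
      = f x • pd i (flux g u i) x + pd i f x • flux g u i x
        + (flux g f i x • pd i u x + pd i (flux g f i) x • u x) := fun i => by
    have d1 := (contDiffAt_flux hg hux i).differentiableAt_of_infty
    have d2 := (contDiffAt_flux hg hfx i).differentiableAt_of_infty
    have d3 := hfx.differentiableAt_of_infty
    have d4 := hux.differentiableAt_of_infty
    rw [pd_congr (h i), pd_add (d3.fun_smul d1) (d2.fun_smul d4), pd_smul d3 d1, pd_smul d2 d4]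
  simp only [laplacian_eq_flux, hp]
  simp only [flux, derivAlongGrad, Fin.sum_univ_two, smul_eq_mul, hg.inv_symm]
  match_scalars <;> field_simp <;> ring

end Laplacian

/-! ### Immersed surfaces: metric, normal, flux of the position vector -/

section Immersion

variable {r : E2 → E3} {x : E2}

/-- The parametrized surface is a smooth immersion at the point. -/
structure ImmersedAt (r : E2 → E3) (x : E2) : Prop where
  smooth : ContDiffAt ℝ ∞ r x
  cr_ne : cr (pd 0 r x) (pd 1 r x) ≠ 0

theorem det_firstForm (y : E2) : (firstForm r y).det = ‖cr (pd 0 r y) (pd 1 r y)‖ ^ 2 := by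
  rw [← real_inner_self_eq_norm_sq, inner_cr_cr, Matrix.det_fin_two]
  rfl

theorem sqrt_det_firstForm (y : E2) :
    Real.sqrt (firstForm r y).det = ‖cr (pd 0 r y) (pd 1 r y)‖ := by
  rw [det_firstForm, Real.sqrt_sq (norm_nonneg _)]

theorem unitNormal_eq (y : E2) :
    unitNormal r y = ‖cr (pd 0 r y) (pd 1 r y)‖⁻¹ • cr (pd 0 r y) (pd 1 r y) := rfl

theorem ImmersedAt.metricAt (h : ImmersedAt r x) : MetricAt (firstForm r) x where
  smooth i j := (contDiffAt_pd h.smooth).inner ℝ (contDiffAt_pd h.smooth)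
  det_pos := by
    rw [det_firstForm]
    have := norm_pos_iff.2 h.cr_ne
    positivity
  symm y := real_inner_comm (pd 1 r y) (pd 0 r y)

theorem ImmersedAt.contDiffAt_unitNormal (h : ImmersedAt r x) : ContDiffAt ℝ ∞ (unitNormal r) x := by
  have hc := contDiffAt_cr (contDiffAt_pd (i := 0) h.smooth) (contDiffAt_pd (i := 1) h.smooth)
  exact ((hc.norm ℝ h.cr_ne).inv (norm_ne_zero_iff.2 h.cr_ne)).smul hc

theorem ImmersedAt.inner_unitNormal_self (h : ImmersedAt r x) :
    inner ℝ (unitNormal r x) (unitNormal r x) = (1 : ℝ) := by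
  have := norm_ne_zero_iff.2 h.cr_ne
  rw [unitNormal_eq, real_inner_smul_left, real_inner_smul_right, real_inner_self_eq_norm_sq]
  field_simp

theorem inner_pd_unitNormal (y : E2) (i : Fin 2) : inner ℝ (pd i r y) (unitNormal r y) = (0 : ℝ) := by
  rw [unitNormal_eq, real_inner_smul_right]
  fin_cases i
  · simp [inner_cr_left]
  · simp [inner_cr_right]

theorem cr_pd_zero_unitNormal (y : E2) : cr (unitNormal r y) (pd 0 r y)
    = ‖cr (pd 0 r y) (pd 1 r y)‖⁻¹ • (firstForm r y 0 0 • pd 1 r y - firstForm r y 1 0 • pd 0 r y) := by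
  rw [cr_anticomm, unitNormal_eq, cr_smul_right, cr_cr, ← smul_neg, neg_sub,
    real_inner_comm (pd 1 r y) (pd 0 r y)]
  rfl

/-- The cross product with `n` rotates the tangent plane by a right angle, and the double cross
product formula reproduces the adjugate coefficients. The square root of `det g` disappears from the
flux of the position vector. -/
theorem ImmersedAt.flux_zero_eq (h : ImmersedAt r x) :
    flux (firstForm r) r 0 x = cr (pd 1 r x) (unitNormal r x) := by
  rw [flux, flux_zero h.metricAt.det_pos (fun j => pd j r x), sqrt_det_firstForm, unitNormal_eq,
    cr_smul_right, cr_cr, real_inner_comm (pd 0 r x) (pd 1 r x)]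
  rfl

theorem ImmersedAt.flux_one_eq (h : ImmersedAt r x) :
    flux (firstForm r) r 1 x = cr (unitNormal r x) (pd 0 r x) := by
  rw [flux, flux_one h.metricAt.det_pos (fun j => pd j r x), sqrt_det_firstForm,
    cr_pd_zero_unitNormal]

end Immersion

/-! ### Tension field through the Gauss map -/

section Tension

variable {r : E2 → E3} {x : E2}

/-- When the rotated fluxes are differentiated, the two terms with `∂₀∂₁r` cancel, so only
derivatives of the normal remain. -/
theorem tension_eq (h : ∀ᶠ y in 𝓝 x, ImmersedAt r y) :
    ‖cr (pd 0 r x) (pd 1 r x)‖ • tension (firstForm r) r x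
      = cr (pd 1 r x) (pd 0 (unitNormal r) x) + cr (pd 1 (unitNormal r) x) (pd 0 r x) := by
  have hx := h.self_of_nhds
  have d0 := (contDiffAt_pd (i := 0) hx.smooth).differentiableAt_of_infty
  have d1 := (contDiffAt_pd (i := 1) hx.smooth).differentiableAt_of_infty
  have dn := hx.contDiffAt_unitNormal.differentiableAt_of_infty
  have e0 : flux (firstForm r) r 0 =ᶠ[𝓝 x] fun y => cr (pd 1 r y) (unitNormal r y) :=
    h.mono fun y hy => hy.flux_zero_eq
  have e1 : flux (firstForm r) r 1 =ᶠ[𝓝 x] fun y => cr (unitNormal r y) (pd 0 r y) :=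
    h.mono fun y hy => hy.flux_one_eq
  rw [tension, laplacian_eq_flux, pd_congr e0, pd_congr e1, pd_cr d1 dn, pd_cr dn d0,
    sqrt_det_firstForm, smul_inv_smul₀ (norm_ne_zero_iff.2 hx.cr_ne),
    pd_comm hx.smooth (i := 1) (j := 0), cr_anticomm (pd 0 (pd 1 r) x)]
  abel

theorem fBitension_eq_laplacian {f : E2 → ℝ} (h : ∀ᶠ y in 𝓝 x, ImmersedAt r y)
    (hf : ∀ᶠ y in 𝓝 x, ContDiffAt ℝ ∞ f y) :
    fBitension (firstForm r) f r x
      = laplacian (firstForm r) (fun y => f y • tension (firstForm r) r y) x := by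
  have ht : ∀ᶠ y in 𝓝 x, ContDiffAt ℝ ∞ (tension (firstForm r) r) y :=
    h.mono fun y hy => contDiffAt_laplacian hy.metricAt hy.smooth
  rw [laplacian_smul h.self_of_nhds.metricAt hf ht]
  rfl

end Tension

/-! ### Rank of the Gauss map and constancy of the ruling direction -/

section Ruling

variable {r : E2 → E3} {x : E2}

theorem eq_smul_of_cr_eq_zero {n z : E3} (hn : inner ℝ n n = (1 : ℝ)) (h : cr n z = 0) :
    z = (inner ℝ n z : ℝ) • n := by
  have := cr_cr n n z
  rw [h, hn, one_smul] at this
  have h0 : cr n 0 = 0 := by simpa using cr_smul_right n 0 0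
  rw [h0] at this
  exact (sub_eq_zero.1 this.symm).symm

theorem cr_eq_smul_of_orthogonal {n a b : E3} (hn : inner ℝ n n = (1 : ℝ))
    (ha : inner ℝ n a = (0 : ℝ)) (hb : inner ℝ n b = (0 : ℝ)) :
    cr a b = (inner ℝ n (cr a b) : ℝ) • n := by
  refine eq_smul_of_cr_eq_zero hn ?_
  rw [cr_cr, ha, hb, zero_smul, zero_smul, sub_zero]

theorem inner_unitNormal_pd (h : ∀ᶠ y in 𝓝 x, ImmersedAt r y) (i : Fin 2) :
    inner ℝ (unitNormal r x) (pd i (unitNormal r) x) = (0 : ℝ) := by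
  have dn := h.self_of_nhds.contDiffAt_unitNormal.differentiableAt_of_infty
  have e : (fun y => (inner ℝ (unitNormal r y) (unitNormal r y) : ℝ)) =ᶠ[𝓝 x] fun _ => (1 : ℝ) :=
    h.mono fun y hy => hy.inner_unitNormal_self
  have := pd_congr (i := i) e
  rw [pd_inner dn dn, pd_const, real_inner_comm (unitNormal r x)] at this
  linarith

theorem inner_pd_pd_unitNormal (h : ∀ᶠ y in 𝓝 x, ImmersedAt r y) (i j : Fin 2) :
    inner ℝ (pd i (unitNormal r) x) (pd j r x) = -secondForm r x i j := by
  have hx := h.self_of_nhds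
  have dn := hx.contDiffAt_unitNormal.differentiableAt_of_infty
  have dj := (contDiffAt_pd (i := j) hx.smooth).differentiableAt_of_infty
  have e : (fun y => (inner ℝ (pd j r y) (unitNormal r y) : ℝ)) =ᶠ[𝓝 x] fun _ => (0 : ℝ) :=
    h.mono fun y hy => inner_pd_unitNormal y j
  have := pd_congr (i := i) e
  rw [pd_inner dj dn, pd_const, real_inner_comm (pd i (unitNormal r) x)] at this
  simp only [secondForm, Matrix.of_apply]
  linarith

/-- Both derivatives of `n` are tangent, so their cross product is normal. By the Binet-Cauchy
identity its normal component is `det II / |∂₀r × ∂₁r|`, which is zero. Thus the Gauss map has rank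
at most one. -/
theorem cr_pd_unitNormal (h : ∀ᶠ y in 𝓝 x, ImmersedAt r y)
    (hg : gaussCurvature r x = 0) :
    cr (pd 0 (unitNormal r) x) (pd 1 (unitNormal r) x) = 0 := by
  have hx := h.self_of_nhds
  have hdet : (secondForm r x).det = 0 :=
    (div_eq_zero_iff.1 hg).resolve_right hx.metricAt.det_pos.ne'
  rw [Matrix.det_fin_two] at hdet
  rw [cr_eq_smul_of_orthogonal hx.inner_unitNormal_self (inner_unitNormal_pd h 0)
    (inner_unitNormal_pd h 1)]
  have : (inner ℝ (unitNormal r x) (cr (pd 0 (unitNormal r) x) (pd 1 (unitNormal r) x)) : ℝ) = 0 := by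
    rw [unitNormal_eq x, real_inner_smul_left, inner_cr_cr, real_inner_comm _ (pd 0 r x),
      real_inner_comm _ (pd 0 r x), real_inner_comm _ (pd 1 r x), real_inner_comm _ (pd 1 r x)]
    simp only [inner_pd_pd_unitNormal h]
    rw [show ∀ a b c d : ℝ, -a * -b - -c * -d = a * b - d * c by intros; ring, hdet, mul_zero]
  rw [this, zero_smul]

/-- Taking the cross product of `tension_eq` with `n` leaves only inner products of `n` with tangent
vectors, so `n × τ = 0`. -/
theorem tension_eq_smul (h : ∀ᶠ y in 𝓝 x, ImmersedAt r y) :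
    tension (firstForm r) r x
      = (inner ℝ (unitNormal r x) (tension (firstForm r) r x) : ℝ) • unitNormal r x := by
  have hx := h.self_of_nhds
  have hn := hx.inner_unitNormal_self
  have h1 := fun i => (real_inner_comm _ _).trans (inner_pd_unitNormal (r := r) x i)
  refine eq_smul_of_cr_eq_zero hn ?_
  have := congrArg (cr (unitNormal r x)) (tension_eq h)
  rw [cr_smul_right, cr_add_right, cr_cr, cr_cr, h1, h1, inner_unitNormal_pd h,
    inner_unitNormal_pd h] at this
  simpa [hx.cr_ne] using this

theorem exists_pd_unitNormal_ne_zero (h : ∀ᶠ y in 𝓝 x, ImmersedAt r y)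
    (ht : tension (firstForm r) r x ≠ 0) :
    ∃ i, pd i (unitNormal r) x ≠ 0 := by
  by_contra! H
  have hc := norm_ne_zero_iff.2 h.self_of_nhds.cr_ne
  have := tension_eq h
  have z1 : ∀ a, cr a 0 = 0 := fun a => by simpa using cr_smul_right a 0 0
  have z2 : ∀ a, cr 0 a = 0 := fun a => by simpa using cr_smul_left 0 a 0
  rw [H 0, H 1, z1, z2, add_zero, smul_eq_zero] at this
  exact this.elim hc ht

/-- Where the tension field of a developable `f`-biharmonic surface does not vanish, the direction
of the rulings is constant. -/
theorem exists_ruling_direction {f : E2 → ℝ} (h : ∀ᶠ y in 𝓝 x, ImmersedAt r y)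
    (hg : ∀ᶠ y in 𝓝 x, gaussCurvature r y = 0) (hf : ∀ᶠ y in 𝓝 x, ContDiffAt ℝ ∞ f y)
    (hf0 : ∀ᶠ y in 𝓝 x, f y ≠ 0) (hb : ∀ᶠ y in 𝓝 x, fBitension (firstForm r) f r y = 0)
    (ht : tension (firstForm r) r x ≠ 0) :
    ∃ b : E3, inner ℝ b b = (1 : ℝ) ∧ ∀ᶠ y in 𝓝 x, inner ℝ b (unitNormal r y) = (0 : ℝ) := by
  have hx := h.self_of_nhds
  obtain ⟨k, hk⟩ := exists_pd_unitNormal_ne_zero h ht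
  set n := unitNormal r with hn
  set F : E2 → E3 := fun y => f y • tension (firstForm r) r y with hF
  -- The vector `t` spans the image of `dn`, normalized from an index `k` with `∂ₖn ≠ 0`; `b`
  -- completes the frame and is the ruling direction.
  set t : E2 → E3 := fun y => ‖pd k n y‖⁻¹ • pd k n y with htdef
  set b : E2 → E3 := fun y => cr (n y) (t y) with hbdef
  have htc : ContDiffAt ℝ ∞ (tension (firstForm r) r) x := contDiffAt_laplacian hx.metricAt hx.smooth
  have hk' : ∀ᶠ y in 𝓝 x, pd k n y ≠ 0 :=
    (contDiffAt_pd hx.contDiffAt_unitNormal).continuousAt.eventually_ne hk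
  have ht' : ∀ᶠ y in 𝓝 x, tension (firstForm r) r y ≠ 0 := htc.continuousAt.eventually_ne ht
  -- pointwise relations of the frame `n`, `t`, `b`
  have key : ∀ᶠ y in 𝓝 x, ContDiffAt ℝ ∞ n y ∧ ContDiffAt ℝ ∞ b y ∧ ContDiffAt ℝ ∞ F y ∧
      Orthonormal ℝ ![n y, t y, b y] ∧ (∀ i, pd i n y = (inner ℝ (t y) (pd i n y) : ℝ) • t y) ∧
      inner ℝ (t y) (pd k n y) ≠ (0 : ℝ) ∧ F y = (inner ℝ (n y) (F y) : ℝ) • n y ∧ F y ≠ 0 := by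
    filter_upwards [h.eventually_nhds, hg, hf, hf0, hk', ht'] with y hy hgy hfy hf0y hky hty
    have hny := hy.self_of_nhds.contDiffAt_unitNormal
    have hnn := hy.self_of_nhds.inner_unitNormal_self
    have hn0 := norm_ne_zero_iff.2 hky
    have h1 : ContDiffAt ℝ ∞ t y :=
      (((contDiffAt_pd hny).norm ℝ hky).inv hn0).smul (contDiffAt_pd hny)
    have htt : inner ℝ (t y) (t y) = (1 : ℝ) := by
      rw [real_inner_self_eq_norm_sq, norm_smul, norm_inv, norm_norm, inv_mul_cancel₀ hn0, one_pow]
    have hnt : inner ℝ (n y) (t y) = (0 : ℝ) := by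
      simp only [htdef, real_inner_smul_right, hn, inner_unitNormal_pd hy, mul_zero]
    have hc : ∀ i, cr (pd k n y) (pd i n y) = 0 := fun i => by
      have := cr_pd_unitNormal hy hgy
      have h2 := cr_anticomm (pd 0 (unitNormal r) y) (pd 1 (unitNormal r) y)
      rw [this, neg_zero] at h2
      fin_cases k <;> fin_cases i
      exacts [cr_self _, this, h2, cr_self _]
    refine ⟨hny, contDiffAt_cr hny h1, hfy.smul (contDiffAt_laplacian hy.self_of_nhds.metricAt
      hy.self_of_nhds.smooth), orthonormal_triple hnn htt ?_ hnt ?_ ?_, fun i => ?_, ?_, ?_, ?_⟩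
    · simp only [hbdef]
      rw [inner_cr_cr, htt, hnt, zero_mul, mul_one, sub_zero, hn, hnn]
    · exact inner_cr_left _ _
    · exact inner_cr_right _ _
    · refine eq_smul_of_cr_eq_zero htt ?_
      simp only [htdef, cr_smul_left, hc, smul_zero]
    · simp only [htdef, real_inner_smul_left, real_inner_self_eq_norm_sq]
      positivity
    · simp only [hF, real_inner_smul_right, ← smul_smul]
      rw [← tension_eq_smul hy]
    · exact smul_ne_zero hf0y hty
  -- Differentiating the orthonormality relations leaves `∂ᵢb = μᵢ t`. Two linear relations between
  -- `α` and `μ` will force `μ = 0`.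
  have hbz : ∀ᶠ y in 𝓝 x, ContDiffAt ℝ ∞ b y ∧ ∀ i, pd i b y = 0 := by
    filter_upwards [key.eventually_nhds, h.eventually_nhds, hf.eventually_nhds, hb]
      with y hkey hy hfy hby
    obtain ⟨hny, hbs, hFs, hon, hnt, hk0, hFn, hF0⟩ := hkey.self_of_nhds
    refine ⟨hbs, ?_⟩
    have hyi := hy.self_of_nhds
    have dn := hny.differentiableAt_of_infty
    have db := hbs.differentiableAt_of_infty
    have dF := hFs.differentiableAt_of_infty
    have o := orthonormal_iff_ite.1 hon
    have onn : inner ℝ (n y) (n y) = (1 : ℝ) := o 0 0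
    have ott : inner ℝ (t y) (t y) = (1 : ℝ) := o 1 1
    have ont : inner ℝ (n y) (t y) = (0 : ℝ) := o 0 1
    have onb : inner ℝ (n y) (b y) = (0 : ℝ) := o 0 2
    have otb : inner ℝ (t y) (b y) = (0 : ℝ) := o 1 2
    have hnb : ∀ i, inner ℝ (n y) (pd i b y) = (0 : ℝ) := fun i => by
      have e : (fun z => (inner ℝ (n z) (b z) : ℝ)) =ᶠ[𝓝 y] fun _ => (0 : ℝ) :=
        hkey.mono fun z hz => (orthonormal_iff_ite.1 hz.2.2.2.1) 0 2
      have := pd_congr (i := i) e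
      rw [pd_inner dn db, pd_const, hnt i, real_inner_smul_left, otb] at this
      linarith
    have hbb : ∀ i, inner ℝ (b y) (pd i b y) = (0 : ℝ) := fun i => by
      have e : (fun z => (inner ℝ (b z) (b z) : ℝ)) =ᶠ[𝓝 y] fun _ => (1 : ℝ) :=
        hkey.mono fun z hz => (orthonormal_iff_ite.1 hz.2.2.2.1) 2 2
      have := pd_congr (i := i) e
      rw [pd_inner db db, pd_const, real_inner_comm (b y)] at this
      linarith
    have hbt : ∀ i, pd i b y = (inner ℝ (t y) (pd i b y) : ℝ) • t y := fun i => by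
      have := eq_sum_of_orthonormal hon (pd i b y)
      rwa [hnb, hbb, zero_smul, zero_smul, zero_add, add_zero] at this
    set α : Fin 2 → ℝ := fun i => inner ℝ (t y) (pd i n y) with hα
    set μ : Fin 2 → ℝ := fun i => inner ℝ (t y) (pd i b y) with hμ
    -- Differentiating `⟨∂ᵢn, b⟩ = 0` gives `⟨∂ⱼ∂ᵢn, b⟩ = -αᵢ μⱼ`, and the left side is symmetric in
    -- the indices.
    have hsym : α 0 * μ 1 = α 1 * μ 0 := by
      have e : ∀ i, (fun z => (inner ℝ (pd i n z) (b z) : ℝ)) =ᶠ[𝓝 y] fun _ => (0 : ℝ) := fun i =>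
        hkey.mono fun z hz => by
          simp only
          have : inner ℝ (t z) (b z) = (0 : ℝ) := (orthonormal_iff_ite.1 hz.2.2.2.1) 1 2
          rw [hz.2.2.2.2.1 i, real_inner_smul_left, this, mul_zero]
      have e2 : ∀ i j, (inner ℝ (pd j (pd i n) y) (b y) : ℝ) = -(α i * μ j) := fun i j => by
        have := pd_congr (i := j) (e i)
        rw [pd_inner (contDiffAt_pd hny).differentiableAt_of_infty db, pd_const, hnt i, hbt j,
          real_inner_smul_left, real_inner_smul_right, ott] at this
        simp only [hα, hμ]
        linarith
      have e3 := e2 0 1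
      rw [pd_comm hny, e2 1 0] at e3
      linarith
    set φ : ℝ := inner ℝ (n y) (F y) with hφ
    have hφ0 : φ ≠ 0 := fun h0 => hF0 (by rw [hFn, h0, zero_smul])
    have hFt : ∀ j, inner ℝ (pd j F y) (t y) = φ * α j := fun j => by
      have e : F =ᶠ[𝓝 y] fun z => (inner ℝ (n z) (F z) : ℝ) • n z :=
        hkey.mono fun z hz => hz.2.2.2.2.2.2.1
      rw [pd_congr e, pd_smul (dn.inner ℝ dF) dn, inner_add_left, real_inner_smul_left,
        real_inner_smul_left, ont, mul_zero, add_zero, real_inner_comm (t y)]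
    have hFb : ∀ᶠ z in 𝓝 y, ∀ j, inner ℝ (pd j F z) (b z) = (0 : ℝ) := by
      filter_upwards [hkey.eventually_nhds] with z hz j
      obtain ⟨hnz, hbsz, hFsz, honz, hntz, -, hFnz, -⟩ := hz.self_of_nhds
      have oz := orthonormal_iff_ite.1 honz
      have otbz : inner ℝ (t z) (b z) = (0 : ℝ) := oz 1 2
      have onbz : inner ℝ (n z) (b z) = (0 : ℝ) := oz 0 2
      have e : F =ᶠ[𝓝 z] fun z => (inner ℝ (n z) (F z) : ℝ) • n z :=
        hz.mono fun z hz => hz.2.2.2.2.2.2.1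
      rw [pd_congr e, pd_smul (hnz.differentiableAt_of_infty.inner ℝ hFsz.differentiableAt_of_infty)
        hnz.differentiableAt_of_infty, inner_add_left, real_inner_smul_left,
        real_inner_smul_left, onbz, mul_zero, add_zero, hntz, real_inner_smul_left, otbz]
      simp
    have hfl : ∀ i, inner ℝ (flux (firstForm r) F i y) (pd i b y)
        = -inner ℝ (pd i (flux (firstForm r) F i) y) (b y) := fun i => by
      have e : (fun z => (inner ℝ (flux (firstForm r) F i z) (b z) : ℝ)) =ᶠ[𝓝 y] fun _ => (0 : ℝ) :=
        hFb.mono fun z hz => by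
          simp only [flux, Fin.sum_univ_two, inner_add_left, real_inner_smul_left, hz, mul_zero,
            add_zero]
      have := pd_congr (i := i) e
      rw [pd_inner (contDiffAt_flux hyi.metricAt hFs i).differentiableAt_of_infty db,
        pd_const] at this
      linarith
    have hlap : pd 0 (flux (firstForm r) F 0) y + pd 1 (flux (firstForm r) F 1) y = 0 := by
      rw [fBitension_eq_laplacian hy hfy, laplacian_eq_flux, smul_eq_zero] at hby
      exact hby.resolve_left (inv_ne_zero (Real.sqrt_pos.2 hyi.metricAt.det_pos).ne')
    -- The flux of `F` is orthogonal to `b`; taking the divergence of this relation, with the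
    -- divergence of the flux zero, leaves the pairing of the flux with `db`.
    have hsum : inner ℝ (flux (firstForm r) F 0 y) (pd 0 b y)
        + inner ℝ (flux (firstForm r) F 1 y) (pd 1 b y) = (0 : ℝ) := by
      rw [hfl, hfl, ← neg_add, ← inner_add_left, hlap, inner_zero_left, neg_zero]
    have hw := (Real.sqrt_pos.2 hyi.metricAt.det_pos).ne'
    have hquad : (firstForm r y 1 1 * α 0 - firstForm r y 0 1 * α 1) * μ 0
        + (firstForm r y 0 0 * α 1 - firstForm r y 1 0 * α 0) * μ 1 = 0 := by
      rw [flux, flux, flux_zero hyi.metricAt.det_pos (fun j => pd j F y),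
        flux_one hyi.metricAt.det_pos (fun j => pd j F y), hbt 0, hbt 1] at hsum
      simp only [real_inner_smul_left, real_inner_smul_right, inner_sub_left, hFt] at hsum
      have : (Real.sqrt (firstForm r y).det)⁻¹ * φ *
          ((firstForm r y 1 1 * α 0 - firstForm r y 0 1 * α 1) * μ 0
            + (firstForm r y 0 0 * α 1 - firstForm r y 1 0 * α 0) * μ 1) = 0 := by
        simp only [hμ]
        linear_combination hsum
      exact (mul_eq_zero.1 this).resolve_left (mul_ne_zero (inv_ne_zero hw) hφ0)
    -- Up to the factor `det g`, `Q` is the squared length of the one-form `α`, hence nonzero. Then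
    -- `μ` is both parallel to `α` and orthogonal to it.
    set Q : ℝ := firstForm r y 1 1 * α 0 ^ 2 - 2 * firstForm r y 0 1 * (α 0 * α 1)
      + firstForm r y 0 0 * α 1 ^ 2 with hQ
    have hs := hyi.metricAt.symm y
    have hQ0 : Q ≠ 0 := by
      have hQn : Q = ‖α 0 • pd 1 r y - α 1 • pd 0 r y‖ ^ 2 := by
        rw [← real_inner_self_eq_norm_sq]
        simp only [inner_sub_left, inner_sub_right, real_inner_smul_left, real_inner_smul_right, hQ,
          firstForm, Matrix.of_apply]
        rw [real_inner_comm (pd 0 r y) (pd 1 r y)]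
        ring
      intro h0
      rw [hQn, sq_eq_zero_iff, norm_eq_zero, sub_eq_zero] at h0
      have h1 : α 0 • cr (pd 0 r y) (pd 1 r y) = 0 := by
        rw [← cr_smul_right, h0, cr_smul_right, cr_self, smul_zero]
      have h2 : α 1 • cr (pd 0 r y) (pd 1 r y) = 0 := by
        rw [← cr_smul_left, ← h0, cr_smul_left, cr_self, smul_zero]
      have h3 : α k ≠ 0 := hk0
      have h4 : α k = 0 := by
        fin_cases k
        exacts [(smul_eq_zero.1 h1).resolve_right hyi.cr_ne,
          (smul_eq_zero.1 h2).resolve_right hyi.cr_ne]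
      exact h3 h4
    have hμ0 : μ 0 = 0 := by
      refine (mul_eq_zero.1 (?_ : Q * μ 0 = 0)).resolve_left hQ0
      linear_combination α 0 * hquad - (firstForm r y 0 0 * α 1 - firstForm r y 0 1 * α 0) * hsym
        - (α 0 * α 0 * μ 1) * hs
    have hμ1 : μ 1 = 0 := by
      refine (mul_eq_zero.1 (?_ : Q * μ 1 = 0)).resolve_left hQ0
      linear_combination α 1 * hquad + (firstForm r y 1 1 * α 0 - firstForm r y 0 1 * α 1) * hsym
        - (α 0 * α 1 * μ 1) * hs
    intro i
    rw [hbt i]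
    have : μ i = 0 := by
      fin_cases i
      exacts [hμ0, hμ1]
    simp only [hμ] at this
    rw [this, zero_smul]
  obtain ⟨ρ, hρ, hball⟩ := Metric.eventually_nhds_iff_ball.1 (hbz.and key)
  have hconst : ∀ y ∈ Metric.ball x ρ, b y = b x := fun y hy => by
    refine (convex_ball x ρ).is_const_of_fderivWithin_eq_zero (𝕜 := ℝ)
      (fun z hz => (hball z hz).1.1.differentiableAt_of_infty.differentiableWithinAt)
      (fun z hz => ?_) hy (Metric.mem_ball_self hρ)
    rw [fderivWithin_of_isOpen Metric.isOpen_ball hz]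
    ext1 a
    rw [fderiv_eq_pd, (hball z hz).1.2, (hball z hz).1.2]
    simp
  refine ⟨b x, (orthonormal_iff_ite.1 key.self_of_nhds.2.2.2.1) 2 2,
    Metric.eventually_nhds_iff_ball.2 ⟨ρ, hρ, fun y hy => ?_⟩⟩
  rw [← hconst y hy, real_inner_comm]
  exact (orthonormal_iff_ite.1 (hball y hy).2.2.2.2.1) 0 2

end Ruling

/-! ### Cylinder coordinates around a point -/

section CylinderCoordinates

variable {r : E2 → E3} {x : E2} {b : E3}

theorem clm_E2_apply {V : Type*} [NormedAddCommGroup V] [NormedSpace ℝ V] (L : E2 →L[ℝ] V)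
    (a : E2) : L a = a 0 • L (EuclideanSpace.single 0 1) + a 1 • L (EuclideanSpace.single 1 1) := by
  have : a = a 0 • EuclideanSpace.single 0 1 + a 1 • EuclideanSpace.single 1 (1 : ℝ) := by
    ext k; fin_cases k <;> simp
  conv_lhs => rw [this]
  simp only [map_add, map_smul]

theorem jacobian_ne_zero {α β α' β' : ℝ} {t b : E3}
    (h : cr (α • t + β • b) (α' • t + β' • b) ≠ 0) : α * β' - α' * β ≠ 0 := fun h0 => by
  refine h ?_
  have h1 := cr_anticomm t b
  simp only [cr_add_left, cr_add_right, cr_smul_left, cr_smul_right, cr_self, smul_zero, h1]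
  have : (α * β' - α' * β) • cr t b = 0 := by rw [h0, zero_smul]
  refine Eq.trans ?_ this
  module

/-- A surface whose normal is orthogonal to a constant unit vector `b` has local coordinates
`σ`, `ν` with `dr = t dσ + b dν`, for a unit vector field `t` orthogonal to `b`. -/
theorem exists_cylinder_coordinates (h : ∀ᶠ y in 𝓝 x, ImmersedAt r y)
    (hb : inner ℝ b b = (1 : ℝ)) (hbn : ∀ᶠ y in 𝓝 x, inner ℝ b (unitNormal r y) = (0 : ℝ)) :
    ∃ (σ ν : E2 → ℝ) (t : E2 → E3), ∀ᶠ y in 𝓝 x, ContDiffAt ℝ ∞ σ y ∧ ContDiffAt ℝ ∞ ν y ∧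
      ContDiffAt ℝ ∞ t y ∧ inner ℝ (t y) (t y) = (1 : ℝ) ∧ inner ℝ (t y) b = (0 : ℝ) ∧
      ∀ i, pd i r y = pd i σ y • t y + pd i ν y • b := by
  set n := unitNormal r with hn
  set t : E2 → E3 := fun y => cr b (n y) with htdef
  have key : ∀ᶠ y in 𝓝 x, ContDiffAt ℝ ∞ r y ∧ ContDiffAt ℝ ∞ t y ∧
      Orthonormal ℝ ![n y, t y, b] ∧
      pd 0 (fun z => (inner ℝ (t z) (pd 1 r z) : ℝ)) y
        = pd 1 (fun z => (inner ℝ (t z) (pd 0 r z) : ℝ)) y := by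
    filter_upwards [h.eventually_nhds, hbn.eventually_nhds] with y hy hby
    have hyi := hy.self_of_nhds
    have hny := hyi.contDiffAt_unitNormal
    have hnn : inner ℝ (n y) (n y) = (1 : ℝ) := hyi.inner_unitNormal_self
    have hbn := hby.self_of_nhds
    have dn := hny.differentiableAt_of_infty
    have hty : ContDiffAt ℝ ∞ t y := contDiffAt_cr contDiffAt_const hny
    have dt := hty.differentiableAt_of_infty
    have hbni : ∀ i, inner ℝ b (pd i n y) = (0 : ℝ) := fun i => by
      have := pd_congr (i := i) (show (fun z => (inner ℝ b (n z) : ℝ)) =ᶠ[𝓝 y] fun _ => 0 from hby)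
      rw [pd_inner (differentiableAt_const b) dn, pd_const, pd_const] at this
      simpa using this
    -- Here `∂ᵢt = b × ∂ᵢn` is a cross product of two vectors orthogonal to `n`, so it is normal to
    -- the surface. Therefore the one-form `⟨t, dr⟩` is closed.
    have hti : ∀ i j, inner ℝ (pd i t y) (pd j r y) = (0 : ℝ) := fun i j => by
      have e : pd i t y = cr b (pd i n y) := by
        rw [htdef, pd_cr (differentiableAt_const b) dn, pd_const]
        have := cr_smul_left 0 (n y) 0
        rw [zero_smul, zero_smul] at this
        rw [this, zero_add]
      rw [e, cr_eq_smul_of_orthogonal hnn (by rw [real_inner_comm, hbn]) (inner_unitNormal_pd hy i),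
        real_inner_smul_left, real_inner_comm (pd j r y), hn, inner_pd_unitNormal, mul_zero]
    refine ⟨hyi.smooth, hty, orthonormal_triple hnn ?_ hb (inner_cr_right _ _) ?_ ?_, ?_⟩
    · simp only [htdef]
      rw [inner_cr_cr, hb, hnn, hbn]
      ring
    · rw [real_inner_comm, hbn]
    · rw [real_inner_comm]; exact inner_cr_left _ _
    · rw [pd_inner dt (contDiffAt_pd hyi.smooth).differentiableAt_of_infty,
        pd_inner dt (contDiffAt_pd hyi.smooth).differentiableAt_of_infty, hti, hti,
        pd_comm hyi.smooth]
  obtain ⟨ρ, hρ, hball⟩ := Metric.eventually_nhds_iff_ball.1 key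
  set η : E2 → E2 →L[ℝ] ℝ := fun y => (innerSL ℝ (t y)).comp (fderiv ℝ r y) with hη
  have hηs : ∀ y ∈ Metric.ball x ρ, ContDiffAt ℝ ∞ η y := fun y hy => by
    refine ContDiffAt.clm_comp ?_ ((hball y hy).1.fderiv_right (m := ∞) (by simp))
    exact (innerSL ℝ).contDiff.contDiffAt.comp y (hball y hy).2.1
  -- The Poincaré lemma on the ball: `σ` is a primitive of `⟨t, dr⟩`.
  obtain ⟨σ, hσ⟩ := (convex_ball x ρ).exists_forall_hasFDerivAt_of_fderiv_symmetric
    Metric.isOpen_ball (show DifferentiableOn ℝ η _ from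
      fun y hy => (hηs y hy).differentiableAt_of_infty.differentiableWithinAt)
    (fun y hy u v => by
      have hd := (hηs y hy).differentiableAt_of_infty
      have e : ∀ i j, fderiv ℝ η y (EuclideanSpace.single i 1) (EuclideanSpace.single j 1)
          = pd i (fun z => (inner ℝ (t z) (pd j r z) : ℝ)) y := fun i j => by
        have : fderiv ℝ (fun z => η z (EuclideanSpace.single j 1)) y (EuclideanSpace.single i 1)
            = fderiv ℝ η y (EuclideanSpace.single i 1) (EuclideanSpace.single j 1) := by
          rw [fderiv_clm_apply hd (differentiableAt_const _)]
          simp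
        rw [← this]
        rfl
      have h01 := (hball y hy).2.2.2
      rw [clm_E2_apply (fderiv ℝ η y) u, clm_E2_apply (fderiv ℝ η y) v]
      simp only [add_apply, smul_apply]
      simp only [clm_E2_apply (fderiv ℝ η y _) u, clm_E2_apply (fderiv ℝ η y _) v, e, h01,
        smul_eq_mul]
      ring)
  have hσs : ContDiffOn ℝ ∞ σ (Metric.ball x ρ) := by
    rw [contDiffOn_infty_iff_fderiv_of_isOpen Metric.isOpen_ball]
    refine ⟨fun y hy => (hσ y hy).differentiableAt.differentiableWithinAt, fun y hy => ?_⟩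
    refine ((hηs y hy).congr_of_eventuallyEq ?_).contDiffWithinAt
    filter_upwards [Metric.isOpen_ball.mem_nhds hy] with z hz
    exact (hσ z hz).fderiv
  refine ⟨σ, fun y => inner ℝ b (r y), t, Metric.eventually_nhds_iff_ball.2 ⟨ρ, hρ, fun y hy => ?_⟩⟩
  obtain ⟨hr, ht, hon, -⟩ := hball y hy
  have o := orthonormal_iff_ite.1 hon
  refine ⟨hσs.contDiffAt (Metric.isOpen_ball.mem_nhds hy), contDiffAt_const.inner ℝ hr, ht, o 1 1,
    o 1 2, fun i => ?_⟩
  have h1 : pd i σ y = inner ℝ (t y) (pd i r y) := by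
    rw [pd, (hσ y hy).fderiv]
    rfl
  have h2 : pd i (fun z => (inner ℝ b (r z) : ℝ)) y = inner ℝ b (pd i r y) := by
    rw [pd_inner (differentiableAt_const b) hr.differentiableAt_of_infty, pd_const,
      inner_zero_left, add_zero]
  have h3 := eq_sum_of_orthonormal hon (pd i r y)
  rwa [real_inner_comm (pd i r y) (n y), hn, inner_pd_unitNormal, zero_smul, zero_add, ← h1, ← h2] at h3

/-- Coordinates `(σ, ν)` around `x`, with inverse `Ψ` taking values in `S`, in which the surface
`r` is a cylinder `a(σ) + ν b`. -/
structure CylinderChart (r : E2 → E3) (S : Set E2) (x : E2) where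
  (b : E3) (σ ν : E2 → ℝ) (a : ℝ → E3) (Ψ : ℝ × ℝ → E2) (ε : ℝ)
  ε_pos : 0 < ε
  inner_dir : inner ℝ b b = (1 : ℝ)
  smooth : ∀ s ∈ Metric.ball (σ x) ε, ContDiffAt ℝ ∞ a s
  inner_deriv : ∀ s ∈ Metric.ball (σ x) ε, inner ℝ (deriv a s) (deriv a s) = (1 : ℝ)
  perp : ∀ s ∈ Metric.ball (σ x) ε, inner ℝ (deriv a s) b = (0 : ℝ)
  center : Ψ (σ x, ν x) = x
  inverse : ∀ z ∈ Metric.ball (σ x, ν x) ε, Ψ z ∈ S ∧ ContDiffAt ℝ ∞ Ψ z ∧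
    (σ (Ψ z), ν (Ψ z)) = z ∧ ∀ᶠ y in 𝓝 (Ψ z), ContDiffAt ℝ ∞ σ y ∧ ContDiffAt ℝ ∞ ν y ∧
      σ y ∈ Metric.ball (σ x) ε ∧ r y = a (σ y) + ν y • b ∧ Ψ (σ y, ν y) = y

/-- As `∂₀r × ∂₁r` is the Jacobian of `(σ, ν)` times `t × b`, the inverse function theorem applies.
In the new coordinates `dr = t dσ + b dν`, so `r - ν b` does not depend on `ν` and defines the
curve. The set `S` carries further local properties into the chart. -/
theorem exists_cylinderChart (h : ∀ᶠ y in 𝓝 x, ImmersedAt r y)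
    (hb : inner ℝ b b = (1 : ℝ)) (hbn : ∀ᶠ y in 𝓝 x, inner ℝ b (unitNormal r y) = (0 : ℝ))
    {S : Set E2} (hS : S ∈ 𝓝 x) : Nonempty (CylinderChart r S x) := by
  obtain ⟨σ, ν, t, hc⟩ := exists_cylinder_coordinates h hb hbn
  set Φ : E2 → ℝ × ℝ := fun y => (σ y, ν y) with hΦ
  have key : ∀ᶠ y in 𝓝 x, y ∈ S ∧ ContDiffAt ℝ ∞ r y ∧ ContDiffAt ℝ ∞ σ y ∧ ContDiffAt ℝ ∞ ν y ∧
      inner ℝ (t y) (t y) = (1 : ℝ) ∧ inner ℝ (t y) b = (0 : ℝ) ∧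
      (∀ i, pd i r y = pd i σ y • t y + pd i ν y • b) ∧
      ∃ L : E2 ≃L[ℝ] ℝ × ℝ, HasFDerivAt Φ (L : E2 →L[ℝ] ℝ × ℝ) y := by
    filter_upwards [h, hc, hS] with y hy ⟨hσ, hν, ht, htt, htb, hr⟩ hyS
    refine ⟨hyS, hy.smooth, hσ, hν, htt, htb, hr, ?_⟩
    have hJ : pd 0 σ y * pd 1 ν y - pd 1 σ y * pd 0 ν y ≠ 0 := by
      have := hy.cr_ne
      rw [hr 0, hr 1] at this
      exact jacobian_ne_zero this
    have hd : HasFDerivAt Φ ((fderiv ℝ σ y).prod (fderiv ℝ ν y)) y :=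
      hσ.differentiableAt_of_infty.hasFDerivAt.prodMk hν.differentiableAt_of_infty.hasFDerivAt
    have hinj : Function.Injective ((fderiv ℝ σ y).prod (fderiv ℝ ν y) : E2 →ₗ[ℝ] ℝ × ℝ) := by
      rw [injective_iff_map_eq_zero]
      intro a ha
      have h1 : fderiv ℝ σ y a = 0 := congrArg Prod.fst ha
      have h2 : fderiv ℝ ν y a = 0 := congrArg Prod.snd ha
      rw [fderiv_eq_pd] at h1 h2
      simp only [smul_eq_mul] at h1 h2
      have h3 : a 0 = 0 := (mul_eq_zero.1 (show
        (pd 0 σ y * pd 1 ν y - pd 1 σ y * pd 0 ν y) * a 0 = 0 by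
          linear_combination pd 1 ν y * h1 - pd 1 σ y * h2)).resolve_left hJ
      have h4 : a 1 = 0 := (mul_eq_zero.1 (show
        (pd 0 σ y * pd 1 ν y - pd 1 σ y * pd 0 ν y) * a 1 = 0 by
          linear_combination pd 0 σ y * h2 - pd 0 ν y * h1)).resolve_left hJ
      ext k; fin_cases k <;> assumption
    refine ⟨(LinearMap.linearEquivOfInjective _ hinj (by simp)).toContinuousLinearEquiv, ?_⟩
    exact hd.congr_fderiv (ContinuousLinearMap.ext fun _ => rfl)
  obtain ⟨L, hL⟩ := key.self_of_nhds.2.2.2.2.2.2.2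
  have hΦx : ContDiffAt ℝ ∞ Φ x := key.self_of_nhds.2.2.1.prodMk key.self_of_nhds.2.2.2.1
  set e := hΦx.toOpenPartialHomeomorph Φ hL (by simp) with he
  have hxs : x ∈ e.source := hΦx.mem_toOpenPartialHomeomorph_source hL (by simp)
  have hxt : Φ x ∈ e.target := e.map_source hxs
  obtain ⟨W, hWk, hWo, hxW⟩ := eventually_nhds_iff.1 key
  have hsx : e.symm (Φ x) = x := e.left_inv hxs
  have hnear : ∀ᶠ z in 𝓝 (Φ x), z ∈ e.target ∧ e.symm z ∈ W := by
    refine (e.open_target.eventually_mem hxt).and ?_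
    have := e.continuousAt_symm hxt
    exact this.eventually_mem (by rw [hsx]; exact hWo.mem_nhds hxW)
  obtain ⟨ε, hε, hball⟩ := Metric.eventually_nhds_iff_ball.1 hnear
  have hΨs : ∀ z ∈ Metric.ball (Φ x) ε, ContDiffAt ℝ ∞ e.symm z := fun z hz => by
    obtain ⟨hzt, hzW⟩ := hball z hz
    obtain ⟨-, -, h1, h2, -, -, -, L', hL'⟩ := hWk _ hzW
    exact e.contDiffAt_symm hzt hL' (h1.prodMk h2)
  have hR : ∀ z ∈ Metric.ball (Φ x) ε, HasFDerivAt (fun z => r (e.symm z))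
      ((ContinuousLinearMap.fst ℝ ℝ ℝ).smulRight (t (e.symm z))
        + (ContinuousLinearMap.snd ℝ ℝ ℝ).smulRight b) z := fun z hz => by
    obtain ⟨hzt, hzW⟩ := hball z hz
    obtain ⟨-, hr, h1, h2, -, -, h3, -⟩ := hWk _ hzW
    have dΨ := (hΨs z hz).differentiableAt_of_infty.hasFDerivAt
    have c := hr.differentiableAt_of_infty.hasFDerivAt.comp z dΨ
    have c1 := h1.differentiableAt_of_infty.hasFDerivAt.comp z dΨ
    have c2 := h2.differentiableAt_of_infty.hasFDerivAt.comp z dΨ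
    have e1 : (fun w => e (e.symm w)) =ᶠ[𝓝 z] id :=
      (e.open_target.eventually_mem hzt).mono fun w hw => e.right_inv hw
    have k1 : (fderiv ℝ σ (e.symm z)).comp (fderiv ℝ e.symm z) = ContinuousLinearMap.fst ℝ ℝ ℝ :=
      c1.unique (hasFDerivAt_fst.congr_of_eventuallyEq
        (e1.mono fun w hw => congrArg Prod.fst hw))
    have k2 : (fderiv ℝ ν (e.symm z)).comp (fderiv ℝ e.symm z) = ContinuousLinearMap.snd ℝ ℝ ℝ :=
      c2.unique (hasFDerivAt_snd.congr_of_eventuallyEq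
        (e1.mono fun w hw => congrArg Prod.snd hw))
    refine HasFDerivAt.congr_fderiv c (ContinuousLinearMap.ext fun w => ?_)
    have k1w := congrArg (fun A => A w) k1
    have k2w := congrArg (fun A => A w) k2
    simp only [ContinuousLinearMap.comp_apply, fderiv_eq_pd (u := σ), fderiv_eq_pd (u := ν),
      smul_eq_mul] at k1w k2w
    rw [ContinuousLinearMap.comp_apply, fderiv_eq_pd (u := r), h3, h3, add_apply,
      ContinuousLinearMap.smulRight_apply, ContinuousLinearMap.smulRight_apply, ← k1w, ← k2w]
    module
  have hfst : ∀ s ∈ Metric.ball (σ x) ε, (s, ν x) ∈ Metric.ball (Φ x) ε := fun s hs => by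
    rw [← ball_prod_same]
    exact ⟨hs, Metric.mem_ball_self hε⟩
  -- The curve is read off on the slice `ν = ν x`; `hrep` shows that every other slice gives the
  -- same curve.
  set a : ℝ → E3 := fun s => r (e.symm (s, ν x)) - ν x • b with ha
  have hpath : ∀ s v : ℝ, HasDerivAt (fun s : ℝ => (s, v)) (1, 0) s := fun s v =>
    (hasDerivAt_id s).prodMk (hasDerivAt_const s v)
  have hda : ∀ s ∈ Metric.ball (σ x) ε, HasDerivAt a (t (e.symm (s, ν x))) s := fun s hs => by
    exact (((hR _ (hfst s hs)).comp_hasDerivAt s (hpath s (ν x))).sub_const (ν x • b)).congr_deriv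
      (by simp)
  have hrep : ∀ z ∈ Metric.ball (Φ x) ε, r (e.symm z) = a z.1 + z.2 • b := by
    rintro ⟨s, v⟩ hz
    rw [← ball_prod_same] at hz
    obtain ⟨hs, hv⟩ := hz
    have hm : ∀ v' ∈ Metric.ball (ν x) ε, (s, v') ∈ Metric.ball (Φ x) ε := fun v' hv' => by
      rw [← ball_prod_same]
      exact ⟨hs, hv'⟩
    have hd : ∀ v' ∈ Metric.ball (ν x) ε,
        HasDerivAt (fun v => r (e.symm (s, v)) - v • b) 0 v' := fun v' hv' => by
      have p : HasDerivAt (fun v : ℝ => (s, v)) (0, 1) v' :=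
        (hasDerivAt_const v' s).prodMk (hasDerivAt_id v')
      exact (((hR _ (hm v' hv')).comp_hasDerivAt v' p).sub
        ((hasDerivAt_id v').smul_const b)).congr_deriv (by simp)
    have := Metric.isOpen_ball.is_const_of_deriv_eq_zero (convex_ball (ν x) ε).isPreconnected
      (fun v' hv' => (hd v' hv').differentiableAt.differentiableWithinAt)
      (fun v' hv' => (hd v' hv').deriv) hv (Metric.mem_ball_self hε)
    simp only at this
    simp only [ha, ← this]
    abel
  refine ⟨⟨b, σ, ν, a, e.symm, ε, hε, hb, fun s hs => ?_, fun s hs => ?_, fun s hs => ?_, hsx,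
    fun z hz => ?_⟩⟩
  · obtain ⟨-, hr, -⟩ := hWk _ (hball _ (hfst s hs)).2
    exact (hr.comp s ((hΨs _ (hfst s hs)).comp s (contDiffAt_id.prodMk contDiffAt_const))).sub
      contDiffAt_const
  · rw [(hda s hs).deriv]
    exact (hWk _ (hball _ (hfst s hs)).2).2.2.2.2.1
  · rw [(hda s hs).deriv]
    exact (hWk _ (hball _ (hfst s hs)).2).2.2.2.2.2.1
  · obtain ⟨hzt, hzW⟩ := hball z hz
    have hri : e (e.symm z) = z := e.right_inv hzt
    refine ⟨(hWk _ hzW).1, hΨs z hz, hri, ?_⟩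
    have hcont : ContinuousAt e (e.symm z) := e.continuousAt (e.map_target hzt)
    filter_upwards [hWo.mem_nhds hzW, e.open_source.mem_nhds (e.map_target hzt),
      hcont.eventually_mem (by rw [hri]; exact Metric.isOpen_ball.mem_nhds hz)] with y h1 h2 h3
    obtain ⟨-, -, h4, h5, -⟩ := hWk _ h1
    refine ⟨h4, h5, ?_, ?_, e.left_inv h2⟩
    · have : Φ y ∈ Metric.ball (Φ x) ε := h3
      rw [← ball_prod_same] at this
      exact this.1
    · have := hrep _ h3
      rwa [e.left_inv h2] at this

end CylinderCoordinates

/-! ### The Laplacian in flat coordinates -/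

section FlatLaplacian

variable {V : Type*} [NormedAddCommGroup V] [NormedSpace ℝ V]

/-- In coordinates `(σ, ν)` with metric `dσ² + dν²` the Laplacian is the flat one. -/
theorem laplacian_comp_flat {g : E2 → Matrix (Fin 2) (Fin 2) ℝ} {σ ν : E2 → ℝ} {x : E2}
    {U : ℝ × ℝ → V} (hσ : ContDiffAt ℝ ∞ σ x) (hν : ContDiffAt ℝ ∞ ν x)
    (hσν : ∀ᶠ y in 𝓝 x, DifferentiableAt ℝ σ y ∧ DifferentiableAt ℝ ν y)
    (hg : ∀ᶠ y in 𝓝 x, ∀ i j, g y i j = pd i σ y * pd j σ y + pd i ν y * pd j ν y)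
    (hdet : 0 < (g x).det) (hU : ContDiffAt ℝ ∞ U (σ x, ν x))
    (hU' : ∀ᶠ z in 𝓝 (σ x, ν x), DifferentiableAt ℝ U z) :
    laplacian g (fun y => U (σ y, ν y)) x
      = fderiv ℝ (fun z => fderiv ℝ U z (1, 0)) (σ x, ν x) (1, 0)
        + fderiv ℝ (fun z => fderiv ℝ U z (0, 1)) (σ x, ν x) (0, 1) := by
  have hchain : ∀ {W : ℝ × ℝ → V} {y : E2}, DifferentiableAt ℝ σ y → DifferentiableAt ℝ ν y →
      DifferentiableAt ℝ W (σ y, ν y) → ∀ i, pd i (fun y => W (σ y, ν y)) y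
        = pd i σ y • fderiv ℝ W (σ y, ν y) (1, 0) + pd i ν y • fderiv ℝ W (σ y, ν y) (0, 1) := by
    intro W y h1 h2 h3 i
    have := (h3.hasFDerivAt.comp y (h1.hasFDerivAt.prodMk h2.hasFDerivAt)).fderiv
    simp only [Function.comp_def] at this
    rw [pd, this, ContinuousLinearMap.comp_apply, ContinuousLinearMap.prod_apply, ← map_smul,
      ← map_smul, ← map_add]
    congr 1
    simp [pd]
  set J : E2 → ℝ := fun y => pd 0 σ y * pd 1 ν y - pd 1 σ y * pd 0 ν y with hJ
  have hdetJ : ∀ᶠ y in 𝓝 x, (g y).det = J y ^ 2 := hg.mono fun y hy => by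
    rw [Matrix.det_fin_two, hy, hy, hy, hy]
    ring
  have hJx : J x ≠ 0 := fun h0 => by
    rw [hdetJ.self_of_nhds, h0] at hdet
    norm_num at hdet
  have hJc : ContinuousAt J x := by
    have := ((contDiffAt_pd (i := 0) hσ).mul (contDiffAt_pd (i := 1) hν)).sub
      ((contDiffAt_pd (i := 1) hσ).mul (contDiffAt_pd (i := 0) hν))
    exact this.continuousAt
  -- Since `√(det g) = |J|`, the sign of the Jacobian is fixed locally as `s = ±1`. The flux then
  -- has the entries of the cofactor matrix of `d(σ, ν)` as coefficients, and the mixed second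
  -- derivatives of `σ` and `ν` cancel in its divergence.
  obtain ⟨s, hs0, hs⟩ : ∃ s : ℝ, s ≠ 0 ∧ ∀ᶠ y in 𝓝 x, J y ≠ 0 ∧ |J y| = s * J y := by
    rcases lt_or_gt_of_ne hJx with hlt | hgt
    · refine ⟨-1, by norm_num, (hJc.eventually_lt continuousAt_const hlt).mono fun y hy => ?_⟩
      rw [abs_of_neg hy]
      exact ⟨hy.ne, by ring⟩
    · refine ⟨1, by norm_num, (continuousAt_const.eventually_lt hJc hgt).mono fun y hy => ?_⟩
      rw [abs_of_pos hy]
      exact ⟨hy.ne', by ring⟩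
  set p : E2 → V := fun y => fderiv ℝ U (σ y, ν y) (1, 0) with hp
  set q : E2 → V := fun y => fderiv ℝ U (σ y, ν y) (0, 1) with hq
  have hΦ : ContDiffAt ℝ ∞ (fun y => (σ y, ν y)) x := hσ.prodMk hν
  have hUd : ContDiffAt ℝ ∞ (fderiv ℝ U) (σ x, ν x) := hU.fderiv_right (by simp)
  have hps : DifferentiableAt ℝ p x :=
    ((hUd.comp x hΦ).clm_apply contDiffAt_const).differentiableAt_of_infty
  have hqs : DifferentiableAt ℝ q x :=
    ((hUd.comp x hΦ).clm_apply contDiffAt_const).differentiableAt_of_infty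
  have hev := hσν.and (hg.and (hs.and (hdetJ.and (hΦ.continuousAt.eventually hU'))))
  have e0 : flux g (fun y => U (σ y, ν y)) 0
      =ᶠ[𝓝 x] fun y => s⁻¹ • (pd 1 ν y • p y - pd 1 σ y • q y) := by
    filter_upwards [hev] with y ⟨⟨h1, h2⟩, h3, ⟨h4, h5⟩, h6, h7⟩
    have hd : 0 < (g y).det := by rw [h6]; positivity
    rw [flux, flux_zero hd (fun j => pd j _ y), hchain h1 h2 h7, hchain h1 h2 h7, h3, h3, h6,
      Real.sqrt_sq_eq_abs, h5]
    simp only [hp, hq]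
    match_scalars <;> field_simp <;> simp only [hJ] <;> ring
  have e1 : flux g (fun y => U (σ y, ν y)) 1
      =ᶠ[𝓝 x] fun y => s⁻¹ • (pd 0 σ y • q y - pd 0 ν y • p y) := by
    filter_upwards [hev] with y ⟨⟨h1, h2⟩, h3, ⟨h4, h5⟩, h6, h7⟩
    have hd : 0 < (g y).det := by rw [h6]; positivity
    rw [flux, flux_one hd (fun j => pd j _ y), hchain h1 h2 h7, hchain h1 h2 h7, h3, h3, h6,
      Real.sqrt_sq_eq_abs, h5]
    simp only [hp, hq]
    match_scalars <;> field_simp <;> simp only [hJ] <;> ring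
  have dσ : ∀ i, DifferentiableAt ℝ (pd i σ) x := fun i =>
    (contDiffAt_pd hσ).differentiableAt_of_infty
  have dν : ∀ i, DifferentiableAt ℝ (pd i ν) x := fun i =>
    (contDiffAt_pd hν).differentiableAt_of_infty
  have hpsmul : ∀ {i : Fin 2} {w : E2 → V}, DifferentiableAt ℝ w x →
      pd i (fun y => s⁻¹ • w y) x = s⁻¹ • pd i w x := fun {i w} hw => by
    rw [pd_smul (differentiableAt_const _) hw, pd_const, zero_smul, add_zero]
  have hd1 : ∀ z, DifferentiableAt ℝ (fun w => fderiv ℝ U w z) (σ x, ν x) := fun z =>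
    (hUd.clm_apply contDiffAt_const).differentiableAt_of_infty
  have dσx := hσ.differentiableAt_of_infty
  have dνx := hν.differentiableAt_of_infty
  have hdet' := hdetJ.self_of_nhds
  obtain ⟨hJ0, hsJ⟩ := hs.self_of_nhds
  rw [laplacian_eq_flux, pd_congr e0, pd_congr e1,
    hpsmul (((dν 1).fun_smul hps).fun_sub ((dσ 1).fun_smul hqs)),
    hpsmul (((dσ 0).fun_smul hqs).fun_sub ((dν 0).fun_smul hps)),
    pd_sub ((dν 1).fun_smul hps) ((dσ 1).fun_smul hqs),
    pd_sub ((dσ 0).fun_smul hqs) ((dν 0).fun_smul hps),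
    pd_smul (dν 1) hps, pd_smul (dσ 1) hqs, pd_smul (dσ 0) hqs, pd_smul (dν 0) hps,
    pd_comm hν (i := 1) (j := 0), pd_comm hσ (i := 1) (j := 0),
    hchain dσx dνx (hd1 (1, 0)) 0, hchain dσx dνx (hd1 (1, 0)) 1,
    hchain dσx dνx (hd1 (0, 1)) 0, hchain dσx dνx (hd1 (0, 1)) 1,
    hdet', Real.sqrt_sq_eq_abs, hsJ]
  have hs2 : s * s = 1 := by
    have : |J x| * |J x| = J x * J x := abs_mul_abs_self _
    rw [hsJ] at this
    have h0 : J x * J x ≠ 0 := mul_ne_zero hJ0 hJ0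
    exact mul_right_cancel₀ h0 (by linear_combination this)
  have hsi : s⁻¹ = s := by
    rw [inv_eq_iff_eq_inv]
    exact eq_inv_of_mul_eq_one_left hs2
  rw [mul_inv, hsi]
  have hJJ : (J x)⁻¹ * J x = 1 := inv_mul_cancel₀ hJ0
  simp only [hJ] at hJJ ⊢
  match_scalars <;> first
    | ring1
    | linear_combination (J x)⁻¹ * (J x) * hs2 + hJJ

end FlatLaplacian

/-! ### Curvature profiles and uniqueness for the governing equations -/

section Profile

theorem hasDerivAt_exp_mul (c s : ℝ) :
    HasDerivAt (fun s => Real.exp (c * s)) (c * Real.exp (c * s)) s := by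
  have := ((hasDerivAt_id s).const_mul c).exp
  simpa [mul_comm] using this

theorem hasDerivAt_cos_mul (c s : ℝ) :
    HasDerivAt (fun s => Real.cos (c * s)) (-(c * Real.sin (c * s))) s := by
  have := ((hasDerivAt_id s).const_mul c).cos
  simpa [mul_comm] using this

theorem hasDerivAt_sin_mul (c s : ℝ) :
    HasDerivAt (fun s => Real.sin (c * s)) (c * Real.cos (c * s)) s := by
  have := ((hasDerivAt_id s).const_mul c).sin
  simpa [mul_comm] using this

/-- The reciprocals of the functions `κ_N(·, K)` solve the initial value problem
`y'' = -4 K y + 2 C`, up to sign, if the constant `C` is compatible with the initial values. -/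
theorem exists_profile (K s₀ y₀ z₀ C : ℝ) (hC : z₀ ^ 2 = -4 - 4 * K * y₀ ^ 2 + 4 * C * y₀) :
    ∃ δ : ℝ, (δ = 1 ∨ δ = -1) ∧ ∃ C₁ C₂ C₃ C₄ C₅ : ℝ, (K < 0 → 0 ≤ 4 * C₁ * C₂ + 1 / K) ∧
      ∃ y z : ℝ → ℝ, ContDiff ℝ ω y ∧ y s₀ = δ * y₀ ∧ z s₀ = δ * z₀ ∧
        (∀ s, HasDerivAt y (z s) s) ∧ (∀ s, HasDerivAt z (-(4 * K * y s) + 2 * (δ * C)) s) ∧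
        ∀ s, kappaN K C₁ C₂ C₃ C₄ C₅ s = (y s)⁻¹ := by
  -- The formulas for `κ_N` contain a nonnegative root, while the constant solution `m = C / (2K)`
  -- can have either sign; replacing `y` by `δ y` repairs this, and geometrically reverses the
  -- normal.
  have hsign : ∀ m R : ℝ, m ^ 2 = R → ∃ δ : ℝ, (δ = 1 ∨ δ = -1) ∧ Real.sqrt R = δ * m := by
    rintro m R rfl
    rw [Real.sqrt_sq_eq_abs]
    rcases abs_choice m with h | h
    · exact ⟨1, Or.inl rfl, by rw [h, one_mul]⟩
    · exact ⟨-1, Or.inr rfl, by rw [h]; ring⟩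
  have hδ2 : ∀ {δ : ℝ}, (δ = 1 ∨ δ = -1) → δ * δ = 1 := by
    rintro δ (rfl | rfl) <;> norm_num
  rcases lt_trichotomy K 0 with hK | hK | hK
  · -- exponential profiles
    set c := 2 * Real.sqrt (-K) with hc
    have hsq : Real.sqrt (-K) * Real.sqrt (-K) = -K := Real.mul_self_sqrt (by linarith)
    have hc2 : c * c = -(4 * K) := by rw [hc]; linear_combination 4 * hsq
    have hc0 : c ≠ 0 := fun h0 => by rw [h0] at hc2; linarith
    set m := C / (2 * K) with hm
    have hmK : m * (2 * K) = C := div_mul_cancel₀ _ (by linarith [hK.ne])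
    -- `P` and `Q` are the coefficients of the growing and decaying exponentials centred at `s₀`.
    -- The compatibility of `C` with the initial values is exactly `m² = 4PQ + 1/K`, which also
    -- yields the sign condition.
    set P := ((y₀ - m) + z₀ / c) / 2 with hP
    set Q := ((y₀ - m) - z₀ / c) / 2 with hQ
    have hzc : z₀ / c * c = z₀ := div_mul_cancel₀ _ hc0
    have hee : Real.exp (-(c * s₀)) * Real.exp (c * s₀) = 1 := by
      rw [← Real.exp_add, neg_add_cancel, Real.exp_zero]
    have hPQ : m ^ 2 = 4 * P * Q + 1 / K := by
      have h1 : 4 * P * Q = (y₀ - m) ^ 2 - (z₀ / c) ^ 2 := by rw [hP, hQ]; ring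
      have h2 : (z₀ / c) ^ 2 * (4 * K) = -z₀ ^ 2 := by
        linear_combination (z₀ / c) ^ 2 * hc2 - (z₀ / c * c + z₀) * hzc
      have h3 : 1 / K * K = 1 := div_mul_cancel₀ _ hK.ne
      have : (4 * K) * (m ^ 2 - (4 * P * Q + 1 / K)) = 0 := by
        rw [h1]
        linear_combination h2 - 4 * h3 - hC + (4 * y₀) * hmK
      have := (mul_eq_zero.1 this).resolve_left (by linarith [hK.ne])
      linarith
    obtain ⟨δ, hδ, hδm⟩ := hsign m _ hPQ
    have hprod : 4 * (δ * P * Real.exp (-(c * s₀))) * (δ * Q * Real.exp (c * s₀)) = 4 * P * Q := by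
      linear_combination (4 * P * Q * Real.exp (-(c * s₀)) * Real.exp (c * s₀)) * hδ2 hδ
        + (4 * P * Q) * hee
    refine ⟨δ, hδ, δ * P * Real.exp (-(c * s₀)), δ * Q * Real.exp (c * s₀), 0, 0, 0, fun _ => ?_,
      fun s => δ * P * Real.exp (-(c * s₀)) * Real.exp (c * s)
        + δ * Q * Real.exp (c * s₀) * Real.exp (-(c * s)) + δ * m,
      fun s => c * (δ * P * Real.exp (-(c * s₀)) * Real.exp (c * s)
        - δ * Q * Real.exp (c * s₀) * Real.exp (-(c * s))), ?_, ?_, ?_, fun s => ?_, fun s => ?_,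
      fun s => ?_⟩
    · rw [hprod, ← hPQ]; positivity
    · have h1 : ContDiff ℝ ω Real.exp := Real.contDiff_exp
      fun_prop
    · have : P + Q = y₀ - m := by rw [hP, hQ]; ring
      linear_combination (δ * P + δ * Q) * hee + δ * this
    · have : (P - Q) * c = z₀ := by rw [hP, hQ]; linear_combination hzc
      linear_combination (c * δ * P - c * δ * Q) * hee + δ * this
    · have h1 := hasDerivAt_exp_mul c s
      have h2 := hasDerivAt_exp_mul (-c) s
      simp only [neg_mul] at h2
      refine (((h1.const_mul _).add (h2.const_mul _)).add_const _).congr_deriv ?_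
      ring
    · have h1 := hasDerivAt_exp_mul c s
      have h2 := hasDerivAt_exp_mul (-c) s
      simp only [neg_mul] at h2
      refine (((h1.const_mul _).sub (h2.const_mul _)).const_mul _).congr_deriv ?_
      linear_combination (δ * P * Real.exp (-(c * s₀)) * Real.exp (c * s)
        + δ * Q * Real.exp (c * s₀) * Real.exp (-(c * s))) * hc2 + 2 * δ * hmK
    · rw [kappaN, if_pos hK, ← hc, hprod, hδm, one_div]
  · -- rational profiles
    subst hK
    have hC' : z₀ ^ 2 = -4 + 4 * C * y₀ := by linear_combination hC
    have hC0 : C ≠ 0 := fun h0 => by rw [h0] at hC'; nlinarith [sq_nonneg z₀]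
    -- Completing the square in `y₀ + z₀ (s - s₀) + C (s - s₀)²`, with `4 C y₀ = z₀² + 4`, gives
    -- these values of `C₃` and `C₄`.
    refine ⟨1, Or.inl rfl, 0, 0, 4 * C, z₀ / (2 * C) - s₀, 0, fun h => absurd h (lt_irrefl _),
      fun s => y₀ + z₀ * (s - s₀) + C * (s - s₀) ^ 2, fun s => z₀ + 2 * C * (s - s₀), ?_, ?_, ?_,
      fun s => ?_, fun s => ?_, fun s => ?_⟩
    · fun_prop
    · ring
    · ring
    · have h := (hasDerivAt_id s).sub_const s₀
      refine ((((h.const_mul z₀).const_add y₀).add ((h.pow 2).const_mul C))).congr_deriv ?_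
      simp only [id]
      ring
    · have h := (hasDerivAt_id s).sub_const s₀
      refine ((h.const_mul (2 * C)).const_add z₀).congr_deriv ?_
      ring
    · rw [kappaN, if_neg (lt_irrefl _), if_pos rfl, ← inv_div]
      congr 1
      field_simp
      linear_combination 16 * hC'
  · -- trigonometric profiles
    set c := 2 * Real.sqrt K with hc
    have hsq : Real.sqrt K * Real.sqrt K = K := Real.mul_self_sqrt hK.le
    have hc2 : c * c = 4 * K := by rw [hc]; linear_combination 4 * hsq
    have hc0 : c ≠ 0 := fun h0 => by rw [h0] at hc2; linarith
    set m := C / (2 * K) with hm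
    have hmK : m * (2 * K) = C := div_mul_cancel₀ _ (by linarith [hK.ne'])
    set P := y₀ - m with hP
    set Q := z₀ / c with hQ
    have hzc : Q * c = z₀ := div_mul_cancel₀ _ hc0
    have hcs := Real.sin_sq_add_cos_sq (c * s₀)
    have hPQ : m ^ 2 = 1 / K + (P ^ 2 + Q ^ 2) := by
      have h2 : Q ^ 2 * (4 * K) = z₀ ^ 2 := by
        linear_combination (-Q ^ 2) * hc2 + (Q * c + z₀) * hzc
      have h3 : 1 / K * K = 1 := div_mul_cancel₀ _ hK.ne'
      have : (4 * K) * (m ^ 2 - (1 / K + (P ^ 2 + Q ^ 2))) = 0 := by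
        rw [hP]
        linear_combination -h2 - 4 * h3 - hC + (4 * y₀) * hmK
      have := (mul_eq_zero.1 this).resolve_left (by linarith [hK.ne'])
      linarith
    obtain ⟨δ, hδ, hδm⟩ := hsign m _ hPQ
    -- The addition formulas move the phase from `s - s₀` to `s`; this rotation preserves `P² + Q²`.
    set A := δ * (P * Real.cos (c * s₀) - Q * Real.sin (c * s₀)) with hA
    set B := δ * (P * Real.sin (c * s₀) + Q * Real.cos (c * s₀)) with hB
    have hprod : A ^ 2 + B ^ 2 = P ^ 2 + Q ^ 2 := by
      rw [hA, hB]
      linear_combination ((P ^ 2 + Q ^ 2) * (Real.sin (c * s₀) ^ 2 + Real.cos (c * s₀) ^ 2)) * hδ2 hδ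
        + (P ^ 2 + Q ^ 2) * hcs
    refine ⟨δ, hδ, 0, 0, 0, A, B, fun h => absurd h hK.not_gt,
      fun s => A * Real.cos (c * s) + B * Real.sin (c * s) + δ * m,
      fun s => c * (B * Real.cos (c * s) - A * Real.sin (c * s)), ?_, ?_, ?_, fun s => ?_,
      fun s => ?_, fun s => ?_⟩
    · have h1 : ContDiff ℝ ω Real.cos := Real.contDiff_cos
      have h2 : ContDiff ℝ ω Real.sin := Real.contDiff_sin
      fun_prop
    · simp only [hA, hB]
      linear_combination (δ * P) * hcs + δ * hP
    · simp only [hA, hB]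
      linear_combination (δ * Q * c) * hcs + δ * hzc
    · refine ((((hasDerivAt_cos_mul c s).const_mul A).add
        ((hasDerivAt_sin_mul c s).const_mul B)).add_const _).congr_deriv ?_
      ring
    · refine ((((hasDerivAt_cos_mul c s).const_mul B).sub
        ((hasDerivAt_sin_mul c s).const_mul A)).const_mul c).congr_deriv ?_
      linear_combination (-(A * Real.cos (c * s) + B * Real.sin (c * s))) * hc2 + 2 * δ * hmK
    · rw [kappaN, if_neg hK.not_gt, if_neg hK.ne', ← hc, hprod, hδm, one_div]

/-- A function with a first integral of the type of `1 / κ_N` does not vanish, and its logarithmic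
derivative is bounded. -/
theorem exists_log_deriv_bound {y z : ℝ → ℝ} {K C : ℝ} (hy : ∀ s, HasDerivAt y (z s) s)
    (hz : ∀ s, z s ^ 2 = -4 - 4 * K * y s ^ 2 + 4 * C * y s) :
    ∃ A : ℝ, ∀ s, ∃ d, HasDerivAt (fun t => Real.log (1 + y t ^ 2)) d s ∧ |d| ≤ A := by
  have hd : ∀ s, HasDerivAt (fun t => 1 + y t ^ 2) (2 * y s * z s) s := fun s =>
    (((hy s).fun_pow 2).const_add 1).congr_deriv (by simp)
  -- The first integral bounds `z²` by a multiple of `1 + y²`, so `2yz / (1 + y²)` is bounded. The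
  -- choice `1 + 16 B`, with `B = |K| + |C|`, only has to satisfy `16 B ≤ (1 + 16 B)²`.
  refine ⟨1 + 16 * (|K| + |C|), fun s => ⟨_, (hd s).log (by positivity), ?_⟩⟩
  set Y := y s
  set Z := z s with hZ
  have h1 : Z ^ 2 ≤ 4 * |K| * Y ^ 2 + 4 * |C| * |Y| := by
    have h2 : -K * Y ^ 2 ≤ |K| * Y ^ 2 := mul_le_mul_of_nonneg_right (neg_le_abs K) (sq_nonneg _)
    have h3 : C * Y ≤ |C| * |Y| := by rw [← abs_mul]; exact le_abs_self _
    have := hz s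
    simp only [← hZ] at this
    linarith
  have h4 : |Y| ≤ 1 + Y ^ 2 := by nlinarith [sq_abs Y, sq_nonneg (|Y| - 1), abs_nonneg Y]
  have h5 : Y ^ 2 ≤ 1 + Y ^ 2 := by linarith
  have h6 : Z ^ 2 ≤ 4 * (|K| + |C|) * (1 + Y ^ 2) := by
    nlinarith [mul_le_mul_of_nonneg_left h4 (abs_nonneg C),
      mul_le_mul_of_nonneg_left h5 (abs_nonneg K)]
  have hpos : 0 < 1 + Y ^ 2 := by positivity
  rw [abs_div, abs_of_pos hpos, div_le_iff₀ hpos]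
  have h7 : (2 * Y * Z) ^ 2 ≤ 16 * (|K| + |C|) * (1 + Y ^ 2) ^ 2 := by
    have : Y ^ 2 * Z ^ 2 ≤ (1 + Y ^ 2) * (4 * (|K| + |C|) * (1 + Y ^ 2)) :=
      mul_le_mul h5 h6 (sq_nonneg _) hpos.le
    nlinarith
  have hB : 0 ≤ |K| + |C| := by positivity
  have h8 : |2 * Y * Z| ≤ (1 + 16 * (|K| + |C|)) * (1 + Y ^ 2) := by
    refine abs_le_of_sq_le_sq (h7.trans ?_) (by positivity)
    rw [mul_pow]
    refine mul_le_mul_of_nonneg_right ?_ (by positivity)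
    nlinarith
  exact h8

theorem linear_ode_unique {s₀ ε k c : ℝ} {y z y₁ z₁ : ℝ → ℝ}
    (hy : ∀ s ∈ Metric.ball s₀ ε, HasDerivAt y (z s) s)
    (hz : ∀ s ∈ Metric.ball s₀ ε, HasDerivAt z (k * y s + c) s)
    (hy₁ : ∀ s ∈ Metric.ball s₀ ε, HasDerivAt y₁ (z₁ s) s)
    (hz₁ : ∀ s ∈ Metric.ball s₀ ε, HasDerivAt z₁ (k * y₁ s + c) s)
    (h0 : y s₀ = y₁ s₀) (h1 : z s₀ = z₁ s₀) : ∀ s ∈ Metric.ball s₀ ε, y s = y₁ s := by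
  intro s hs
  have hε : 0 < ε := lt_of_le_of_lt dist_nonneg hs
  set L : ℝ × ℝ →L[ℝ] ℝ × ℝ :=
    (ContinuousLinearMap.snd ℝ ℝ ℝ).prod (k • ContinuousLinearMap.fst ℝ ℝ ℝ) with hL
  have hlip : ∀ t ∈ Set.Ioo (s₀ - ε) (s₀ + ε),
      LipschitzOnWith ‖L‖₊ (fun p : ℝ × ℝ => L p + (0, c)) Set.univ := fun t _ => by
    refine (LipschitzWith.of_dist_le_mul fun p q => ?_).lipschitzOnWith
    rw [dist_add_right]
    exact L.lipschitz.dist_le_mul p q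
  rw [Real.ball_eq_Ioo] at hs hy hz hy₁ hz₁
  have := ODE_solution_unique_of_mem_Ioo (f := fun t => (y t, z t)) (g := fun t => (y₁ t, z₁ t))
    (v := fun _ p => L p + (0, c))
    (t₀ := s₀) hlip ⟨by linarith, by linarith⟩
    (fun t ht => ⟨((hy t ht).prodMk (hz t ht)).congr_deriv
      (by simp [hL]), Set.mem_univ _⟩)
    (fun t ht => ⟨((hy₁ t ht).prodMk (hz₁ t ht)).congr_deriv
      (by simp [hL]), Set.mem_univ _⟩) (by simp [h0, h1]) hs
  exact congrArg Prod.fst this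

/-- The Frenet system is skew-symmetric, so `|T - T₁|² + |N - N₁|²` is constant; no regularity of
`κ` is needed. -/
theorem frenet_unique {E : Type*} [NormedAddCommGroup E] [InnerProductSpace ℝ E] {S : Set ℝ}
    (hS : IsOpen S) (hS' : IsPreconnected S) {T N T₁ N₁ : ℝ → E} {κ : ℝ → ℝ}
    (hT : ∀ s ∈ S, HasDerivAt T (κ s • N s) s) (hN : ∀ s ∈ S, HasDerivAt N (-(κ s • T s)) s)
    (hT₁ : ∀ s ∈ S, HasDerivAt T₁ (κ s • N₁ s) s)
    (hN₁ : ∀ s ∈ S, HasDerivAt N₁ (-(κ s • T₁ s)) s) {s₀ : ℝ} (hs₀ : s₀ ∈ S)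
    (h0 : T s₀ = T₁ s₀) (h1 : N s₀ = N₁ s₀) : ∀ s ∈ S, T s = T₁ s ∧ N s = N₁ s := by
  have hd : ∀ s ∈ S, HasDerivAt (fun s => (inner ℝ (T s - T₁ s) (T s - T₁ s) : ℝ)
      + inner ℝ (N s - N₁ s) (N s - N₁ s)) 0 s := fun s hs => by
    have h2 := (hT s hs).sub (hT₁ s hs)
    have h3 := (hN s hs).sub (hN₁ s hs)
    refine ((h2.inner ℝ h2).add (h3.inner ℝ h3)).congr_deriv ?_
    have e1 : κ s • N s - κ s • N₁ s = κ s • (N s - N₁ s) := (smul_sub _ _ _).symm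
    have e2 : -(κ s • T s) - -(κ s • T₁ s) = -(κ s • (T s - T₁ s)) := by module
    simp only [Pi.sub_apply, e1, e2, inner_neg_left, inner_neg_right, real_inner_smul_left,
      real_inner_smul_right]
    rw [real_inner_comm (N s - N₁ s)]
    ring
  intro s hs
  have := hS.is_const_of_deriv_eq_zero hS'
    (fun s hs => (hd s hs).differentiableAt.differentiableWithinAt) (fun s hs => (hd s hs).deriv)
    hs hs₀
  simp only [h0, h1, sub_self, inner_zero_left, add_zero, real_inner_self_eq_norm_sq] at this
  have h4 := sq_nonneg ‖T s - T₁ s‖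
  have h5 := sq_nonneg ‖N s - N₁ s‖
  have h6 : ‖T s - T₁ s‖ ^ 2 = 0 := by linarith
  have h7 : ‖N s - N₁ s‖ ^ 2 = 0 := by linarith
  rw [sq_eq_zero_iff, norm_eq_zero, sub_eq_zero] at h6 h7
  exact ⟨h6, h7⟩

end Profile

/-! ### Complete directrices: extension and rigidity -/

/-- A complete plane curve `a` with Frenet frame `T`, `N` and binormal `b`, whose curvature `κ` is
one of the functions `κ_N(·, K)`. -/
structure Directrix where
  (a T N : ℝ → E3) (b : E3) (κ : ℝ → ℝ)
  orthonormal : ∀ s, Orthonormal ℝ ![T s, N s, b]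
  hasDerivAt_curve : ∀ s, HasDerivAt a (T s) s
  hasDerivAt_tangent : ∀ s, HasDerivAt T (κ s • N s) s
  hasDerivAt_normal : ∀ s, HasDerivAt N (-(κ s • T s)) s
  contDiff_curve : ContDiff ℝ ∞ a
  contDiff_curvature : ContDiff ℝ ω κ
  curvature_ne : ∀ s, κ s ≠ 0
  log_bound : ∃ A : ℝ, ∀ s, ∃ d,
    HasDerivAt (fun t => Real.log (1 + (κ t)⁻¹ ^ 2)) d s ∧ |d| ≤ A
  profile : ∃ K C₁ C₂ C₃ C₄ C₅ : ℝ, (K < 0 → 0 ≤ 4 * C₁ * C₂ + 1 / K) ∧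
    ∀ s, κ s = kappaN K C₁ C₂ C₃ C₄ C₅ s

theorem hasDerivAt_intervalIntegral {E : Type*} [NormedAddCommGroup E] [NormedSpace ℝ E]
    [CompleteSpace E] {u : ℝ → E} (hu : Continuous u) (s₀ s : ℝ) :
    HasDerivAt (fun t => ∫ τ in s₀..t, u τ) (u s) s :=
  intervalIntegral.integral_hasDerivAt_right (hu.intervalIntegrable _ _)
    hu.stronglyMeasurable.stronglyMeasurableAtFilter hu.continuousAt

theorem contDiff_of_hasDerivAt {E : Type*} [NormedAddCommGroup E] [NormedSpace ℝ E]
    {u u' : ℝ → E} (h : ∀ s, HasDerivAt u (u' s) s) (hu' : ContDiff ℝ ∞ u') : ContDiff ℝ ∞ u := by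
  rw [contDiff_infty_iff_deriv]
  refine ⟨fun s => (h s).differentiableAt, ?_⟩
  rwa [funext fun s => (h s).deriv]

/-- A plane curve whose radius of curvature `y` satisfies `4 - 2 y y'' + y'² = 4 K y²` is part of a
complete directrix. -/
theorem exists_directrix_extension {s₀ ε K : ℝ} (hε : 0 < ε) {a T N : ℝ → E3} {b : E3}
    {y z w : ℝ → ℝ} (hon : ∀ s ∈ Metric.ball s₀ ε, Orthonormal ℝ ![T s, N s, b])
    (ha : ∀ s ∈ Metric.ball s₀ ε, HasDerivAt a (T s) s)
    (hT : ∀ s ∈ Metric.ball s₀ ε, HasDerivAt T ((y s)⁻¹ • N s) s)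
    (hN : ∀ s ∈ Metric.ball s₀ ε, HasDerivAt N (-((y s)⁻¹ • T s)) s)
    (hy0 : ∀ s ∈ Metric.ball s₀ ε, y s ≠ 0)
    (hy : ∀ s ∈ Metric.ball s₀ ε, HasDerivAt y (z s) s)
    (hz : ∀ s ∈ Metric.ball s₀ ε, HasDerivAt z (w s) s)
    (hode : ∀ s ∈ Metric.ball s₀ ε, 4 - 2 * y s * w s + z s ^ 2 = 4 * K * y s ^ 2) :
    ∃ D : Directrix, D.b = b ∧ ∀ s ∈ Metric.ball s₀ ε, D.a s = a s := by
  have hmem : s₀ ∈ Metric.ball s₀ ε := Metric.mem_ball_self hε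
  have hpre : IsPreconnected (Metric.ball s₀ ε) := (convex_ball s₀ ε).isPreconnected
  -- the first integral
  obtain ⟨C, hC⟩ : ∃ C, ∀ s ∈ Metric.ball s₀ ε, z s ^ 2 + 4 + 4 * K * y s ^ 2 = 4 * C * y s := by
    set c : ℝ → ℝ := fun s => (z s ^ 2 + 4 + 4 * K * y s ^ 2) / (4 * y s) with hc
    have hd : ∀ s ∈ Metric.ball s₀ ε, HasDerivAt c 0 s := fun s hs => by
      have h1 := ((((hz s hs).fun_pow 2).add_const 4).fun_add
        (((hy s hs).fun_pow 2).const_mul (4 * K))).fun_div ((hy s hs).const_mul 4)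
        (mul_ne_zero four_ne_zero (hy0 s hs))
      refine h1.congr_deriv ?_
      rw [div_eq_zero_iff]
      left
      push_cast
      linear_combination (-4 * z s) * hode s hs
    refine ⟨c s₀, fun s hs => ?_⟩
    rw [← Metric.isOpen_ball.is_const_of_deriv_eq_zero hpre
      (fun s hs => (hd s hs).differentiableAt.differentiableWithinAt)
      (fun s hs => (hd s hs).deriv) hs hmem]
    have := hy0 s hs
    simp only [hc]
    field_simp
  -- Eliminating `z²` between the equation and its first integral leaves `y` times a linear
  -- equation.
  have hw : ∀ s ∈ Metric.ball s₀ ε, w s = -(4 * K) * y s + 2 * C := fun s hs =>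
    mul_left_cancel₀ (hy0 s hs) (by linear_combination (-1 / 2) * hode s hs + (1 / 2) * hC s hs)
  obtain ⟨δ, hδ, C₁, C₂, C₃, C₄, C₅, hcond, Y, Z, hYs, hY0, hZ0, hY, hZ, hprof⟩ :=
    exists_profile K s₀ (y s₀) (z s₀) C (by linear_combination hC s₀ hmem)
  have hδ2 : δ * δ = 1 := by rcases hδ with rfl | rfl <;> norm_num
  have hδinv : δ⁻¹ = δ := inv_eq_of_mul_eq_one_left hδ2
  have hYy : ∀ s ∈ Metric.ball s₀ ε, Y s = δ * y s :=
    linear_ode_unique (k := -(4 * K)) (c := 2 * (δ * C)) (fun s _ => hY s)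
      (fun s _ => (hZ s).congr_deriv (by ring)) (fun s hs => (hy s hs).const_mul δ)
      (fun s hs => ((hz s hs).const_mul δ).congr_deriv (by rw [hw s hs]; ring)) hY0 hZ0
  have hZ2 : ∀ s, Z s ^ 2 = -4 - 4 * K * Y s ^ 2 + 4 * (δ * C) * Y s := by
    have hd : ∀ s, HasDerivAt (fun s => Z s ^ 2 + 4 + 4 * K * Y s ^ 2 - 4 * (δ * C) * Y s) 0 s :=
      fun s => by
        refine (((((hZ s).fun_pow 2).add_const 4).fun_add
          (((hY s).fun_pow 2).const_mul (4 * K))).fun_sub ((hY s).const_mul _)).congr_deriv ?_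
        push_cast
        ring
    intro s
    have := is_const_of_deriv_eq_zero (fun s => (hd s).differentiableAt) (fun s => (hd s).deriv)
      s s₀
    simp only [hY0, hZ0] at this
    linear_combination this + hC s₀ hmem + (z s₀ ^ 2 + 4 * K * y s₀ ^ 2 - 4 * C * y s₀) * hδ2
  -- At a zero of `Y` the first integral would read `Z² = -4`.
  have hYne : ∀ s, Y s ≠ 0 := fun s h0 => by
    have := hZ2 s
    rw [h0] at this
    nlinarith [sq_nonneg (Z s)]
  set κ : ℝ → ℝ := fun s => (Y s)⁻¹ with hκ
  have hκs : ContDiff ℝ ω κ := hYs.inv hYne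
  have hκs' : ContDiff ℝ ∞ κ := hκs.of_le le_top
  -- `θ` is the turning angle of the tangent. The complete frame is the initial one rotated by `θ`,
  -- with normal `δ N` to match the curvature `1 / (δ y)`.
  set θ : ℝ → ℝ := fun s => ∫ τ in s₀..s, κ τ with hθ
  have hθd : ∀ s, HasDerivAt θ (κ s) s := hasDerivAt_intervalIntegral hκs.continuous s₀
  have hθs : ContDiff ℝ ∞ θ := contDiff_of_hasDerivAt hθd hκs'
  set T' : ℝ → E3 := fun s => Real.cos (θ s) • T s₀ + Real.sin (θ s) • (δ • N s₀) with hT'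
  set N' : ℝ → E3 := fun s => Real.cos (θ s) • (δ • N s₀) - Real.sin (θ s) • T s₀ with hN'
  have hT's : ContDiff ℝ ∞ T' := by
    have h1 : ContDiff ℝ ∞ Real.cos := Real.contDiff_cos
    have h2 : ContDiff ℝ ∞ Real.sin := Real.contDiff_sin
    fun_prop
  have hT'd : ∀ s, HasDerivAt T' (κ s • N' s) s := fun s => by
    refine (((hθd s).cos.smul_const (T s₀)).add ((hθd s).sin.smul_const (δ • N s₀))).congr_deriv ?_
    simp only [hN']
    module
  have hN'd : ∀ s, HasDerivAt N' (-(κ s • T' s)) s := fun s => by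
    refine (((hθd s).cos.smul_const (δ • N s₀)).sub ((hθd s).sin.smul_const (T s₀))).congr_deriv ?_
    simp only [hT']
    module
  set a' : ℝ → E3 := fun s => a s₀ + ∫ τ in s₀..s, T' τ with ha'
  have ha'd : ∀ s, HasDerivAt a' (T' s) s := fun s =>
    (hasDerivAt_intervalIntegral hT's.continuous s₀ s).const_add _
  have hθ0 : θ s₀ = 0 := by simp [hθ]
  have hfr := frenet_unique (T := T') (N := N') (T₁ := T) (N₁ := fun s => δ • N s) (κ := κ)
    Metric.isOpen_ball hpre (fun s _ => hT'd s) (fun s _ => hN'd s)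
    (fun s hs => (hT s hs).congr_deriv (by
      simp only [hκ, hYy s hs, mul_inv, hδinv, smul_smul]
      congr 1
      linear_combination -(y s)⁻¹ * hδ2))
    (fun s hs => ((hN s hs).const_smul δ).congr_deriv (by
      simp only [hκ, hYy s hs, mul_inv, hδinv, smul_smul, smul_neg]))
    hmem (by simp [hT', hθ0]) (by simp [hN', hθ0])
  refine ⟨⟨a', T', N', b, κ, fun s => ?_, ha'd, hT'd, hN'd, contDiff_of_hasDerivAt ha'd hT's, hκs,
    fun s => inv_ne_zero (hYne s), ?_, K, C₁, C₂, C₃, C₄, C₅, hcond, fun s => (hprof s).symm⟩, rfl,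
    fun s hs => ?_⟩
  · have o := orthonormal_iff_ite.1 (hon s₀ hmem)
    have o1 : inner ℝ (T s₀) (T s₀) = (1 : ℝ) := o 0 0
    have o2 : inner ℝ (N s₀) (N s₀) = (1 : ℝ) := o 1 1
    have o3 : inner ℝ b b = (1 : ℝ) := o 2 2
    have o4 : inner ℝ (T s₀) (N s₀) = (0 : ℝ) := o 0 1
    have o5 : inner ℝ (N s₀) (T s₀) = (0 : ℝ) := o 1 0
    have o6 : inner ℝ (T s₀) b = (0 : ℝ) := o 0 2
    have o7 : inner ℝ (N s₀) b = (0 : ℝ) := o 1 2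
    have hcs := Real.sin_sq_add_cos_sq (θ s)
    apply orthonormal_triple <;>
      simp only [hT', hN', inner_add_left, inner_add_right, inner_sub_left, inner_sub_right,
        real_inner_smul_left, real_inner_smul_right, o1, o2, o3, o4, o5, o6, o7]
    · linear_combination (Real.sin (θ s) ^ 2) * hδ2 + hcs
    · linear_combination (Real.cos (θ s) ^ 2) * hδ2 + hcs
    · linear_combination (Real.sin (θ s) * Real.cos (θ s)) * hδ2
    · ring
    · ring
  · simpa only [hκ, inv_inv] using exists_log_deriv_bound hY hZ2
  · have hd : ∀ s ∈ Metric.ball s₀ ε, HasDerivAt (fun s => a' s - a s) 0 s := fun s hs =>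
      ((ha'd s).sub (ha s hs)).congr_deriv (by rw [(hfr s hs).1, sub_self])
    have := Metric.isOpen_ball.is_const_of_deriv_eq_zero hpre
      (fun s hs => (hd s hs).differentiableAt.differentiableWithinAt)
      (fun s hs => (hd s hs).deriv) hs hmem
    have h0 : a' s₀ = a s₀ := by simp [ha']
    rw [h0, sub_self] at this
    exact sub_eq_zero.1 this

/-- Near `x` the parametrized surface `r` is a part of the cylinder over the directrix `D`. -/
def Directrix.Represents (D : Directrix) (r : E2 → E3) (x : E2) : Prop :=
  ∃ σ ν : E2 → ℝ, ∀ᶠ y in 𝓝 x, ContDiffAt ℝ ∞ σ y ∧ ContDiffAt ℝ ∞ ν y ∧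
    r y = D.a (σ y) + ν y • D.b

theorem pd_comp_curve {V : Type*} [NormedAddCommGroup V] [NormedSpace ℝ V] {γ : ℝ → V} {γ' : V}
    {σ : E2 → ℝ} {x : E2} (hγ : HasDerivAt γ γ' (σ x)) (hσ : DifferentiableAt ℝ σ x) (i : Fin 2) :
    pd i (fun y => γ (σ y)) x = pd i σ x • γ' := by
  have := (hγ.hasFDerivAt.comp x hσ.hasFDerivAt).fderiv
  simp only [Function.comp_def] at this
  rw [pd, this]
  simp [pd]

theorem eventually_eq_of_sq_eq_one {X : Type*} [TopologicalSpace X] {u : X → ℝ} {x : X}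
    (hu : ContinuousAt u x) (h : ∀ᶠ y in 𝓝 x, u y * u y = 1) : ∀ᶠ y in 𝓝 x, u y = u x := by
  have h1 : ∀ᶠ y in 𝓝 x, u y ∈ Metric.ball (u x) 1 := hu.eventually_mem (Metric.ball_mem_nhds _ one_pos)
  have hx := mul_self_eq_one_iff.1 h.self_of_nhds
  filter_upwards [h, h1] with y hy hy1
  rw [Metric.mem_ball, Real.dist_eq, abs_lt] at hy1
  rcases mul_self_eq_one_iff.1 hy with h2 | h2 <;> rcases hx with h3 | h3 <;>
    rw [h2, h3] at hy1 ⊢ <;> norm_num at hy1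

/-- Two complete cylinders that overlap agree up to a reparametrization and a shift along the
rulings. -/
theorem Directrix.congruent {D D₁ : Directrix} {r : E2 → E3} {x : E2}
    (him : ∀ᶠ y in 𝓝 x, ImmersedAt r y) (h : D.Represents r x) (h₁ : D₁.Represents r x) :
    ∃ ε c m η : ℝ, ε * ε = 1 ∧ D₁.b = η • D.b ∧ ∀ s, D₁.a (ε * s + c) = D.a s + m • D.b := by
  obtain ⟨σ, ν, hr⟩ := h
  obtain ⟨σ₁, ν₁, hr₁⟩ := h₁
  have key : ∀ (D : Directrix) (σ ν : E2 → ℝ), (∀ᶠ y in 𝓝 x, ContDiffAt ℝ ∞ σ y ∧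
      ContDiffAt ℝ ∞ ν y ∧ r y = D.a (σ y) + ν y • D.b) → ∀ᶠ y in 𝓝 x,
      DifferentiableAt ℝ σ y ∧ ∀ i, pd i r y = pd i σ y • D.T (σ y) + pd i ν y • D.b := by
    intro D σ ν h
    filter_upwards [h.eventually_nhds] with y hy
    have dσ := hy.self_of_nhds.1.differentiableAt_of_infty
    have dν := hy.self_of_nhds.2.1.differentiableAt_of_infty
    refine ⟨dσ, fun i => ?_⟩
    have e : r =ᶠ[𝓝 y] fun y => D.a (σ y) + ν y • D.b := hy.mono fun z hz => hz.2.2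
    have da := D.hasDerivAt_curve (σ y)
    rw [pd_congr e, pd_add (show DifferentiableAt ℝ (fun y => D.a (σ y)) y from
      da.differentiableAt.comp y dσ) (dν.fun_smul (differentiableAt_const D.b)),
      pd_comp_curve da dσ, pd_smul dν (differentiableAt_const _), pd_const, smul_zero, zero_add]
  have hσx : ContDiffAt ℝ ∞ σ x := hr.self_of_nhds.1
  have hσ₁x : ContDiffAt ℝ ∞ σ₁ x := hr₁.self_of_nhds.1
  -- Both curve normals are normal to the same surface, because `D.T` and `D.b` span its tangent
  -- plane and `D₁.N` is orthogonal to `dr`.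
  have hfr : ∀ᶠ y in 𝓝 x, D₁.N (σ₁ y) = (inner ℝ (D.N (σ y)) (D₁.N (σ₁ y)) : ℝ) • D.N (σ y) := by
    filter_upwards [him, key D σ ν hr, key D₁ σ₁ ν₁ hr₁] with y hy ⟨_, h1⟩ ⟨_, h2⟩
    have hJ := hy.cr_ne
    rw [h1, h1] at hJ
    replace hJ := jacobian_ne_zero hJ
    have o := orthonormal_iff_ite.1 (D₁.orthonormal (σ₁ y))
    have o1 : inner ℝ (D₁.T (σ₁ y)) (D₁.N (σ₁ y)) = (0 : ℝ) := o 0 1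
    have o2 : inner ℝ D₁.b (D₁.N (σ₁ y)) = (0 : ℝ) := o 2 1
    have h3 : ∀ i, pd i σ y * inner ℝ (D.T (σ y)) (D₁.N (σ₁ y))
        + pd i ν y * inner ℝ D.b (D₁.N (σ₁ y)) = 0 := fun i => by
      have h4 : inner ℝ (pd i r y) (D₁.N (σ₁ y)) = (0 : ℝ) := by
        rw [h2, inner_add_left, real_inner_smul_left, real_inner_smul_left, o1, o2]
        ring
      rwa [h1, inner_add_left, real_inner_smul_left, real_inner_smul_left] at h4
    have h5 : inner ℝ (D.T (σ y)) (D₁.N (σ₁ y)) = (0 : ℝ) :=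
      (mul_eq_zero.1 (by linear_combination pd 1 ν y * h3 0 - pd 0 ν y * h3 1)).resolve_left hJ
    have h6 : inner ℝ D.b (D₁.N (σ₁ y)) = (0 : ℝ) :=
      (mul_eq_zero.1 (by linear_combination pd 0 σ y * h3 1 - pd 1 σ y * h3 0)).resolve_left hJ
    have h7 := eq_sum_of_orthonormal (D.orthonormal (σ y)) (D₁.N (σ₁ y))
    rwa [h5, h6, zero_smul, zero_smul, zero_add, add_zero] at h7
  have hunit : ∀ {u v : E3}, inner ℝ u u = (1 : ℝ) → inner ℝ v v = (1 : ℝ) →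
      v = (inner ℝ u v : ℝ) • u → (inner ℝ u v : ℝ) * inner ℝ u v = 1 := fun {u v} hu hv h => by
    have h2 : inner ℝ v v = (inner ℝ u v : ℝ) * inner ℝ u v * inner ℝ u u := by
      conv_lhs => rw [h]
      rw [real_inner_smul_left, real_inner_smul_right]
      ring
    rw [hv, hu, mul_one] at h2
    exact h2.symm
  have hNN : ∀ (D : Directrix) s, inner ℝ (D.N s) (D.N s) = (1 : ℝ) := fun D s =>
    (orthonormal_iff_ite.1 (D.orthonormal s)) 1 1
  have hTT : ∀ (D : Directrix) s, inner ℝ (D.T s) (D.T s) = (1 : ℝ) := fun D s =>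
    (orthonormal_iff_ite.1 (D.orthonormal s)) 0 0
  have hTb : ∀ (D : Directrix) s, inner ℝ (D.T s) D.b = (0 : ℝ) := fun D s =>
    (orthonormal_iff_ite.1 (D.orthonormal s)) 0 2
  have hNb : ∀ (D : Directrix) s, inner ℝ (D.N s) D.b = (0 : ℝ) := fun D s =>
    (orthonormal_iff_ite.1 (D.orthonormal s)) 1 2
  have cT : ∀ (D : Directrix) {σ : E2 → ℝ}, ContinuousAt σ x →
      ContinuousAt (fun y => D.T (σ y)) x := fun D σ hσ =>
    (D.hasDerivAt_tangent (σ x)).continuousAt.comp (f := σ) hσ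
  have cN : ∀ (D : Directrix) {σ : E2 → ℝ}, ContinuousAt σ x →
      ContinuousAt (fun y => D.N (σ y)) x := fun D σ hσ =>
    (D.hasDerivAt_normal (σ x)).continuousAt.comp (f := σ) hσ
  set δ : ℝ := inner ℝ (D.N (σ x)) (D₁.N (σ₁ x)) with hδ
  have hδev := eventually_eq_of_sq_eq_one
    ((cN D hσx.continuousAt).inner (cN D₁ hσ₁x.continuousAt))
    (hfr.mono fun y hy => hunit (hNN D _) (hNN D₁ _) hy)
  have hδ2 : δ * δ = 1 := hunit (hNN D _) (hNN D₁ _) hfr.self_of_nhds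
  have hN : ∀ᶠ y in 𝓝 x, D₁.N (σ₁ y) = δ • D.N (σ y) := by
    filter_upwards [hfr, hδev] with y h1 h2
    rw [h2] at h1
    exact h1
  -- Differentiating `N₁ = δ N` compares the tangents; as the curvatures do not vanish, the tangents
  -- are parallel, and so are the rulings.
  have hκT : ∀ᶠ y in 𝓝 x, ∀ i, (pd i σ₁ y * D₁.κ (σ₁ y)) • D₁.T (σ₁ y)
      = (δ * pd i σ y * D.κ (σ y)) • D.T (σ y) := by
    filter_upwards [hN.eventually_nhds, key D σ ν hr, key D₁ σ₁ ν₁ hr₁] with y hy ⟨d, _⟩ ⟨d₁, _⟩ i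
    have := pd_congr (i := i) (show (fun y => D₁.N (σ₁ y)) =ᶠ[𝓝 y] fun y => δ • D.N (σ y) from hy)
    rw [pd_comp_curve (D₁.hasDerivAt_normal _) d₁,
      pd_comp_curve (γ := fun s => δ • D.N s) ((D.hasDerivAt_normal _).const_smul δ) d] at this
    simp only [smul_neg, neg_inj, smul_smul] at this
    rw [this]
    congr 1
    ring
  obtain ⟨k, hk⟩ : ∃ k, pd k σ x ≠ 0 := by
    by_contra! H
    have hJ := him.self_of_nhds.cr_ne
    rw [(key D σ ν hr).self_of_nhds.2, (key D σ ν hr).self_of_nhds.2] at hJ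
    replace hJ := jacobian_ne_zero hJ
    rw [H 0, H 1] at hJ
    simp at hJ
  have hkev : ∀ᶠ y in 𝓝 x, pd k σ y ≠ 0 := (contDiffAt_pd hσx).continuousAt.eventually_ne hk
  have hδ0 : δ ≠ 0 := fun h0 => by rw [h0] at hδ2; norm_num at hδ2
  have hT' : ∀ᶠ y in 𝓝 x, D₁.T (σ₁ y) = (inner ℝ (D.T (σ y)) (D₁.T (σ₁ y)) : ℝ) • D.T (σ y) := by
    filter_upwards [hκT, hkev] with y h1 h2
    have hc : δ * pd k σ y * D.κ (σ y) ≠ 0 :=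
      mul_ne_zero (mul_ne_zero hδ0 h2) (D.curvature_ne _)
    have h3 : pd k σ₁ y * D₁.κ (σ₁ y) ≠ 0 := fun h0 => by
      have := h1 k
      rw [h0, zero_smul] at this
      have h4 := (smul_eq_zero.1 this.symm).resolve_left hc
      have := hTT D (σ y)
      rw [h4, inner_zero_left] at this
      exact zero_ne_one this
    have h4 : D₁.T (σ₁ y) = ((pd k σ₁ y * D₁.κ (σ₁ y))⁻¹ * (δ * pd k σ y * D.κ (σ y))) • D.T (σ y) := by
      rw [← smul_smul, ← h1 k, inv_smul_smul₀ h3]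
    have h5 : (inner ℝ (D.T (σ y)) (D₁.T (σ₁ y)) : ℝ)
        = (pd k σ₁ y * D₁.κ (σ₁ y))⁻¹ * (δ * pd k σ y * D.κ (σ y)) := by
      rw [h4, real_inner_smul_right, hTT, mul_one]
    rw [h5]
    exact h4
  set ε : ℝ := inner ℝ (D.T (σ x)) (D₁.T (σ₁ x)) with hε
  have hεev := eventually_eq_of_sq_eq_one
    ((cT D hσx.continuousAt).inner (cT D₁ hσ₁x.continuousAt))
    (hT'.mono fun y hy => hunit (hTT D _) (hTT D₁ _) hy)
  have hε2 : ε * ε = 1 := hunit (hTT D _) (hTT D₁ _) hT'.self_of_nhds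
  have hT : ∀ᶠ y in 𝓝 x, D₁.T (σ₁ y) = ε • D.T (σ y) := by
    filter_upwards [hT', hεev] with y h1 h2
    rw [h2] at h1
    exact h1
  have hε0 : ε ≠ 0 := fun h0 => by rw [h0] at hε2; norm_num at hε2
  have hTb₁ : inner ℝ (D.T (σ x)) D₁.b = (0 : ℝ) := by
    have := hTb D₁ (σ₁ x)
    rw [hT.self_of_nhds, real_inner_smul_left] at this
    exact (mul_eq_zero.1 this).resolve_left hε0
  have hNb₁ : inner ℝ (D.N (σ x)) D₁.b = (0 : ℝ) := by
    have := hNb D₁ (σ₁ x)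
    rw [hN.self_of_nhds, real_inner_smul_left] at this
    exact (mul_eq_zero.1 this).resolve_left hδ0
  have hb₁ : D₁.b = (inner ℝ D.b D₁.b : ℝ) • D.b := by
    have := eq_sum_of_orthonormal (D.orthonormal (σ x)) D₁.b
    rwa [hTb₁, hNb₁, zero_smul, zero_smul, zero_add, zero_add] at this
  have hdσ : ∀ᶠ y in 𝓝 x, ∀ i, pd i σ₁ y = ε * pd i σ y := by
    filter_upwards [hT, key D σ ν hr, key D₁ σ₁ ν₁ hr₁] with y h0 ⟨_, h1⟩ ⟨_, h2⟩ i
    have h3 : inner ℝ (pd i r y) (D₁.T (σ₁ y)) = pd i σ₁ y := by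
      rw [h2, inner_add_left, real_inner_smul_left, real_inner_smul_left, hTT,
        real_inner_comm, hTb]
      ring
    rw [h0, real_inner_smul_right, h1, inner_add_left, real_inner_smul_left, real_inner_smul_left,
      hTT, real_inner_comm, hTb] at h3
    linear_combination -h3
  set c : ℝ := σ₁ x - ε * σ x with hc
  have hσσ : ∀ᶠ y in 𝓝 x, σ₁ y = ε * σ y + c := by
    obtain ⟨ρ, hρ, hball⟩ := Metric.eventually_nhds_iff_ball.1
      (hdσ.and ((key D σ ν hr).and (key D₁ σ₁ ν₁ hr₁)))
    refine Metric.eventually_nhds_iff_ball.2 ⟨ρ, hρ, fun y hy => ?_⟩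
    have hd : ∀ z ∈ Metric.ball x ρ, DifferentiableAt ℝ (fun z => σ₁ z - ε * σ z) z := fun z hz =>
      (hball z hz).2.2.1.fun_sub ((hball z hz).2.1.1.const_mul ε)
    have := (convex_ball x ρ).is_const_of_fderivWithin_eq_zero (𝕜 := ℝ)
      (fun z hz => (hd z hz).differentiableWithinAt)
      (fun z hz => by
        rw [fderivWithin_of_isOpen Metric.isOpen_ball hz]
        ext1 a
        have h1 : ∀ i, pd i (fun z => σ₁ z - ε * σ z) z = 0 := fun i => by
          rw [pd_sub (hball z hz).2.2.1 ((hball z hz).2.1.1.const_mul ε),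
            pd_mul (differentiableAt_const ε) (hball z hz).2.1.1, pd_const, (hball z hz).1 i]
          ring
        rw [fderiv_eq_pd, h1, h1]
        simp) hy (Metric.mem_ball_self hρ)
    rw [hc, ← this]
    ring
  have hκ : ∀ᶠ y in 𝓝 x, D₁.κ (ε * σ y + c) = δ * D.κ (σ y) := by
    filter_upwards [hκT, hkev, hdσ, hT, hσσ] with y h1 h2 h3 h4 h5
    have h7 := h1 k
    rw [h4, h5] at h7
    have h6 := congrArg (fun v => (inner ℝ (D.T (σ y)) v : ℝ)) h7
    simp only [real_inner_smul_right, hTT, h3 k] at h6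
    refine mul_left_cancel₀ h2 ?_
    linear_combination h6 - pd k σ y * D₁.κ (ε * σ y + c) * hε2
  -- Since `dσ ≠ 0`, `σ` is open at `x`. The curvature identity therefore holds on an interval of
  -- parameters, and analyticity extends it to all of `ℝ`.
  have hmap : map σ (𝓝 x) = 𝓝 (σ x) := by
    have hs := hσx.hasStrictFDerivAt (by simp)
    refine hs.map_nhds_eq_of_surj ?_
    rw [LinearMap.range_eq_top]
    intro t
    refine ⟨(t / pd k σ x) • EuclideanSpace.single k 1, ?_⟩
    have : fderiv ℝ σ x (EuclideanSpace.single k 1) = pd k σ x := rfl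
    simp [this, hk]
  have hκ' : ∀ s, D₁.κ (ε * s + c) = δ * D.κ s := by
    have han : ∀ {u : ℝ → ℝ}, ContDiff ℝ ω u → AnalyticOnNhd ℝ u Set.univ := fun hu s _ =>
      hu.contDiffAt.analyticAt
    have h1 : ContDiff ℝ ω fun s => D₁.κ (ε * s + c) :=
      D₁.contDiff_curvature.comp ((contDiff_const.mul contDiff_id).add contDiff_const)
    have h2 : ContDiff ℝ ω fun s => δ * D.κ s := contDiff_const.mul D.contDiff_curvature
    refine congrFun ((han h1).eq_of_eventuallyEq (han h2) (z₀ := σ x) ?_)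
    rw [EventuallyEq, ← hmap, eventually_map]
    exact hκ
  have hlin : ∀ s, HasDerivAt (fun s => ε * s + c) ε s := fun s => by
    simpa using ((hasDerivAt_id s).const_mul ε).add_const c
  have hfr := frenet_unique (S := Set.univ) (T := fun s => ε • D₁.T (ε * s + c))
    (N := fun s => δ • D₁.N (ε * s + c)) (T₁ := D.T) (N₁ := D.N) (κ := D.κ) isOpen_univ
    isPreconnected_univ
    (fun s _ => (((D₁.hasDerivAt_tangent _).scomp s (hlin s)).const_smul ε).congr_deriv (by
      simp only [hκ', smul_smul]
      congr 1
      linear_combination (δ * D.κ s) * hε2))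
    (fun s _ => (((D₁.hasDerivAt_normal _).scomp s (hlin s)).const_smul δ).congr_deriv (by
      simp only [hκ', smul_smul, smul_neg]
      congr 2
      linear_combination (ε * D.κ s) * hδ2))
    (fun s _ => D.hasDerivAt_tangent s) (fun s _ => D.hasDerivAt_normal s) (Set.mem_univ (σ x))
    (by simp only [← hσσ.self_of_nhds, hT.self_of_nhds, smul_smul, hε2, one_smul])
    (by simp only [← hσσ.self_of_nhds, hN.self_of_nhds, smul_smul, hδ2, one_smul])
  have hd : ∀ s, HasDerivAt (fun s => D₁.a (ε * s + c) - D.a s) 0 s := fun s =>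
    (((D₁.hasDerivAt_curve _).scomp s (hlin s)).sub (D.hasDerivAt_curve s)).congr_deriv (by
      rw [← (hfr s (Set.mem_univ s)).1, sub_self])
  refine ⟨ε, c, ν x - ν₁ x * inner ℝ D.b D₁.b, inner ℝ D.b D₁.b, hε2, hb₁, fun s => ?_⟩
  have h1 := is_const_of_deriv_eq_zero (fun s => (hd s).differentiableAt) (fun s => (hd s).deriv)
    s (σ x)
  have h2 : D₁.a (σ₁ x) + ν₁ x • D₁.b = D.a (σ x) + ν x • D.b :=
    hr₁.self_of_nhds.2.2.symm.trans hr.self_of_nhds.2.2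
  rw [hb₁, smul_smul, hσσ.self_of_nhds, ← eq_sub_iff_add_eq] at h2
  rw [sub_eq_iff_eq_add] at h1
  rw [h1, h2]
  module

/-! ### Harmonic multiples of the normal and separation of variables -/

section FlatCalculus

variable {V : Type*} [NormedAddCommGroup V] [NormedSpace ℝ V]

theorem hasDerivAt_slice_fst {u : ℝ × ℝ → V} {s v : ℝ} (h : DifferentiableAt ℝ u (s, v)) :
    HasDerivAt (fun s => u (s, v)) (fderiv ℝ u (s, v) (1, 0)) s :=
  h.hasFDerivAt.comp_hasDerivAt s ((hasDerivAt_id s).prodMk (hasDerivAt_const s v))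

theorem hasDerivAt_slice_snd {u : ℝ × ℝ → V} {s v : ℝ} (h : DifferentiableAt ℝ u (s, v)) :
    HasDerivAt (fun v => u (s, v)) (fderiv ℝ u (s, v) (0, 1)) v :=
  h.hasFDerivAt.comp_hasDerivAt v ((hasDerivAt_const v s).prodMk (hasDerivAt_id v))

theorem fderiv_smul_fst {φ : ℝ × ℝ → ℝ} {W : ℝ → V} {W' : V} {z : ℝ × ℝ}
    (hφ : DifferentiableAt ℝ φ z) (hW : HasDerivAt W W' z.1) (e : ℝ × ℝ) :
    fderiv ℝ (fun z => φ z • W z.1) z e = fderiv ℝ φ z e • W z.1 + φ z • e.1 • W' := by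
  have h1 : HasFDerivAt (fun z : ℝ × ℝ => W z.1) _ z :=
    hW.hasFDerivAt.comp (f := Prod.fst) z hasFDerivAt_fst
  rw [(hφ.hasFDerivAt.fun_smul h1).fderiv]
  simp [add_comm]

theorem contDiffAt_fderiv_apply {u : ℝ × ℝ → V} {z : ℝ × ℝ} (h : ContDiffAt ℝ ∞ u z) (e : ℝ × ℝ) :
    ContDiffAt ℝ ∞ (fun z => fderiv ℝ u z e) z :=
  (h.fderiv_right (m := ∞) (by simp)).clm_apply contDiffAt_const

theorem contDiffAt_deriv {u : ℝ → V} {s : ℝ} (h : ContDiffAt ℝ ∞ u s) :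
    ContDiffAt ℝ ∞ (deriv u) s :=
  (h.fderiv_right (m := ∞) (by simp)).clm_apply contDiffAt_const

/-- The equations satisfied by a function `φ` and a plane curve with normal `N` for which `φ N` is
harmonic on the cylinder over the curve. -/
theorem harmonic_normal {S : Set (ℝ × ℝ)} (hS : IsOpen S) {φ : ℝ × ℝ → ℝ} {T N : ℝ → E3}
    {κ κ' : ℝ → ℝ} (hφ : ∀ z ∈ S, ContDiffAt ℝ ∞ φ z)
    (hT : ∀ z ∈ S, HasDerivAt T (κ z.1 • N z.1) z.1)
    (hN : ∀ z ∈ S, HasDerivAt N (-(κ z.1 • T z.1)) z.1)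
    (hκ : ∀ z ∈ S, HasDerivAt κ (κ' z.1) z.1)
    (hNN : ∀ z ∈ S, inner ℝ (N z.1) (N z.1) = (1 : ℝ))
    (hTT : ∀ z ∈ S, inner ℝ (T z.1) (T z.1) = (1 : ℝ))
    (hTN : ∀ z ∈ S, inner ℝ (T z.1) (N z.1) = (0 : ℝ)) {z : ℝ × ℝ} (hz : z ∈ S)
    (h : fderiv ℝ (fun w => fderiv ℝ (fun z => φ z • N z.1) w (1, 0)) z (1, 0)
        + fderiv ℝ (fun w => fderiv ℝ (fun z => φ z • N z.1) w (0, 1)) z (0, 1) = 0) :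
    fderiv ℝ (fun w => fderiv ℝ φ w (1, 0)) z (1, 0)
        + fderiv ℝ (fun w => fderiv ℝ φ w (0, 1)) z (0, 1) = κ z.1 ^ 2 * φ z ∧
      2 * fderiv ℝ φ z (1, 0) * κ z.1 + φ z * κ' z.1 = 0 := by
  have dφ := fun w hw => (hφ w hw).differentiableAt_of_infty
  have e1 : (fun w => fderiv ℝ (fun z => φ z • N z.1) w (1, 0))
      =ᶠ[𝓝 z] fun w => fderiv ℝ φ w (1, 0) • N w.1 - (φ w * κ w.1) • T w.1 := by
    filter_upwards [hS.mem_nhds hz] with w hw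
    rw [fderiv_smul_fst (dφ w hw) (hN w hw)]
    module
  have e2 : (fun w => fderiv ℝ (fun z => φ z • N z.1) w (0, 1))
      =ᶠ[𝓝 z] fun w => fderiv ℝ φ w (0, 1) • N w.1 := by
    filter_upwards [hS.mem_nhds hz] with w hw
    rw [fderiv_smul_fst (dφ w hw) (hN w hw)]
    module
  have d1 := (contDiffAt_fderiv_apply (hφ z hz) (1, 0)).differentiableAt_of_infty
  have d2 := (contDiffAt_fderiv_apply (hφ z hz) (0, 1)).differentiableAt_of_infty
  have dκ : DifferentiableAt ℝ (fun w : ℝ × ℝ => κ w.1) z :=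
    (hκ z hz).differentiableAt.comp (f := Prod.fst) z differentiableAt_fst
  have dN : DifferentiableAt ℝ (fun w : ℝ × ℝ => N w.1) z :=
    (hN z hz).differentiableAt.comp (f := Prod.fst) z differentiableAt_fst
  have dT : DifferentiableAt ℝ (fun w : ℝ × ℝ => T w.1) z :=
    (hT z hz).differentiableAt.comp (f := Prod.fst) z differentiableAt_fst
  have e3 : fderiv ℝ (fun w : ℝ × ℝ => φ w * κ w.1) z (1, 0)
      = fderiv ℝ φ z (1, 0) * κ z.1 + φ z * κ' z.1 := by
    have := fderiv_smul_fst (dφ z hz) (hκ z hz) (1, 0)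
    simpa using this
  rw [e1.fderiv_eq, e2.fderiv_eq, fderiv_fun_sub (d1.fun_smul dN) (((dφ z hz).fun_mul dκ).fun_smul dT),
    sub_apply, fderiv_smul_fst d1 (hN z hz), fderiv_smul_fst d2 (hN z hz),
    fderiv_smul_fst ((dφ z hz).fun_mul dκ) (hT z hz), e3] at h
  have hNT : inner ℝ (N z.1) (T z.1) = (0 : ℝ) := by rw [real_inner_comm, hTN z hz]
  -- The normal and tangential components of the Laplacian are the two asserted equations.
  have h1 := congrArg (fun v => (inner ℝ (N z.1) v : ℝ)) h
  have h2 := congrArg (fun v => (inner ℝ (T z.1) v : ℝ)) h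
  simp only [inner_add_right, inner_sub_right, inner_neg_right, real_inner_smul_right, hNN z hz,
    hTT z hz, hTN z hz, hNT, inner_zero_right] at h1 h2
  constructor
  · linear_combination h1
  · linear_combination -h2

/-- Separation of variables in the equations of `harmonic_normal`. -/
theorem radius_ode {s₀ v₀ ε : ℝ} (hε : 0 < ε) {φ : ℝ × ℝ → ℝ} {κ κ₁ κ₂ : ℝ → ℝ}
    (hφ : ∀ z ∈ Metric.ball (s₀, v₀) ε, ContDiffAt ℝ ∞ φ z)
    (hφ0 : ∀ z ∈ Metric.ball (s₀, v₀) ε, φ z ≠ 0)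
    (hκ : ∀ s ∈ Metric.ball s₀ ε, HasDerivAt κ (κ₁ s) s)
    (hκ₁ : ∀ s ∈ Metric.ball s₀ ε, HasDerivAt κ₁ (κ₂ s) s)
    (hκ0 : ∀ s ∈ Metric.ball s₀ ε, κ s ≠ 0)
    (h1 : ∀ z ∈ Metric.ball (s₀, v₀) ε, fderiv ℝ (fun w => fderiv ℝ φ w (1, 0)) z (1, 0)
        + fderiv ℝ (fun w => fderiv ℝ φ w (0, 1)) z (0, 1) = κ z.1 ^ 2 * φ z)
    (h2 : ∀ z ∈ Metric.ball (s₀, v₀) ε,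
      2 * fderiv ℝ φ z (1, 0) * κ z.1 + φ z * κ₁ z.1 = 0) :
    ∃ K : ℝ, ∀ s ∈ Metric.ball s₀ ε,
      4 * κ s ^ 4 + 2 * κ s * κ₂ s - 3 * κ₁ s ^ 2 = 4 * K * κ s ^ 2 := by
  have hm : ∀ {s v : ℝ}, s ∈ Metric.ball s₀ ε → v ∈ Metric.ball v₀ ε →
      (s, v) ∈ Metric.ball (s₀, v₀) ε := fun hs hv => by
    rw [← ball_prod_same]
    exact ⟨hs, hv⟩
  have hs₀ := Metric.mem_ball_self (x := s₀) hε
  have hv₀ := Metric.mem_ball_self (x := v₀) hε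
  have dφ := fun z hz => (hφ z hz).differentiableAt_of_infty
  -- By the second equation `∂ₛ log |φ| = -κ' / (2κ)` does not involve `v`, so `φ(s, v) / φ(s, v₀)`
  -- is constant in `s`.
  have hsep : ∀ s ∈ Metric.ball s₀ ε, ∀ v ∈ Metric.ball v₀ ε,
      φ (s, v) = φ (s, v₀) / φ (s₀, v₀) * φ (s₀, v) := fun s hs v hv => by
    have hd : ∀ s ∈ Metric.ball s₀ ε, HasDerivAt (fun s => φ (s, v) / φ (s, v₀)) 0 s :=
      fun s hs => by
        refine ((hasDerivAt_slice_fst (dφ _ (hm hs hv))).fun_div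
          (hasDerivAt_slice_fst (dφ _ (hm hs hv₀))) (hφ0 _ (hm hs hv₀))).congr_deriv ?_
        rw [div_eq_zero_iff]
        left
        refine (mul_eq_zero.1 (?_ : κ s * _ = 0)).resolve_left (hκ0 s hs)
        linear_combination (1 / 2) * φ (s, v₀) * h2 _ (hm hs hv)
          - (1 / 2) * φ (s, v) * h2 _ (hm hs hv₀)
    have := Metric.isOpen_ball.is_const_of_deriv_eq_zero (convex_ball s₀ ε).isPreconnected
      (fun s hs => (hd s hs).differentiableAt.differentiableWithinAt)
      (fun s hs => (hd s hs).deriv) hs hs₀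
    have n1 := hφ0 _ (hm hs hv₀)
    have n2 := hφ0 _ (hm hs₀ hv₀)
    field_simp at this ⊢
    linear_combination this
  have hφ2 : ∀ s ∈ Metric.ball s₀ ε, ∀ v ∈ Metric.ball v₀ ε, fderiv ℝ φ (s, v) (0, 1)
      = φ (s, v₀) / φ (s₀, v₀) * fderiv ℝ φ (s₀, v) (0, 1) := fun s hs v hv => by
    refine (hasDerivAt_slice_snd (dφ _ (hm hs hv))).unique
      (((hasDerivAt_slice_snd (dφ _ (hm hs₀ hv))).const_mul _).congr_of_eventuallyEq ?_)
    filter_upwards [Metric.isOpen_ball.mem_nhds hv] with v' hv'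
    exact hsep s hs v' hv'
  have dφ2 := fun z hz => (contDiffAt_fderiv_apply (hφ z hz) (0, 1)).differentiableAt_of_infty
  have dφ1 := fun z hz => (contDiffAt_fderiv_apply (hφ z hz) (1, 0)).differentiableAt_of_infty
  have hφ22 : ∀ s ∈ Metric.ball s₀ ε,
      fderiv ℝ (fun w => fderiv ℝ φ w (0, 1)) (s, v₀) (0, 1) = φ (s, v₀) / φ (s₀, v₀) *
        fderiv ℝ (fun w => fderiv ℝ φ w (0, 1)) (s₀, v₀) (0, 1) := fun s hs => by
    refine (hasDerivAt_slice_snd (dφ2 _ (hm hs hv₀))).unique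
      (((hasDerivAt_slice_snd (dφ2 _ (hm hs₀ hv₀))).const_mul _).congr_of_eventuallyEq ?_)
    filter_upwards [Metric.isOpen_ball.mem_nhds hv₀] with v' hv'
    exact hφ2 s hs v' hv'
  -- `K` is the separation constant, the value of `φ_vv / φ` along `v = v₀`. The final combination
  -- eliminates `φ_s` and `φ_ss` using the second equation and its `s`-derivative.
  refine ⟨fderiv ℝ (fun w => fderiv ℝ φ w (0, 1)) (s₀, v₀) (0, 1) / φ (s₀, v₀), fun s hs => ?_⟩
  have hz := hm hs hv₀
  have e1 := h1 _ hz
  rw [hφ22 s hs] at e1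
  have e2 := h2 _ hz
  have e3 : 2 * fderiv ℝ (fun w => fderiv ℝ φ w (1, 0)) (s, v₀) (1, 0) * κ s
      + 2 * fderiv ℝ φ (s, v₀) (1, 0) * κ₁ s
      + (fderiv ℝ φ (s, v₀) (1, 0) * κ₁ s + φ (s, v₀) * κ₂ s) = 0 := by
    refine (((((hasDerivAt_slice_fst (dφ1 _ hz)).const_mul 2).fun_mul (hκ s hs)).fun_add
      ((hasDerivAt_slice_fst (dφ _ hz)).fun_mul (hκ₁ s hs)))).unique
      ((hasDerivAt_const s (0 : ℝ)).congr_of_eventuallyEq ?_)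
    filter_upwards [Metric.isOpen_ball.mem_nhds hs] with s' hs'
    exact h2 _ (hm hs' hv₀)
  simp only at e1 e2
  have n2 := hφ0 _ (hm hs₀ hv₀)
  refine mul_left_cancel₀ (hφ0 _ hz) ?_
  linear_combination (-4 * κ s ^ 2) * e1 + (2 * κ s) * e3 - (3 * κ₁ s) * e2

end FlatCalculus

/-! ### Frenet frame of a plane curve -/

section PlaneCurve

/-- The Frenet equations of a unit speed curve orthogonal to a constant unit vector. -/
theorem frenet_of_perp {S : Set ℝ} (hS : IsOpen S) {a : ℝ → E3} {b : E3}
    (hb : inner ℝ b b = (1 : ℝ)) (ha : ∀ s ∈ S, ContDiffAt ℝ ∞ a s)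
    (hun : ∀ s ∈ S, inner ℝ (deriv a s) (deriv a s) = (1 : ℝ))
    (hperp : ∀ s ∈ S, inner ℝ (deriv a s) b = (0 : ℝ)) :
    ∃ (N : ℝ → E3) (κ : ℝ → ℝ), ∀ s ∈ S, ContDiffAt ℝ ∞ N s ∧ ContDiffAt ℝ ∞ κ s ∧
      Orthonormal ℝ ![deriv a s, N s, b] ∧ HasDerivAt (deriv a) (κ s • N s) s ∧
      HasDerivAt N (-(κ s • deriv a s)) s := by
  set N : ℝ → E3 := fun s => cr b (deriv a s) with hN
  set κ : ℝ → ℝ := fun s => inner ℝ (N s) (deriv (deriv a) s) with hκ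
  refine ⟨N, κ, fun s hs => ?_⟩
  have c1 := contDiffAt_deriv (ha s hs)
  have cN : ContDiffAt ℝ ∞ N s := contDiffAt_cr contDiffAt_const c1
  have hbT : inner ℝ b (deriv a s) = (0 : ℝ) := by rw [real_inner_comm, hperp s hs]
  have hon : Orthonormal ℝ ![deriv a s, N s, b] := by
    refine orthonormal_triple (hun s hs) ?_ hb (inner_cr_right _ _) (hperp s hs) ?_
    · simp only [hN]
      rw [inner_cr_cr, hb, hun s hs, hbT]
      ring
    · rw [real_inner_comm]; exact inner_cr_left _ _
  have dT := c1.differentiableAt_of_infty.hasDerivAt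
  have z1 : inner ℝ (deriv a s) (deriv (deriv a) s) = (0 : ℝ) := by
    have := (dT.inner ℝ dT).unique ((hasDerivAt_const s (1 : ℝ)).congr_of_eventuallyEq
      (by filter_upwards [hS.mem_nhds hs] with t ht using hun t ht))
    rw [real_inner_comm (deriv a s)] at this
    linarith
  have z2 : inner ℝ b (deriv (deriv a) s) = (0 : ℝ) := by
    have := (dT.inner ℝ (hasDerivAt_const s b)).unique
      ((hasDerivAt_const s (0 : ℝ)).congr_of_eventuallyEq
        (by filter_upwards [hS.mem_nhds hs] with t ht using hperp t ht))
    rw [inner_zero_right, zero_add] at this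
    rw [real_inner_comm, this]
  have hT' : deriv (deriv a) s = κ s • N s := by
    have := eq_sum_of_orthonormal hon (deriv (deriv a) s)
    rwa [z1, z2, zero_smul, zero_smul, zero_add, add_zero] at this
  refine ⟨cN, cN.inner ℝ (contDiffAt_deriv c1), hon, by rwa [hT'] at dT, ?_⟩
  have z3 : cr 0 (deriv a s) = 0 := by simpa using cr_smul_left 0 (deriv a s) 0
  refine (hasDerivAt_cr (hasDerivAt_const s b) dT).congr_deriv ?_
  rw [z3, zero_add, hT', cr_smul_right]
  simp only [hN]
  rw [cr_cr, hbT, hb]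
  module

end PlaneCurve

/-! ### Geometry of a cylinder and the local classification -/

section Cylinder

variable {r : E2 → E3} {x : E2} {σ ν : E2 → ℝ} {a T N : ℝ → E3} {b : E3} {κ : ℝ → ℝ} {S : Set ℝ}

theorem firstForm_cylinder (ha : ∀ s ∈ S, HasDerivAt a (T s) s)
    (hTT : ∀ s ∈ S, inner ℝ (T s) (T s) = (1 : ℝ)) (hTb : ∀ s ∈ S, inner ℝ (T s) b = (0 : ℝ))
    (hbb : inner ℝ b b = (1 : ℝ))
    (h : ∀ᶠ y in 𝓝 x, ContDiffAt ℝ ∞ σ y ∧ ContDiffAt ℝ ∞ ν y ∧ σ y ∈ S ∧ r y = a (σ y) + ν y • b) :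
    ∀ᶠ y in 𝓝 x, ∀ i j, firstForm r y i j = pd i σ y * pd j σ y + pd i ν y * pd j ν y := by
  filter_upwards [h.eventually_nhds] with y hy i j
  obtain ⟨hσ, hν, hσS, -⟩ := hy.self_of_nhds
  have dσ := hσ.differentiableAt_of_infty
  have dν := hν.differentiableAt_of_infty
  have da := ha _ hσS
  have e : r =ᶠ[𝓝 y] fun y => a (σ y) + ν y • b := hy.mono fun z hz => hz.2.2.2
  have hp : ∀ i, pd i r y = pd i σ y • T (σ y) + pd i ν y • b := fun i => by
    rw [pd_congr e, pd_add (show DifferentiableAt ℝ (fun y => a (σ y)) y from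
      da.differentiableAt.comp y dσ) (dν.fun_smul (differentiableAt_const b)),
      pd_comp_curve da dσ, pd_smul dν (differentiableAt_const _), pd_const, smul_zero, zero_add]
  have hbT : inner ℝ b (T (σ y)) = (0 : ℝ) := by rw [real_inner_comm, hTb _ hσS]
  simp only [firstForm, Matrix.of_apply, hp, inner_add_left, inner_add_right, real_inner_smul_left,
    real_inner_smul_right, hTT _ hσS, hTb _ hσS, hbT, hbb]
  ring

/-- The flat Laplacian of `a(σ) + ν b` is `a''(σ)`, which is the curvature vector of the directrix.
-/
theorem tension_cylinder (hS : IsOpen S) (ha : ∀ s ∈ S, HasDerivAt a (T s) s)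
    (hT : ∀ s ∈ S, HasDerivAt T (κ s • N s) s)
    (has : ∀ s ∈ S, ContDiffAt ℝ ∞ a s)
    (hTT : ∀ s ∈ S, inner ℝ (T s) (T s) = (1 : ℝ)) (hTb : ∀ s ∈ S, inner ℝ (T s) b = (0 : ℝ))
    (hbb : inner ℝ b b = (1 : ℝ)) (him : ImmersedAt r x)
    (h : ∀ᶠ y in 𝓝 x, ContDiffAt ℝ ∞ σ y ∧ ContDiffAt ℝ ∞ ν y ∧ σ y ∈ S ∧ r y = a (σ y) + ν y • b) :
    tension (firstForm r) r x = κ (σ x) • N (σ x) := by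
  obtain ⟨hσ, hν, hσS, -⟩ := h.self_of_nhds
  set U : ℝ × ℝ → E3 := fun z => a z.1 + z.2 • b with hU
  have e : r =ᶠ[𝓝 x] fun y => U (σ y, ν y) := h.mono fun z hz => hz.2.2.2
  have hnear : ∀ᶠ z : ℝ × ℝ in 𝓝 (σ x, ν x), z.1 ∈ S :=
    continuousAt_fst.eventually_mem (hS.mem_nhds hσS)
  have hd : ∀ z : ℝ × ℝ, z.1 ∈ S → HasFDerivAt U
      ((ContinuousLinearMap.fst ℝ ℝ ℝ).smulRight (T z.1)
        + (ContinuousLinearMap.snd ℝ ℝ ℝ).smulRight b) z := fun z hz => by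
    have h1 := (ha _ hz).hasFDerivAt.comp (f := Prod.fst) z hasFDerivAt_fst
    have h2 : HasFDerivAt (fun z : ℝ × ℝ => z.2 • b)
      ((ContinuousLinearMap.snd ℝ ℝ ℝ).smulRight b) z := hasFDerivAt_snd.smul_const b
    refine (h1.add h2).congr_fderiv (ContinuousLinearMap.ext fun w => ?_)
    simp
  have e1 : (fun z => fderiv ℝ U z (1, 0)) =ᶠ[𝓝 (σ x, ν x)] fun z => T z.1 :=
    hnear.mono fun z hz => by simp [(hd z hz).fderiv]
  have e2 : (fun z => fderiv ℝ U z (0, 1)) =ᶠ[𝓝 (σ x, ν x)] fun _ => b :=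
    hnear.mono fun z hz => by simp [(hd z hz).fderiv]
  have hUs : ContDiffAt ℝ ∞ U (σ x, ν x) :=
    ((has _ hσS).comp (f := Prod.fst) (σ x, ν x) contDiffAt_fst).add
      (contDiffAt_snd.smul contDiffAt_const)
  rw [tension, laplacian_congr e, laplacian_comp_flat hσ hν
    (h.mono fun y hy => ⟨hy.1.differentiableAt_of_infty, hy.2.1.differentiableAt_of_infty⟩)
    (firstForm_cylinder ha hTT hTb hbb h) him.metricAt.det_pos hUs
    (hnear.mono fun z hz => (hd z hz).differentiableAt), e1.fderiv_eq, e2.fderiv_eq]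
  have h3 := ((hT _ hσS).hasFDerivAt.comp (f := Prod.fst) (σ x, ν x) hasFDerivAt_fst).fderiv
  simp only [Function.comp_def] at h3
  rw [h3]
  simp

end Cylinder

/-- Where the tension field of a developable `f`-biharmonic surface does not vanish, the surface is
locally a cylinder over a directrix with curvature `κ_N`. -/
theorem exists_directrix_represents {r : E2 → E3} {x : E2} {f : E2 → ℝ}
    (h : ∀ᶠ y in 𝓝 x, ImmersedAt r y)
    (hg : ∀ᶠ y in 𝓝 x, gaussCurvature r y = 0) (hf : ∀ᶠ y in 𝓝 x, ContDiffAt ℝ ∞ f y)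
    (hf0 : ∀ᶠ y in 𝓝 x, f y ≠ 0) (hb : ∀ᶠ y in 𝓝 x, fBitension (firstForm r) f r y = 0)
    (ht : tension (firstForm r) r x ≠ 0) : ∃ D : Directrix, D.Represents r x := by
  have hx := h.self_of_nhds
  obtain ⟨b, hbb, hbn⟩ := exists_ruling_direction h hg hf hf0 hb ht
  have htc : ContDiffAt ℝ ∞ (tension (firstForm r) r) x := contDiffAt_laplacian hx.metricAt hx.smooth
  have ht' : ∀ᶠ y in 𝓝 x, tension (firstForm r) r y ≠ 0 := htc.continuousAt.eventually_ne ht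
  obtain ⟨c⟩ := exists_cylinderChart h hbb hbn
    (h.and (hf.and (hf0.and (hb.and ht')))).eventually_nhds
  obtain ⟨N, κ, hfr⟩ := frenet_of_perp Metric.isOpen_ball c.inner_dir c.smooth c.inner_deriv c.perp
  set s₀ := c.σ x with hs₀
  set v₀ := c.ν x with hv₀
  set T := deriv c.a with hT
  have hda : ∀ s ∈ Metric.ball s₀ c.ε, HasDerivAt c.a (T s) s := fun s hs =>
    (c.smooth s hs).differentiableAt_of_infty.hasDerivAt
  have hmem : ∀ {z : ℝ × ℝ}, z ∈ Metric.ball (s₀, v₀) c.ε → z.1 ∈ Metric.ball s₀ c.ε := fun hz => by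
    rw [← ball_prod_same] at hz
    exact hz.1
  have hcyl : ∀ z ∈ Metric.ball (s₀, v₀) c.ε, ∀ᶠ y in 𝓝 (c.Ψ z), ContDiffAt ℝ ∞ c.σ y ∧
      ContDiffAt ℝ ∞ c.ν y ∧ c.σ y ∈ Metric.ball s₀ c.ε ∧ r y = c.a (c.σ y) + c.ν y • c.b :=
    fun z hz => (c.inverse z hz).2.2.2.mono fun y hy => ⟨hy.1, hy.2.1, hy.2.2.1, hy.2.2.2.1⟩
  have hten : ∀ z ∈ Metric.ball (s₀, v₀) c.ε, ∀ᶠ y in 𝓝 (c.Ψ z),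
      tension (firstForm r) r y = κ (c.σ y) • N (c.σ y) := fun z hz => by
    filter_upwards [(hcyl z hz).eventually_nhds, (c.inverse z hz).1] with y h1 h2
    exact tension_cylinder Metric.isOpen_ball hda (fun s hs => (hfr s hs).2.2.2.1) c.smooth
      c.inner_deriv c.perp c.inner_dir h2.1 h1
  have hκ0 : ∀ s ∈ Metric.ball s₀ c.ε, κ s ≠ 0 := fun s hs h0 => by
    have hz : (s, v₀) ∈ Metric.ball (s₀, v₀) c.ε := by
      rw [← ball_prod_same]
      exact ⟨hs, Metric.mem_ball_self c.ε_pos⟩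
    have h1 := (hten _ hz).self_of_nhds
    have h2 := (c.inverse _ hz).1.self_of_nhds.2.2.2.2
    have h3 : c.σ (c.Ψ (s, v₀)) = s := congrArg Prod.fst (c.inverse _ hz).2.2.1
    rw [h1, h3, h0, zero_smul] at h2
    exact h2 rfl
  -- On the cylinder `τ = κ N`, so the harmonic field `f τ` becomes `φ N` in these coordinates.
  set φ : ℝ × ℝ → ℝ := fun z => f (c.Ψ z) * κ z.1 with hφ
  have hφs : ∀ z ∈ Metric.ball (s₀, v₀) c.ε, ContDiffAt ℝ ∞ φ z := fun z hz => by
    refine ContDiffAt.mul ?_ ((hfr _ (hmem hz)).2.1.comp (f := Prod.fst) z contDiffAt_fst)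
    exact (c.inverse z hz).1.self_of_nhds.2.1.comp z (c.inverse z hz).2.1
  have dκ : ∀ s ∈ Metric.ball s₀ c.ε, HasDerivAt κ (deriv κ s) s := fun s hs =>
    (hfr s hs).2.1.differentiableAt_of_infty.hasDerivAt
  have dκ₁ : ∀ s ∈ Metric.ball s₀ c.ε, HasDerivAt (deriv κ) (deriv (deriv κ) s) s := fun s hs =>
    (contDiffAt_deriv (hfr s hs).2.1).differentiableAt_of_infty.hasDerivAt
  have hharm : ∀ z ∈ Metric.ball (s₀, v₀) c.ε, _ ∧ _ := fun z hz => by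
    refine harmonic_normal (T := T) (N := N) (κ := κ) (κ' := deriv κ) (φ := φ)
      Metric.isOpen_ball hφs
      (fun z hz => (hfr _ (hmem hz)).2.2.2.1) (fun z hz => (hfr _ (hmem hz)).2.2.2.2)
      (fun z hz => dκ _ (hmem hz))
      (fun z hz => orthonormal_iff_ite.1 (hfr _ (hmem hz)).2.2.1 1 1)
      (fun z hz => orthonormal_iff_ite.1 (hfr _ (hmem hz)).2.2.1 0 0)
      (fun z hz => orthonormal_iff_ite.1 (hfr _ (hmem hz)).2.2.1 0 1) hz ?_
    obtain ⟨hS, hΨ, hinv, hloc⟩ := c.inverse z hz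
    have h1 := hS.self_of_nhds.2.2.2.1
    rw [fBitension_eq_laplacian (hS.mono fun y hy => hy.1) (hS.mono fun y hy => hy.2.1)] at h1
    set U : ℝ × ℝ → E3 := fun z => φ z • N z.1 with hU
    have e : (fun y => f y • tension (firstForm r) r y) =ᶠ[𝓝 (c.Ψ z)]
        fun y => U (c.σ y, c.ν y) := by
      filter_upwards [hten z hz, hloc] with y h2 h3
      simp only [hU, hφ, h3.2.2.2.2, h2, smul_smul]
    have hUs : ∀ z ∈ Metric.ball (s₀, v₀) c.ε, ContDiffAt ℝ ∞ U z := fun z hz =>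
      (hφs z hz).smul ((hfr _ (hmem hz)).1.comp (f := Prod.fst) z contDiffAt_fst)
    rw [laplacian_congr e, laplacian_comp_flat hloc.self_of_nhds.1 hloc.self_of_nhds.2.1
      (hloc.mono fun y hy => ⟨hy.1.differentiableAt_of_infty, hy.2.1.differentiableAt_of_infty⟩)
      (firstForm_cylinder hda c.inner_deriv c.perp c.inner_dir (hcyl z hz))
      hS.self_of_nhds.1.metricAt.det_pos (by rw [hinv]; exact hUs z hz)
      (by
        rw [hinv]
        filter_upwards [Metric.isOpen_ball.mem_nhds hz] with w hw
        exact (hUs w hw).differentiableAt_of_infty), hinv] at h1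
    exact h1
  obtain ⟨K, hK⟩ := radius_ode (v₀ := v₀) c.ε_pos hφs
    (fun z hz => mul_ne_zero (c.inverse z hz).1.self_of_nhds.2.2.1 (hκ0 _ (hmem hz))) dκ dκ₁ hκ0
    (fun z hz => (hharm z hz).1) (fun z hz => (hharm z hz).2)
  -- The equation for `κ` is rewritten for `y = 1/κ`; `z` and `w` are its first two derivatives as
  -- given by the quotient rule.
  obtain ⟨D, hDb, hDa⟩ := exists_directrix_extension (K := K) (y := fun s => (κ s)⁻¹)
    (z := fun s => -deriv κ s / κ s ^ 2)
    (w := fun s => (-deriv (deriv κ) s * κ s ^ 2 - -deriv κ s * (2 * κ s * deriv κ s))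
      / (κ s ^ 2) ^ 2) c.ε_pos
    (fun s hs => (hfr s hs).2.2.1) hda
    (fun s hs => by simpa only [inv_inv] using (hfr s hs).2.2.2.1)
    (fun s hs => by simpa only [inv_inv] using (hfr s hs).2.2.2.2)
    (fun s hs => inv_ne_zero (hκ0 s hs)) (fun s hs => (dκ s hs).fun_inv (hκ0 s hs))
    (fun s hs => ((dκ₁ s hs).fun_neg.fun_div ((dκ s hs).fun_pow 2)
      (pow_ne_zero 2 (hκ0 s hs))).congr_deriv (by simp))
    (fun s hs => by
      have h0 := hκ0 s hs
      have := hK s hs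
      field_simp
      linear_combination this)
  refine ⟨D, c.σ, c.ν, ?_⟩
  have hz : (s₀, v₀) ∈ Metric.ball (s₀, v₀) c.ε := Metric.mem_ball_self c.ε_pos
  have h1 := hcyl _ hz
  rw [c.center] at h1
  filter_upwards [h1] with y hy
  exact ⟨hy.1, hy.2.1, by rw [hDb, hDa _ hy.2.2.1]; exact hy.2.2.2⟩

/-! ### Continuation along segments -/

section Continuation

variable {r : E2 → E3}

theorem Directrix.Represents.eventually {D : Directrix} {x : E2} (h : D.Represents r x) :
    ∀ᶠ y in 𝓝 x, D.Represents r y := by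
  obtain ⟨σ, ν, h⟩ := h
  exact h.eventually_nhds.mono fun y hy => ⟨σ, ν, hy⟩

theorem Directrix.represents_of_congruent {D D₁ : Directrix} {ε c m η : ℝ} (hε : ε * ε = 1)
    (hb : D₁.b = η • D.b) (ha : ∀ s, D₁.a (ε * s + c) = D.a s + m • D.b) {x : E2}
    (h : D₁.Represents r x) : D.Represents r x := by
  obtain ⟨σ, ν, h⟩ := h
  refine ⟨fun y => ε * (σ y - c), fun y => m + ν y * η, h.mono fun y ⟨h1, h2, h3⟩ => ⟨?_, ?_, ?_⟩⟩
  · exact contDiffAt_const.mul (h1.sub contDiffAt_const)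
  · exact contDiffAt_const.add (h2.mul contDiffAt_const)
  · have := ha (ε * (σ y - c))
    rw [show ε * (ε * (σ y - c)) + c = σ y by linear_combination (σ y - c) * hε] at this
    rw [h3, this, hb]
    module

/-- Pairing `dr` with the unit tangent gives `dσ`. The parameter of the directrix thus moves no
faster than the surface point. -/
theorem Directrix.represents_fderiv {D : Directrix} {x : E2} {σ ν : E2 → ℝ}
    (h : ∀ᶠ y in 𝓝 x, ContDiffAt ℝ ∞ σ y ∧ ContDiffAt ℝ ∞ ν y ∧ r y = D.a (σ y) + ν y • D.b)
    (v : E2) : |fderiv ℝ σ x v| ≤ ‖fderiv ℝ r x v‖ := by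
  have dσ := h.self_of_nhds.1.differentiableAt_of_infty
  have dν := h.self_of_nhds.2.1.differentiableAt_of_infty
  have e : r =ᶠ[𝓝 x] fun y => D.a (σ y) + ν y • D.b := h.mono fun y hy => hy.2.2
  have hd := ((D.hasDerivAt_curve (σ x)).hasFDerivAt.comp x dσ.hasFDerivAt).fun_add
    (dν.hasFDerivAt.smul_const D.b)
  have h1 : fderiv ℝ r x v = fderiv ℝ σ x v • D.T (σ x) + fderiv ℝ ν x v • D.b := by
    rw [e.fderiv_eq]
    have := hd.fderiv
    simp only [Function.comp_def] at this
    rw [this]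
    simp
  have o := orthonormal_iff_ite.1 (D.orthonormal (σ x))
  have o1 : inner ℝ (D.T (σ x)) (D.T (σ x)) = (1 : ℝ) := o 0 0
  have o2 : inner ℝ (D.T (σ x)) D.b = (0 : ℝ) := o 0 2
  have h2 : inner ℝ (D.T (σ x)) (fderiv ℝ r x v) = fderiv ℝ σ x v := by
    rw [h1, inner_add_right, real_inner_smul_right, real_inner_smul_right, o1, o2]
    ring
  have h3 := abs_real_inner_le_norm (D.T (σ x)) (fderiv ℝ r x v)
  rwa [h2, norm_eq_one_of_inner o1, one_mul] at h3

/-- This expresses the curvature at the point by a quantity independent of the local choice of `σ`.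
It therefore makes sense along a whole segment, over which the choices of `σ` need not fit together.
-/
theorem Directrix.tension_eq {D : Directrix} {x : E2} {σ ν : E2 → ℝ}
    (him : ∀ᶠ y in 𝓝 x, ImmersedAt r y)
    (h : ∀ᶠ y in 𝓝 x, ContDiffAt ℝ ∞ σ y ∧ ContDiffAt ℝ ∞ ν y ∧ r y = D.a (σ y) + ν y • D.b) :
    ∀ᶠ y in 𝓝 x, ‖tension (firstForm r) r y‖ ^ 2 = D.κ (σ y) ^ 2 := by
  have o := fun s => orthonormal_iff_ite.1 (D.orthonormal s)
  filter_upwards [him, h.eventually_nhds] with y h1 h2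
  rw [tension_cylinder (S := Set.univ) isOpen_univ (fun s _ => D.hasDerivAt_curve s)
    (fun s _ => D.hasDerivAt_tangent s) (fun s _ => D.contDiff_curve.contDiffAt)
    (fun s _ => o s 0 0) (fun s _ => o s 0 2) (o 0 2 2) h1
    (h2.mono fun z hz => ⟨hz.1, hz.2.1, Set.mem_univ _, hz.2.2⟩), norm_smul,
    norm_eq_one_of_inner (a := D.N (σ y)) (o (σ y) 1 1), mul_one, Real.norm_eq_abs, sq_abs]

/-- Along a segment in the cylinder over a directrix the tension field does not tend to zero. -/
theorem Directrix.tension_ne_zero {D : Directrix} {x w : E2} {t₀ : ℝ} (ht₀ : 0 < t₀)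
    (him : ∀ t ∈ Set.Icc 0 t₀, ∀ᶠ y in 𝓝 (x + t • w), ImmersedAt r y)
    (h : ∀ t ∈ Set.Ico 0 t₀, D.Represents r (x + t • w)) :
    tension (firstForm r) r (x + t₀ • w) ≠ 0 := by
  have hγ : ∀ t : ℝ, HasDerivAt (fun t : ℝ => x + t • w) w t := fun t => by
    simpa using ((hasDerivAt_id t).smul_const w).const_add x
  have hmem₀ : t₀ ∈ Set.Icc 0 t₀ := Set.right_mem_Icc.2 ht₀.le
  obtain ⟨L, hL⟩ : ∃ L, ∀ t ∈ Set.Icc 0 t₀, ‖fderiv ℝ r (x + t • w) w‖ ≤ L := by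
    refine isCompact_Icc.exists_bound_of_continuousOn fun t ht => ?_
    have h1 : ContinuousAt (fun y => fderiv ℝ r y w) (x + t • w) :=
      (((him t ht).self_of_nhds.smooth.fderiv_right (m := ∞) (by simp)).clm_apply
        contDiffAt_const).continuousAt
    exact (h1.comp (f := fun t : ℝ => x + t • w) (hγ t).continuousAt).continuousWithinAt
  obtain ⟨A, hA⟩ := D.log_bound
  set τ : ℝ → ℝ := fun t => ‖tension (firstForm r) r (x + t • w)‖ ^ 2 with hτ
  have hτc : ContinuousAt τ t₀ := by
    have hm := (him t₀ hmem₀).self_of_nhds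
    have h1 : ContinuousAt (fun y => ‖tension (firstForm r) r y‖ ^ 2) (x + t₀ • w) :=
      (contDiffAt_laplacian hm.metricAt hm.smooth).continuousAt.norm.pow 2
    exact h1.comp (f := fun t : ℝ => x + t • w) (hγ t₀).continuousAt
  have hA0 : 0 ≤ A := by
    obtain ⟨d, -, hd⟩ := hA 0
    exact (abs_nonneg d).trans hd
  -- Locally `log(1 + 1/|τ|²)` is the function `log(1 + κ⁻²)` composed with `σ`; the chain rule
  -- bounds its derivative by `A` times the speed bound `L`.
  have hZ : ∀ t ∈ Set.Ico 0 t₀, 0 < τ t ∧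
      ∃ d, HasDerivAt (fun t => Real.log (1 + (τ t)⁻¹)) d t ∧ |d| ≤ A * L := fun t ht => by
    have htI : t ∈ Set.Icc 0 t₀ := Set.Ico_subset_Icc_self ht
    obtain ⟨σ, ν, hrep⟩ := h t ht
    have h1 := Directrix.tension_eq (him t htI) hrep
    obtain ⟨d, hd, hdA⟩ := hA (σ (x + t • w))
    refine ⟨?_, d * fderiv ℝ σ (x + t • w) w, ?_, ?_⟩
    · have := D.curvature_ne (σ (x + t • w))
      simp only [hτ, h1.self_of_nhds]
      positivity
    · have dσ := hrep.self_of_nhds.1.differentiableAt_of_infty.hasFDerivAt.comp_hasDerivAt t (hγ t)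
      have h2 := hd.comp t dσ
      refine h2.congr_of_eventuallyEq ?_
      filter_upwards [(hγ t).continuousAt.eventually h1] with u hu
      simp only [hτ, hu, Function.comp, inv_pow]
    · rw [abs_mul]
      exact mul_le_mul hdA ((Directrix.represents_fderiv hrep w).trans (hL t htI)) (abs_nonneg _) hA0
  -- The mean value inequality bounds the logarithm on `[0, t₀)`, hence keeps `|τ|²` above a
  -- positive constant independent of `t`; continuity then carries the bound to `t₀`.
  have hlow : ∀ t ∈ Set.Ico 0 t₀,
      Real.exp (-(Real.log (1 + (τ 0)⁻¹) + A * L * t₀)) ≤ τ t := fun t ht => by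
    choose! hpos d hd hdb using hZ
    have h0 : (0 : ℝ) ∈ Set.Ico 0 t₀ := ⟨le_rfl, ht₀⟩
    have h1 := (convex_Ico (0 : ℝ) t₀).norm_image_sub_le_of_norm_hasDerivWithin_le
      (fun t ht => (hd t ht).hasDerivWithinAt) hdb h0 ht
    rw [sub_zero, Real.norm_eq_abs, Real.norm_eq_abs, abs_of_nonneg ht.1] at h1
    have hAL : 0 ≤ A * L := mul_nonneg hA0 ((norm_nonneg _).trans (hL t₀ hmem₀))
    have h2 : Real.log (1 + (τ t)⁻¹) ≤ Real.log (1 + (τ 0)⁻¹) + A * L * t₀ := by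
      have := (le_abs_self _).trans h1
      have := mul_le_mul_of_nonneg_left ht.2.le hAL
      linarith
    have h3 : 0 < (τ t)⁻¹ := inv_pos.2 (hpos t ht)
    have h4 : (τ t)⁻¹ ≤ Real.exp (Real.log (1 + (τ 0)⁻¹) + A * L * t₀) := by
      have := Real.exp_le_exp.2 h2
      rw [Real.exp_log (by positivity)] at this
      linarith
    rw [Real.exp_neg]
    exact inv_le_of_inv_le₀ (hpos t ht) h4
  have hfin : Real.exp (-(Real.log (1 + (τ 0)⁻¹) + A * L * t₀)) ≤ τ t₀ := by
    refine ge_of_tendsto (hτc.tendsto.mono_left (nhdsWithin_le_nhds (s := Set.Iio t₀))) ?_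
    filter_upwards [Ico_mem_nhdsLT ht₀] with t ht using hlow t ht
  intro h0
  have h1 : τ t₀ = 0 := by simp [hτ, h0]
  rw [h1] at hfin
  exact absurd hfin (not_le.2 (Real.exp_pos _))

/-- The infimum of the failures would satisfy `P` by `hstep` (or `h0`), and then `P` would hold
around it by `hopen`, contradicting the infimum. -/
theorem unit_interval_induction {P : ℝ → Prop} (h0 : P 0)
    (hopen : ∀ t ∈ Set.Icc (0 : ℝ) 1, P t → ∀ᶠ s in 𝓝 t, P s)
    (hstep : ∀ t ∈ Set.Ioc (0 : ℝ) 1, (∀ s ∈ Set.Ico 0 t, P s) → P t) : P 1 := by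
  by_contra h1
  set B : Set ℝ := {t | t ∈ Set.Icc (0 : ℝ) 1 ∧ ¬P t} with hB
  have hne : B.Nonempty := ⟨1, by simp, h1⟩
  have hbdd : BddBelow B := ⟨0, fun t ht => ht.1.1⟩
  have hlow : ∀ s ∈ Set.Ico 0 (sInf B), P s := fun s hs => by
    by_contra hP
    have hs1 : s ≤ 1 := hs.2.le.trans (csInf_le hbdd ⟨by simp, h1⟩)
    exact absurd (csInf_le hbdd ⟨⟨hs.1, hs1⟩, hP⟩) (not_le.2 hs.2)
  have h01 : sInf B ∈ Set.Icc (0 : ℝ) 1 :=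
    ⟨le_csInf hne fun t ht => ht.1.1, csInf_le hbdd ⟨by simp, h1⟩⟩
  have hP : P (sInf B) := by
    rcases h01.1.eq_or_lt with h | h
    · rwa [← h]
    · exact hstep _ ⟨h, h01.2⟩ hlow
  obtain ⟨ε, hε, hball⟩ := Metric.eventually_nhds_iff_ball.1 (hopen _ h01 hP)
  obtain ⟨t, ht, hlt⟩ := exists_lt_of_csInf_lt hne (show sInf B < sInf B + ε by linarith)
  refine ht.2 (hball t ?_)
  have := csInf_le hbdd ht
  rw [Metric.mem_ball, Real.dist_eq, abs_lt]
  constructor <;> linarith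

/-- Continuation of the cylinder over a directrix along a segment. -/
theorem Directrix.represents_segment {D : Directrix} {x w : E2} {f : E2 → ℝ}
    (h : ∀ t ∈ Set.Icc (0 : ℝ) 1, ∀ᶠ y in 𝓝 (x + t • w), ImmersedAt r y ∧
      gaussCurvature r y = 0 ∧ ContDiffAt ℝ ∞ f y ∧ f y ≠ 0 ∧ fBitension (firstForm r) f r y = 0)
    (h0 : D.Represents r x) : D.Represents r (x + w) := by
  have hγ : Continuous fun t : ℝ => x + t • w := by fun_prop
  have key : D.Represents r (x + (1 : ℝ) • w) := by
    refine unit_interval_induction (P := fun t => D.Represents r (x + t • w)) (by simpa using h0)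
      (fun t _ ht => hγ.continuousAt.eventually ht.eventually) fun t ht hlt => ?_
    have hsub : Set.Icc 0 t ⊆ Set.Icc (0 : ℝ) 1 := Set.Icc_subset_Icc_right ht.2
    have htm : t ∈ Set.Icc (0 : ℝ) 1 := ⟨ht.1.le, ht.2⟩
    -- Since the tension survives at the end point, the local classification gives a directrix
    -- there. It overlaps the old cylinder slightly before the end, and rigidity identifies the two.
    have hne := Directrix.tension_ne_zero ht.1
      (fun s hs => (h s (hsub hs)).mono fun y hy => hy.1) hlt
    have ht' := h t htm
    obtain ⟨D₁, hD₁⟩ := exists_directrix_represents (ht'.mono fun y hy => hy.1)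
      (ht'.mono fun y hy => hy.2.1) (ht'.mono fun y hy => hy.2.2.1)
      (ht'.mono fun y hy => hy.2.2.2.1) (ht'.mono fun y hy => hy.2.2.2.2) hne
    have h1 : ∀ᶠ s in 𝓝[<] t, D₁.Represents r (x + s • w) :=
      (hγ.continuousAt.eventually hD₁.eventually).filter_mono nhdsWithin_le_nhds
    obtain ⟨s, hs1, hs2⟩ := (h1.and (Ico_mem_nhdsLT ht.1)).exists
    obtain ⟨ε, c, m, η, hε, hb, ha⟩ := Directrix.congruent
      ((h s (hsub (Set.Ico_subset_Icc_self hs2))).mono fun y hy => hy.1) (hlt s hs2) hs1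
    exact Directrix.represents_of_congruent hε hb ha hD₁
  rwa [one_smul] at key

end Continuation

/-! ### From charts to the connected surface -/

section Global

variable {M : Type*} [TopologicalSpace M] [ChartedSpace E2 M] [IsManifold 𝓘(ℝ, E2) ∞ M]

theorem contDiffAt_comp_symm {F : Type*} [NormedAddCommGroup F] [NormedSpace ℝ F] {u : M → F}
    {U : Set M} (hU : IsOpen U) (hu : ContMDiffOn 𝓘(ℝ, E2) 𝓘(ℝ, F) ∞ u U)
    {e : OpenPartialHomeomorph M E2} (he : e ∈ atlas E2 M) {y : E2} (hy : y ∈ e.target)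
    (hyU : e.symm y ∈ U) : ContDiffAt ℝ ∞ (u ∘ e.symm) y := by
  have h1 : ContMDiffAt 𝓘(ℝ, E2) 𝓘(ℝ, E2) ∞ e.symm y :=
    (contMDiffOn_symm_of_mem_maximalAtlas (IsManifold.subset_maximalAtlas he)).contMDiffAt
      (e.open_target.mem_nhds hy)
  exact ((hu.contMDiffAt (hU.mem_nhds hyU)).comp y h1).contDiffAt

theorem immersedAt_comp_symm {X : M → E3} (hX : IsSmoothImmersion X)
    {e : OpenPartialHomeomorph M E2} (he : e ∈ atlas E2 M) {y : E2} (hy : y ∈ e.target) :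
    ImmersedAt (X ∘ e.symm) y where
  smooth := contDiffAt_comp_symm isOpen_univ hX.1.contMDiffOn he hy (Set.mem_univ _)
  cr_ne := by
    have hd := mdifferentiable_of_mem_atlas (I := 𝓘(ℝ, E2)) he
    have hX' : MDifferentiableAt 𝓘(ℝ, E2) 𝓘(ℝ, E3) X (e.symm y) :=
      (hX.1 (e.symm y)).mdifferentiableAt (by simp)
    have hcomp := mfderiv_comp y hX' (hd.mdifferentiableAt_symm hy)
    have hinj : Function.Injective (fderiv ℝ (X ∘ e.symm) y) := by
      rw [← mfderiv_eq_fderiv, hcomp]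
      exact (hX.2 (e.symm y)).comp (hd.symm.mfderiv_injective hy)
    -- If the cross product vanished, `∂₀r × (∂₀r × ∂₁r) = 0` would be a linear relation between the
    -- partial derivatives whose coefficient at `∂₁r` is `-|∂₀r|²`. Injectivity forces `∂₀r = 0`,
    -- which again contradicts injectivity.
    intro h0
    set r := X ∘ e.symm with hr
    have h1 := cr_cr (pd 0 r y) (pd 0 r y) (pd 1 r y)
    have z : cr (pd 0 r y) 0 = 0 := by simpa using cr_smul_right (pd 0 r y) 0 0
    rw [h0, z] at h1
    set a : E2 := (inner ℝ (pd 0 r y) (pd 1 r y) : ℝ) • EuclideanSpace.single 0 1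
      - (inner ℝ (pd 0 r y) (pd 0 r y) : ℝ) • EuclideanSpace.single 1 (1 : ℝ) with ha
    have h2 : fderiv ℝ r y a = 0 := by
      rw [ha, map_sub, map_smul, map_smul]
      exact h1.symm
    have h3 : a = 0 := hinj (by rw [h2, map_zero])
    have h4 : inner ℝ (pd 0 r y) (pd 0 r y) = (0 : ℝ) := by
      have := congrArg (fun v : E2 => v 1) h3
      simpa [ha] using this
    have h5 : fderiv ℝ r y (EuclideanSpace.single 0 1) = 0 := inner_self_eq_zero.1 h4
    have h6 : (EuclideanSpace.single 0 1 : E2) = 0 := hinj (by rw [h5, map_zero])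
    have := congrArg (fun v : E2 => v 0) h6
    simp at this

/-- Near `p` the surface `X` is a part of the cylinder over the directrix `D`. -/
def Directrix.RepresentsAt (D : Directrix) (X : M → E3) (p : M) : Prop :=
  ∃ U : Set M, IsOpen U ∧ p ∈ U ∧ ∃ σ ν : M → ℝ,
    ContMDiffOn 𝓘(ℝ, E2) 𝓘(ℝ, ℝ) ∞ σ U ∧ ContMDiffOn 𝓘(ℝ, E2) 𝓘(ℝ, ℝ) ∞ ν U ∧
    ∀ q ∈ U, X q = D.a (σ q) + ν q • D.b

theorem Directrix.representsAt_iff {D : Directrix} {X : M → E3} {e : OpenPartialHomeomorph M E2}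
    (he : e ∈ atlas E2 M) {y : E2} (hy : y ∈ e.target) :
    D.RepresentsAt X (e.symm y) ↔ D.Represents (X ∘ e.symm) y := by
  constructor
  · rintro ⟨U, hU, hyU, σ, ν, hσ, hν, h⟩
    refine ⟨σ ∘ e.symm, ν ∘ e.symm, ?_⟩
    filter_upwards [e.open_target.mem_nhds hy,
      (e.continuousAt_symm hy).eventually_mem (hU.mem_nhds hyU)] with z hz hzU
    exact ⟨contDiffAt_comp_symm hU hσ he hz hzU, contDiffAt_comp_symm hU hν he hz hzU, h _ hzU⟩
  · rintro ⟨σ, ν, h⟩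
    obtain ⟨W, hW, hWo, hyW⟩ := eventually_nhds_iff.1 h
    have hsm : ∀ u : E2 → ℝ, (∀ z ∈ W, ContDiffAt ℝ ∞ u z) →
        ContMDiffOn 𝓘(ℝ, E2) 𝓘(ℝ, ℝ) ∞ (u ∘ e) (e.source ∩ e ⁻¹' W) := fun u hu q hq => by
      have h1 : ContMDiffAt 𝓘(ℝ, E2) 𝓘(ℝ, E2) ∞ e q :=
        (contMDiffOn_of_mem_maximalAtlas (IsManifold.subset_maximalAtlas he)).contMDiffAt
          (e.open_source.mem_nhds hq.1)
      exact ((hu _ hq.2).contMDiffAt.comp q h1).contMDiffWithinAt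
    refine ⟨e.source ∩ e ⁻¹' W, e.isOpen_inter_preimage hWo, ⟨e.map_target hy, ?_⟩, σ ∘ e, ν ∘ e,
      hsm σ fun z hz => (hW z hz).1, hsm ν fun z hz => (hW z hz).2.1, fun q hq => ?_⟩
    · rwa [Set.mem_preimage, e.right_inv hy]
    · have := (hW _ hq.2).2.2
      simpa only [Function.comp, e.left_inv hq.1] using this

/-- Openness is built into the definition. For closedness, a limit point is joined to a nearby
represented point by a segment inside a chart ball, and the representation is continued along it. -/
theorem Directrix.isClopen_representsAt (D : Directrix) {X : M → E3} (hX : IsSmoothImmersion X)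
    (hdev : IsDevelopable X) {f : M → ℝ} (hf : ContMDiff 𝓘(ℝ, E2) 𝓘(ℝ, ℝ) ∞ f)
    (hfpos : ∀ p : M, 0 < f p) (hbi : IsFBiharmonic f X) :
    IsClopen {p | D.RepresentsAt X p} := by
  refine ⟨isClosed_of_closure_subset fun p hp => ?_, isOpen_iff_mem_nhds.2 fun p hp => ?_⟩
  · set e := chartAt E2 p with hedef
    have he : e ∈ atlas E2 M := chart_mem_atlas E2 p
    have hps : p ∈ e.source := mem_chart_source E2 p
    have hpt : e p ∈ e.target := e.map_source hps
    obtain ⟨ρ, hρ, hball⟩ := Metric.isOpen_iff.1 e.open_target (e p) hpt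
    obtain ⟨q, ⟨hqs, hqb⟩, hq⟩ := mem_closure_iff.1 hp (e.source ∩ e ⁻¹' Metric.ball (e p) ρ)
      (e.isOpen_inter_preimage Metric.isOpen_ball) ⟨hps, Metric.mem_ball_self hρ⟩
    have hq' : D.Represents (X ∘ e.symm) (e q) := by
      rw [← Directrix.representsAt_iff he (e.map_source hqs), e.left_inv hqs]
      exact hq
    have hseg := Directrix.represents_segment (w := e p - e q) (f := f ∘ e.symm) (fun t ht => ?_) hq'
    · rw [add_sub_cancel, ← Directrix.representsAt_iff he hpt, e.left_inv hps] at hseg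
      exact hseg
    · have hmem : e q + t • (e p - e q) ∈ e.target :=
        hball ((convex_ball (e p) ρ).add_smul_sub_mem hqb (Metric.mem_ball_self hρ) ht)
      filter_upwards [e.open_target.mem_nhds hmem] with y hy
      exact ⟨immersedAt_comp_symm hX he hy, hdev e he y hy,
        contDiffAt_comp_symm isOpen_univ hf.contMDiffOn he hy (Set.mem_univ _), (hfpos _).ne',
        hbi e he y hy⟩
  · obtain ⟨U, hU, hpU, h⟩ := hp
    exact mem_of_superset (hU.mem_nhds hpU) fun q hq => ⟨U, hU, hq, h⟩

theorem laplacian_zero {V : Type*} [NormedAddCommGroup V] [NormedSpace ℝ V]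
    (g : E2 → Matrix (Fin 2) (Fin 2) ℝ) (x : E2) : laplacian g (fun _ => (0 : V)) x = 0 := by
  have : ∀ i, flux g (fun _ => (0 : V)) i = fun _ => 0 := fun i => by
    funext y
    simp [flux, pd_const]
  rw [laplacian_eq_flux, this, this, pd_const, pd_const, add_zero, smul_zero]

/-- If the tension vanished near a point, so would the bitension there. Failure of biharmonicity
thus supplies a point with `τ ≠ 0`, where the local classification applies. -/
theorem exists_directrix_representsAt {X : M → E3} (hX : IsSmoothImmersion X)
    (hdev : IsDevelopable X) {f : M → ℝ} (hf : ContMDiff 𝓘(ℝ, E2) 𝓘(ℝ, ℝ) ∞ f)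
    (hfpos : ∀ p : M, 0 < f p) (hbi : IsProperFBiharmonic f X) :
    ∃ (D : Directrix) (p : M), D.RepresentsAt X p := by
  have hnot := hbi.2
  simp only [IsBiharmonic, not_forall] at hnot
  obtain ⟨e, he, x, hx, hne⟩ := hnot
  have hex : ∃ᶠ y in 𝓝 x, tension (firstForm (X ∘ e.symm)) (X ∘ e.symm) y ≠ 0 := fun h => by
    refine hne ?_
    have h' : tension (firstForm (X ∘ e.symm)) (X ∘ e.symm) =ᶠ[𝓝 x] fun _ => 0 :=
      h.mono fun y hy => not_not.1 hy
    rw [bitension, laplacian_congr h', laplacian_zero]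
  obtain ⟨y, hy, hyt⟩ := (hex.and_eventually (e.open_target.mem_nhds hx)).exists
  have hev : ∀ᶠ z in 𝓝 y, z ∈ e.target := e.open_target.mem_nhds hyt
  obtain ⟨D, hD⟩ := exists_directrix_represents (f := f ∘ e.symm)
    (hev.mono fun z hz => immersedAt_comp_symm hX he hz) (hev.mono fun z hz => hdev e he z hz)
    (hev.mono fun z hz => contDiffAt_comp_symm isOpen_univ hf.contMDiffOn he hz (Set.mem_univ _))
    (Eventually.of_forall fun z => (hfpos _).ne') (hev.mono fun z hz => hbi.1 e he z hz) hy
  exact ⟨D, e.symm y, (Directrix.representsAt_iff he hyt).2 hD⟩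

end Global

/-! ### The circular case and the conclusion -/

theorem Directrix.isCircular (D : Directrix) (h : ∀ s t, D.κ s = D.κ t) :
    IsCircular Set.univ D.a D.b := by
  set y := (D.κ 0)⁻¹ with hy
  have hκ := D.curvature_ne 0
  -- With constant curvature the centre of curvature `a + N/κ` does not move.
  have hd : ∀ s, HasDerivAt (fun s => D.a s + y • D.N s) 0 s := fun s =>
    ((D.hasDerivAt_curve s).fun_add ((D.hasDerivAt_normal s).const_smul y)).congr_deriv (by
      rw [h s 0, hy, smul_neg, smul_smul, inv_mul_cancel₀ hκ, one_smul, add_neg_cancel])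
  refine ⟨D.a 0 + y • D.N 0, |y|, abs_pos.2 (inv_ne_zero hκ), fun s _ => ?_⟩
  have h1 := is_const_of_deriv_eq_zero (fun s => (hd s).differentiableAt) (fun s => (hd s).deriv)
    0 s
  have h2 : D.a s - (D.a 0 + y • D.N 0) = -(y • D.N s) := by
    rw [h1]
    abel
  have o := orthonormal_iff_ite.1 (D.orthonormal s)
  have o1 : inner ℝ (D.N s) (D.N s) = (1 : ℝ) := o 1 1
  have o2 : inner ℝ (D.N s) D.b = (0 : ℝ) := o 1 2
  rw [h2]
  constructor
  · rw [norm_neg, norm_smul, norm_eq_one_of_inner o1, mul_one, Real.norm_eq_abs]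
  · rw [inner_neg_left, real_inner_smul_left, o2, mul_zero, neg_zero]

end Surf

end

theorem mainTheorem2 {M : Type*} [TopologicalSpace M] [ChartedSpace E2 M]
    [IsManifold 𝓘(ℝ, E2) ∞ M] [ConnectedSpace M]
    (X : M → E3) (hX : Surf.IsSmoothImmersion X) (hdev : Surf.IsDevelopable X)
    (f : M → ℝ) (hf : ContMDiff 𝓘(ℝ, E2) 𝓘(ℝ, ℝ) ∞ f) (hfpos : ∀ p : M, 0 < f p)
    (hbi : Surf.IsProperFBiharmonic f X) :
    ∃ (I : Set ℝ) (a : ℝ → E3) (b : E3), Surf.IsCylinder X I a b ∧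
      (Surf.IsCircular I a b ∨
        ∃ κ : ℝ → ℝ, Surf.HasFrenetCurvatures I a κ (fun _ => 0) ∧
          (∃ s ∈ I, ∃ t ∈ I, κ s ≠ κ t) ∧
          ∃ K C₁ C₂ C₃ C₄ C₅ : ℝ, (K < 0 → 0 ≤ 4 * C₁ * C₂ + 1 / K) ∧
            ∀ s ∈ I, κ s = Surf.kappaN K C₁ C₂ C₃ C₄ C₅ s) := by
  obtain ⟨D, p₀, hp₀⟩ := Surf.exists_directrix_representsAt hX hdev hf hfpos hbi
  -- One directrix, defined on all of `ℝ`, represents the whole surface; this is why `I` can be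
  -- taken to be the full line.
  have huniv : {p | D.RepresentsAt X p} = Set.univ :=
    (D.isClopen_representsAt hX hdev hf hfpos hbi.1).eq_univ ⟨p₀, hp₀⟩
  have o := fun s => orthonormal_iff_ite.1 (D.orthonormal s)
  refine ⟨Set.univ, D.a, D.b, ⟨isOpen_univ, Set.ordConnected_univ, D.contDiff_curve.contDiffOn,
    fun s _ => ?_, Surf.norm_eq_one_of_inner (o 0 2 2), fun s _ => ?_, fun p => ?_⟩, ?_⟩
  · rw [(D.hasDerivAt_curve s).deriv]
    exact Surf.norm_eq_one_of_inner (o s 0 0)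
  · rw [(D.hasDerivAt_curve s).deriv]
    exact o s 0 2
  · obtain ⟨U, hU, hpU, σ, ν, hσ, hν, h⟩ : D.RepresentsAt X p := huniv.ge (Set.mem_univ p)
    exact ⟨U, hU, hpU, σ, ν, hσ, hν, fun q hq => ⟨Set.mem_univ _, h q hq⟩⟩
  · by_cases hconst : ∀ s t, D.κ s = D.κ t
    · exact Or.inl (D.isCircular hconst)
    · push Not at hconst
      obtain ⟨s, t, hst⟩ := hconst
      obtain ⟨K, C₁, C₂, C₃, C₄, C₅, hK, hprof⟩ := D.profile
      refine Or.inr ⟨D.κ, ⟨D.T, D.N, fun _ => D.b, fun s _ => ⟨D.orthonormal s,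
        D.hasDerivAt_curve s, D.hasDerivAt_tangent s, ?_, ?_⟩⟩,
        ⟨s, Set.mem_univ s, t, Set.mem_univ t, hst⟩, K, C₁, C₂, C₃, C₄, C₅, hK,
        fun s _ => hprof s⟩
      · simpa using D.hasDerivAt_normal s
      · simpa using hasDerivAt_const s D.b
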